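/- Let $\Omega$ be either (a) a bounded domain in $\mathbb{R}^2$ with $\Omega=\operatorname{int}(\overline\Omega)$, or (b) a part of the boundary of a bounded domain in $\mathbb{R}^3$. In case (b) only the compact set $\Gamma=\overline\Omega$ matters, and $H^1(\Omega)$ means the closure of the Lipschitz functions on $\Gamma$ in the norm $(\|u\|^2_{L_2(\Gamma)}+\|\nabla u\|^2_{L_2(\Gamma)})^{1/2}$, where $\nabla$ is the surface gradient and $L_2$-norms are taken with respect to the surface measure. Let $\mathcal{T}$ be a mesh on $\Omega$, i.e. a finite set of flat, compact, non-degenerate triangles with $\overline{\Omega}=\bigcup_{T\in\mathcal{T}}T$ such that the intersection of any two distinct $T_1,T_2\in\mathcal{T}$ is empty, a node of both or an edge of both. Assume that any two elements of $\mathcal{T}$ with a common node $z$ can be joined by a chain of elements of $\mathcal T$ containing $z$ as a node in which consecutive elements share an edge (this holds, for instance, if $\Omega$ is a Lipschitz domain). Put $h(T):=\operatorname{diam}(T)$ and let $\mathcal{T}$ be $\gamma$-shape-regular, i.e. $h(T)^2\le\gamma\,|T|$ for all $T\in\mathcal{T}$; in case (b) let, moreover, at most $M$ elements share any node. Let each node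 $z$ of $\mathcal{T}$ carry a weight $d_z>0$ such that, with constants $C_5,C_6>0$, for all $T\in\mathcal{T}$ and all nodes $z,z'$ of $T$, $$\frac{d_z}{d_{z'}}\le C_5\le\pi\qquad\text{and}\qquad C_6^{-1}\le\frac{d_z}{h(T)}\le C_6 .$$ Let $\mathcal{S}^1(\mathcal{T})$ be the space of globally continuous, $\mathcal{T}$-piecewise affine functions and $\Pi:L_2(\Omega)\to\mathcal{S}^1(\mathcal{T})$ the $L_2$-orthogonal projection. Then $\Pi$ is $H^1$-stable: $$\|\nabla\Pi u\|_{L_2(\Omega)}\le C_2\,\|\nabla u\|_{L_2(\Omega)}\qquad\text{for all }u\in H^1(\Omega),$$ where $C_2>0$ depends only on $C_5$, $C_6$ and $\gamma$, and in case (b) also on $M$. -/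

import Mathlib

open MeasureTheory Filter Topology Set
open scoped ContDiff

/-- A triangle is given by the finite set of its three nodes; this is the compact flat set that it
fills. -/
def triangleHull {n : ℕ} (T : Finset (EuclideanSpace ℝ (Fin n))) :
    Set (EuclideanSpace ℝ (Fin n)) :=
  convexHull ℝ (T : Set (EuclideanSpace ℝ (Fin n)))

/-- `𝒯` is a mesh (regular triangulation) of the set `S`: a finite set of nondegenerate triangles
that covers `S`, in which two distinct triangles have either nothing, or a common node, or a common
edge in common (these are the cases `e.card = 0, 1, 2` of `regular`). -/
structure IsMesh {n : ℕ} (𝒯 : Finset (Finset (EuclideanSpace ℝ (Fin n))))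
    (S : Set (EuclideanSpace ℝ (Fin n))) : Prop where
  card_eq : ∀ T ∈ 𝒯, T.card = 3
  nondegenerate : ∀ T ∈ 𝒯, AffineIndependent ℝ (fun z : T => (z : EuclideanSpace ℝ (Fin n)))
  covers : S = ⋃ T ∈ 𝒯, triangleHull T
  regular : ∀ T₁ ∈ 𝒯, ∀ T₂ ∈ 𝒯, T₁ ≠ T₂ →
    ∃ e : Finset (EuclideanSpace ℝ (Fin n)), e ⊆ T₁ ∧ e ⊆ T₂ ∧ e.card ≤ 2 ∧
      triangleHull T₁ ∩ triangleHull T₂ = triangleHull e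

/-- The element size `h(T) = diam(T)`. -/
noncomputable def elementSize {n : ℕ} (T : Finset (EuclideanSpace ℝ (Fin n))) : ℝ :=
  Metric.diam (triangleHull T)

/-- `γ`-shape regularity, `diam(T)² ≤ γ |T|` for all elements, where `μ` is the area measure. -/
def IsShapeRegular {n : ℕ} (μ : Measure (EuclideanSpace ℝ (Fin n)))
    (𝒯 : Finset (Finset (EuclideanSpace ℝ (Fin n)))) (γ : ℝ) : Prop :=
  ∀ T ∈ 𝒯, elementSize T ^ 2 ≤ γ * μ.real (triangleHull T)

/-- Any two elements with the common node `z` are joined by a chain of elements with node `z` in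
which consecutive elements share an edge (with `z` as one endpoint and `a` as the other one). -/
def HasEdgeConnectedPatches {n : ℕ} (𝒯 : Finset (Finset (EuclideanSpace ℝ (Fin n)))) : Prop :=
  ∀ z, ∀ T ∈ 𝒯, ∀ T' ∈ 𝒯, z ∈ T → z ∈ T' →
    Relation.ReflTransGen (fun A B => B ∈ 𝒯 ∧ z ∈ B ∧ ∃ a, a ≠ z ∧ a ∈ A ∧ a ∈ B) T T'

/-- At most `M` elements share a node. -/
def NodeValenceLE {n : ℕ} (𝒯 : Finset (Finset (EuclideanSpace ℝ (Fin n)))) (M : ℕ) : Prop :=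
  ∀ z, {T | T ∈ 𝒯 ∧ z ∈ T}.ncard ≤ M

/-- Positive nodal weights `d` whose ratios within each element are bounded by `C₅`, and which are
comparable to the element size with constant `C₆`. -/
structure IsNodalWeight {n : ℕ} (𝒯 : Finset (Finset (EuclideanSpace ℝ (Fin n))))
    (d : EuclideanSpace ℝ (Fin n) → ℝ) (C₅ C₆ : ℝ) : Prop where
  pos : ∀ T ∈ 𝒯, ∀ z ∈ T, 0 < d z
  ratio_le : ∀ T ∈ 𝒯, ∀ z ∈ T, ∀ z' ∈ T, d z / d z' ≤ C₅
  le_div_size : ∀ T ∈ 𝒯, ∀ z ∈ T, C₆⁻¹ ≤ d z / elementSize T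
  div_size_le : ∀ T ∈ 𝒯, ∀ z ∈ T, d z / elementSize T ≤ C₆

/-- `V` belongs to the space `S¹(𝒯)` of continuous `𝒯`-piecewise affine functions
(its values off the triangulated set are irrelevant). -/
def IsCourant {n : ℕ} (𝒯 : Finset (Finset (EuclideanSpace ℝ (Fin n))))
    (V : EuclideanSpace ℝ (Fin n) → ℝ) : Prop :=
  ContinuousOn V (⋃ T ∈ 𝒯, triangleHull T) ∧
    ∀ T ∈ 𝒯, ∃ A : EuclideanSpace ℝ (Fin n) →ᵃ[ℝ] ℝ, EqOn V A (triangleHull T)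

/-- `V = Π u`, where `Π` is the `L₂(μ)`-orthogonal projection onto `S¹(𝒯)`. -/
def IsL2Projection {n : ℕ} (𝒯 : Finset (Finset (EuclideanSpace ℝ (Fin n))))
    (μ : Measure (EuclideanSpace ℝ (Fin n))) (u V : EuclideanSpace ℝ (Fin n) → ℝ) : Prop :=
  IsCourant 𝒯 V ∧ ∀ W, IsCourant 𝒯 W → ∫ x, W x * (u x - V x) ∂μ = 0

/-- `u ∈ H¹(Ω)` with weak gradient `G`, for an open set `Ω ⊆ ℝ²`. -/
structure HasPlanarGradient (Ω : Set (EuclideanSpace ℝ (Fin 2)))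
    (u : EuclideanSpace ℝ (Fin 2) → ℝ)
    (G : EuclideanSpace ℝ (Fin 2) → EuclideanSpace ℝ (Fin 2)) : Prop where
  memLp : MemLp u 2 (volume.restrict Ω)
  memLp_grad : MemLp G 2 (volume.restrict Ω)
  weak : ∀ φ : EuclideanSpace ℝ (Fin 2) → ℝ, ContDiff ℝ ∞ φ → HasCompactSupport φ →
    tsupport φ ⊆ Ω → ∫ x in Ω, u x • gradient φ x = -∫ x in Ω, φ x • G x

/-- The surface measure of the triangulated surface with mesh `𝒯`. -/
noncomputable def surfaceMeasure {n : ℕ} (𝒯 : Finset (Finset (EuclideanSpace ℝ (Fin n)))) :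
    Measure (EuclideanSpace ℝ (Fin n)) :=
  μHE[2].restrict (⋃ T ∈ 𝒯, triangleHull T)

/-- `w` is a Lipschitz function on the triangulated surface with mesh `𝒯` (continuous, and Lipschitz
on each of the finitely many flat triangles), and `g` is its surface gradient: at almost every point
of each triangle, `g` is tangential and is the gradient of `w` along the triangle. -/
structure IsLipschitzWithSurfaceGradient {n : ℕ}
    (𝒯 : Finset (Finset (EuclideanSpace ℝ (Fin n))))
    (w : EuclideanSpace ℝ (Fin n) → ℝ)
    (g : EuclideanSpace ℝ (Fin n) → EuclideanSpace ℝ (Fin n)) : Prop where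
  continuousOn : ContinuousOn w (⋃ T ∈ 𝒯, triangleHull T)
  lipschitz : ∀ T ∈ 𝒯, ∃ K, LipschitzOnWith K w (triangleHull T)
  memLp_grad : MemLp g 2 (surfaceMeasure 𝒯)
  grad : ∀ T ∈ 𝒯, ∀ᵐ x ∂(μHE[2].restrict (triangleHull T)),
    g x ∈ vectorSpan ℝ (T : Set (EuclideanSpace ℝ (Fin n))) ∧
      HasGradientWithinAt w (g x) (triangleHull T) x

/-- `u ∈ H¹(Γ)` with surface gradient `G`, where `Γ` is the triangulated surface with mesh `𝒯`:
`H¹(Γ)` is the closure of the Lipschitz functions on `Γ` with respect to the norm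
`(‖u‖² + ‖∇u‖²)^(1/2)`. -/
def HasSurfaceGradient {n : ℕ} (𝒯 : Finset (Finset (EuclideanSpace ℝ (Fin n))))
    (u : EuclideanSpace ℝ (Fin n) → ℝ)
    (G : EuclideanSpace ℝ (Fin n) → EuclideanSpace ℝ (Fin n)) : Prop :=
  MemLp u 2 (surfaceMeasure 𝒯) ∧ MemLp G 2 (surfaceMeasure 𝒯) ∧
    ∃ (w : ℕ → EuclideanSpace ℝ (Fin n) → ℝ)
      (g : ℕ → EuclideanSpace ℝ (Fin n) → EuclideanSpace ℝ (Fin n)),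
      (∀ k, IsLipschitzWithSurfaceGradient 𝒯 (w k) (g k)) ∧
      Tendsto (fun k => eLpNorm (fun x => w k x - u x) 2 (surfaceMeasure 𝒯)) atTop (𝓝 0) ∧
      Tendsto (fun k => eLpNorm (fun x => g k x - G x) 2 (surfaceMeasure 𝒯)) atTop (𝓝 0)

/-- The `L₂(μ)`-projection `Π` onto `S¹(𝒯)` is (well defined and) `H¹`-stable with constant `C`:
`Π u` is in `H¹` and `‖∇ Π u‖ ≤ C ‖∇ u‖` in `L₂(μ)` for all `u ∈ H¹`. Here `HasGrad u G` says that
`u ∈ H¹` and `∇ u = G`. -/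
def IsH1StableProjection {n : ℕ} (𝒯 : Finset (Finset (EuclideanSpace ℝ (Fin n))))
    (μ : Measure (EuclideanSpace ℝ (Fin n)))
    (HasGrad : (EuclideanSpace ℝ (Fin n) → ℝ) →
      (EuclideanSpace ℝ (Fin n) → EuclideanSpace ℝ (Fin n)) → Prop) (C : ℝ) : Prop :=
  ∀ u G, HasGrad u G →
    (∃ V, IsL2Projection 𝒯 μ u V) ∧
    ∀ V, IsL2Projection 𝒯 μ u V →
      ∃ H, HasGrad V H ∧ eLpNorm H 2 μ ≤ ENNReal.ofReal C * eLpNorm G 2 μ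

/-! The gradient of an affine function `V` on an element `T` is controlled by the distance of its
nodal values from any constant `c`: the inverse estimate `h(T)² ‖∇V‖² ≤ C(γ) ∑ (V z - c)²` of
`IsTriangle.exists_gradient`. Hence it suffices to find constants `c T` for which `∑_T |T| / h(T)²
∑_{z ∈ T} (Πu z - c T)²` is at most a multiple of `‖∇u‖²`; this is `IsMesh.projection_estimate`.

The constants come from Poincaré's inequality on the elements. It is proved for bounded convex sets
by translations (`HasPlanarGradient.exists_poincare`), so its constant is explicit and depends on
the shape only. The constants of two elements with a common edge are compared through a second
Poincaré inequality, on a disc around the midpoint of the edge. By shape regularity the two halves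
of this disc fit into the two elements. In the plane the disc lies in `Ω`; on a surface the two
elements are unfolded isometrically and the Lipschitz approximants of `u` are glued along the edge
(the two lemmas `exists_poincare_edge`). Chains of edge neighbours then bound `c T - c T'` for all
elements at one node by the energy on the node patch (`HasLocalEstimates.sub_sq_le`). In the plane a
bound of the chain length follows from comparing areas (`IsMesh.nodeValenceLE_planar`).

Let `I` be the Courant function whose value at `z` is `c T` for one chosen element `T` at `z`. Then
`u - I`, divided by the element size, is bounded in `L₂` by `‖∇u‖`, and `Πu - I = Π(u - I)`. What
remains is the stability of `Π` in the `L₂`-norm weighted with the inverse element size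
(`IsMesh.weighted_stability`), the only place where the weights `d` have to vary slowly. For `V =
Πv`, orthogonality is tested with the Courant function `W` of nodal values `V z / d z ²`. The
element mass matrix is `|T| / 12` times the sum of the identity and the all-ones matrix, so in the
variables `y = V / d` the local form is `∑ y² + (∑ y / d) (∑ d y)`. Its smallest eigenvalue is `1 +
(3 - √((∑ d²) (∑ d⁻²))) / 2`, positive when the product of sums is below `25`. If the ratios of the
`d²` are at most `r`, that product is at most `5 + 2 (r + 1 / r)`, which is below `25` for `1 ≤ r <
5 + 2√6 ≈ 9.899`. The value `r = π² ≈ 9.870` is admissible by a small margin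
(`weighted_mass_coercive`). Young's inequality then absorbs the test function. -/

/-! ### Piecewise Lipschitz functions on convex sets -/

/-- A continuous function on a convex set that is `K`-Lipschitz on each member of a finite closed
cover is `K`-Lipschitz. -/
theorem lipschitzOnWith_of_finite_closed_cover {E ι : Type*} [NormedAddCommGroup E]
    [NormedSpace ℝ E] {s : Finset ι} {S : ι → Set E} {Ω : Set E} (hΩ : Convex ℝ Ω)
    (hS : ∀ i ∈ s, IsClosed (S i)) (hcov : Ω ⊆ ⋃ i ∈ s, S i) {f : E → ℝ}
    (hf : ContinuousOn f Ω) {K : NNReal} (hK : ∀ i ∈ s, LipschitzOnWith K f (S i ∩ Ω)) :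
    LipschitzOnWith K f Ω := by
  refine LipschitzOnWith.of_dist_le_mul fun y hy x hx => ?_
  set γ : ℝ → E := fun t => x + t • (y - x) with hγ
  have hγc : Continuous γ := by fun_prop
  have hγΩ : ∀ t ∈ Icc (0:ℝ) 1, γ t ∈ Ω := fun t ht =>
    hΩ.add_smul_sub_mem hx hy ht
  have hγd : ∀ t z, dist (γ t) (γ z) = |t - z| * dist y x := by
    intro t z
    rw [dist_eq_norm, dist_eq_norm, ← Real.norm_eq_abs, ← norm_smul]
    congr 1; simp only [hγ, sub_smul]; abel
  set g : ℝ → ℝ := fun t => f (γ t) - f x with hg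
  have hgc : ContinuousOn g (Icc 0 1) :=
    (hf.comp hγc.continuousOn hγΩ).sub continuousOn_const
  -- The comparison theorem for right slopes needs a strict inequality between derivatives, whence
  -- the slack `ε`.
  refine le_of_forall_pos_le_add fun ε hε => ?_
  have key := image_norm_le_of_liminf_right_slope_norm_lt_deriv_boundary (f := g)
    (f' := fun _ => K * dist y x) (B := fun t => (K * dist y x + ε) * t)
    (B' := fun _ => K * dist y x + ε) hgc ?_ (by simp [hg, hγ]) (by fun_prop) ?_ ?_
    (right_mem_Icc.2 zero_le_one)
  · simpa [hg, hγ, Real.dist_eq] using key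
  · intro t ht r hr
    have h1 : ∀ᶠ z in 𝓝[>] t, ∃ i ∈ s, γ z ∈ S i := by
      filter_upwards [Ioo_mem_nhdsGT ht.2] with z hz
      simpa using hcov (hγΩ z ⟨ht.1.trans hz.1.le, hz.2.le⟩)
    -- Finitely many pieces cover the segment, so one of them is met arbitrarily close to the right
    -- of `t`. Being closed it also contains `γ t`, and its Lipschitz bound controls the slopes that
    -- the liminf needs.
    obtain ⟨i, hi, hfr⟩ : ∃ i ∈ s, ∃ᶠ z in 𝓝[>] t, γ z ∈ S i := by
      by_contra! hcon
      have h2 : ∀ᶠ z in 𝓝[>] t, ∀ i ∈ s, γ z ∉ S i :=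
        (eventually_all_finset s).2 fun i hi => by
          simpa [Filter.Frequently] using hcon i hi
      obtain ⟨z, ⟨i, hi, hz⟩, hz'⟩ := (h1.and h2).exists
      exact hz' i hi hz
    have hti : γ t ∈ S i := by
      have : ∃ᶠ z in 𝓝 t, γ z ∈ S i := hfr.filter_mono nhdsWithin_le_nhds
      exact ((hS i hi).preimage hγc).closure_subset
        (mem_closure_iff_frequently.2 this)
    refine (hfr.and_eventually (Ioo_mem_nhdsGT ht.2)).mono ?_
    rintro z ⟨hz, hz1⟩
    have hL := (hK i hi).dist_le_mul (γ z) ⟨hz, hγΩ z ⟨ht.1.trans hz1.1.le, hz1.2.le⟩⟩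
      (γ t) ⟨hti, hγΩ t ⟨ht.1, ht.2.le⟩⟩
    rw [hγd, abs_of_pos (sub_pos.2 hz1.1)] at hL
    refine lt_of_le_of_lt ?_ hr
    rw [slope_def_field, div_le_iff₀ (sub_pos.2 hz1.1)]
    have h3 : ‖g z‖ - ‖g t‖ ≤ dist (f (γ z)) (f (γ t)) := by
      refine (norm_sub_norm_le _ _).trans (le_of_eq ?_)
      simp [hg, Real.dist_eq]
    calc _ ≤ dist (f (γ z)) (f (γ t)) := h3
      _ ≤ _ := hL
      _ = _ := by ring
  · intro t _
    simpa using ((hasDerivAt_id t).const_mul (K * dist y x + ε)).hasDerivWithinAt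
  · intro t _ _
    simpa using hε


/-! ### Weak gradients in the plane -/

/-- The Euclidean plane. -/
abbrev Plane : Type := EuclideanSpace ℝ (Fin 2)

theorem continuous_gradient {φ : Plane → ℝ} (hφ : ContDiff ℝ ∞ φ) : Continuous (gradient φ) :=
  (InnerProductSpace.toDual ℝ Plane).symm.continuous.comp (hφ.continuous_fderiv (by simp))

theorem hasCompactSupport_gradient {φ : Plane → ℝ} (hc : HasCompactSupport φ) :
    HasCompactSupport (gradient φ) :=
  (hc.fderiv ℝ).comp_left (g := (InnerProductSpace.toDual ℝ Plane).symm) (map_zero _)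

theorem memLp_gradient {φ : Plane → ℝ} (hφ : ContDiff ℝ ∞ φ) (hc : HasCompactSupport φ)
    (μ : Measure Plane) [IsFiniteMeasureOnCompacts μ] : MemLp (gradient φ) 2 μ :=
  (continuous_gradient hφ).memLp_of_hasCompactSupport (hasCompactSupport_gradient hc)

theorem MeasureTheory.MemLp.integrable_smul_of_two {α E : Type*} {m : MeasurableSpace α}
    {μ : Measure α} [NormedAddCommGroup E] [NormedSpace ℝ E] {f : α → ℝ} {g : α → E}
    (hf : MemLp f 2 μ) (hg : MemLp g 2 μ) : Integrable (fun x => f x • g x) μ :=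
  memLp_one_iff_integrable.1 (hg.smul hf)

/-- A vector identity holds once it holds after taking inner products with every `v`. The scalar
form is the one that meets directional derivatives of Lipschitz functions and translations in
direction `v`. -/
theorem weak_gradient_iff {Ω : Set Plane} {u : Plane → ℝ} {G : Plane → Plane}
    (hu : MemLp u 2 (volume.restrict Ω)) (hG : MemLp G 2 (volume.restrict Ω))
    {φ : Plane → ℝ} (hφ : ContDiff ℝ ∞ φ) (hc : HasCompactSupport φ) :
    ∫ x in Ω, u x • gradient φ x = -∫ x in Ω, φ x • G x ↔
      ∀ v : Plane, ∫ x in Ω, u x * fderiv ℝ φ x v = -∫ x in Ω, φ x * inner ℝ v (G x) := by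
  have h1 := hu.integrable_smul_of_two (memLp_gradient hφ hc (volume.restrict Ω))
  have h2 := (hφ.continuous.memLp_of_hasCompactSupport (p := 2)
    (μ := volume.restrict Ω) hc).integrable_smul_of_two hG
  have e1 : ∀ v : Plane, ∫ x in Ω, u x * fderiv ℝ φ x v
      = inner ℝ v (∫ x in Ω, u x • gradient φ x) := fun v => by
    rw [← integral_inner h1]
    refine integral_congr_ae (ae_of_all _ fun x => ?_)
    simp only [inner_smul_right]
    rw [real_inner_comm, inner_gradient_left]
  have e2 : ∀ v : Plane, ∫ x in Ω, φ x * inner ℝ v (G x)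
      = inner ℝ v (∫ x in Ω, φ x • G x) := fun v => by
    rw [← integral_inner h2]
    simp only [inner_smul_right]
  simp only [e1, e2, ← inner_neg_right]
  exact ⟨fun h v => by rw [h], fun h => ext_inner_left ℝ h⟩

theorem HasPlanarGradient.weak_inner {Ω : Set Plane} {u : Plane → ℝ} {G : Plane → Plane}
    (h : HasPlanarGradient Ω u G) {φ : Plane → ℝ} (hφ : ContDiff ℝ ∞ φ)
    (hc : HasCompactSupport φ) (hs : tsupport φ ⊆ Ω) (v : Plane) :
    ∫ x in Ω, u x * fderiv ℝ φ x v = -∫ x in Ω, φ x * inner ℝ v (G x) :=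
  (weak_gradient_iff h.memLp h.memLp_grad hφ hc).1 (h.weak φ hφ hc hs) v

theorem HasPlanarGradient.mono {Ω Ω' : Set Plane} {u : Plane → ℝ} {G : Plane → Plane}
    (h : HasPlanarGradient Ω u G) (hΩ : Ω' ⊆ Ω) : HasPlanarGradient Ω' u G where
  memLp := h.memLp.mono_measure (Measure.restrict_mono hΩ le_rfl)
  memLp_grad := h.memLp_grad.mono_measure (Measure.restrict_mono hΩ le_rfl)
  weak φ hφ hc hs := by
    have e1 : ∀ Ω'' : Set Plane, tsupport φ ⊆ Ω'' → ∫ x in Ω'', u x • gradient φ x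
        = ∫ x, u x • gradient φ x := fun Ω'' hs'' => by
      refine setIntegral_eq_integral_of_forall_compl_eq_zero fun x hx => ?_
      have : fderiv ℝ φ x = 0 := by
        by_contra hne
        exact hx (hs'' (tsupport_fderiv_subset ℝ (subset_closure hne)))
      simp [gradient, this]
    have e2 : ∀ Ω'' : Set Plane, tsupport φ ⊆ Ω'' → ∫ x in Ω'', φ x • G x
        = ∫ x, φ x • G x := fun Ω'' hs'' => by
      refine setIntegral_eq_integral_of_forall_compl_eq_zero fun x hx => ?_
      rw [image_eq_zero_of_notMem_tsupport fun h' => hx (hs'' h'), zero_smul]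
    rw [e1 _ hs, e2 _ hs, ← e1 _ (hs.trans hΩ), ← e2 _ (hs.trans hΩ)]
    exact h.weak φ hφ hc (hs.trans hΩ)

/-- `φ * u` is globally Lipschitz if `φ` is a test function on `Ω` and `u` is uniformly Lipschitz
on the balls in `Ω`. -/
theorem exists_lipschitzWith_mul {Ω : Set Plane} (hΩ : IsOpen Ω) {u : Plane → ℝ} {K : NNReal}
    (hL : ∀ x r, Metric.ball x r ⊆ Ω → LipschitzOnWith K u (Metric.ball x r))
    {φ : Plane → ℝ} (hφ : ContDiff ℝ ∞ φ) (hc : HasCompactSupport φ) (hs : tsupport φ ⊆ Ω) :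
    ∃ C, LipschitzWith C (fun x => φ x * u x) := by
  obtain ⟨A, hA⟩ := hφ.lipschitzWith_of_hasCompactSupport hc (by simp)
  obtain ⟨B, hB⟩ := hφ.continuous.bounded_above_of_compact_support hc
  obtain ⟨δ, hδ, hδΩ⟩ := hc.isCompact.exists_thickening_subset_open hΩ hs
  have hball : ∀ x ∈ tsupport φ, Metric.ball x δ ⊆ Ω := fun x hx =>
    (Metric.ball_subset_thickening hx δ).trans hδΩ
  have huc : ContinuousOn u Ω := by
    intro x hx
    obtain ⟨r, hr, hrΩ⟩ := Metric.isOpen_iff.1 hΩ x hx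
    exact ((hL x r hrΩ).continuousOn.continuousAt (Metric.ball_mem_nhds x hr)).continuousWithinAt
  obtain ⟨N, hN⟩ := hc.isCompact.exists_bound_of_continuousOn (huc.mono hs)
  have hB0 : 0 ≤ B := (norm_nonneg _).trans (hB 0)
  have hN' : ∀ x ∈ tsupport φ, |u x| ≤ |N| := fun x hx => (hN x hx).trans (le_abs_self _)
  have hφ0 : ∀ x ∉ tsupport φ, φ x = 0 := fun x hx => image_eq_zero_of_notMem_tsupport hx
  have hbd : ∀ x, |φ x * u x| ≤ B * |N| := by
    intro x
    by_cases hx : x ∈ tsupport φ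
    · rw [abs_mul]
      exact mul_le_mul (hB x) (hN' x hx) (abs_nonneg _) hB0
    · simp [hφ0 x hx]; positivity
  have hnear : ∀ x ∈ tsupport φ, ∀ y, dist x y < δ →
      |φ x * u x - φ y * u y| ≤ (A * |N| + B * K) * dist x y := by
    intro x hx y hxy
    have h1 : |φ x - φ y| ≤ A * dist x y := hA.dist_le_mul x y
    have h2 : |u x - u y| ≤ K * dist x y :=
      (hL x δ (hball x hx)).dist_le_mul x (Metric.mem_ball_self hδ) y
        (by rwa [Metric.mem_ball, dist_comm])
    calc |φ x * u x - φ y * u y| = |(φ x - φ y) * u x + φ y * (u x - u y)| := by ring_nf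
      _ ≤ |φ x - φ y| * |u x| + |φ y| * |u x - u y| := by
        rw [← abs_mul, ← abs_mul]; exact abs_add_le _ _
      _ ≤ (A * dist x y) * |N| + B * (K * dist x y) := by
        exact add_le_add (mul_le_mul h1 (hN' x hx) (abs_nonneg _) (by positivity))
          (mul_le_mul (hB y) h2 (abs_nonneg _) hB0)
      _ = _ := by ring
  -- The first two terms are the product rule, for points closer than `δ` with one of them in the
  -- support. The last serves points at distance at least `δ`, where boundedness of the product is
  -- enough.
  set C : ℝ := A * |N| + B * K + 2 * (B * |N|) / δ with hC
  have hC0 : 0 ≤ C := by positivity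
  refine ⟨C.toNNReal, LipschitzWith.of_dist_le_mul fun x y => ?_⟩
  rw [Real.coe_toNNReal _ hC0, Real.dist_eq]
  have hle : (A * |N| + B * K) * dist x y ≤ C * dist x y := by
    refine mul_le_mul_of_nonneg_right ?_ dist_nonneg
    rw [hC]; exact le_add_of_nonneg_right (by positivity)
  rcases lt_or_ge (dist x y) δ with h | h
  · by_cases hx : x ∈ tsupport φ
    · exact (hnear x hx y h).trans hle
    by_cases hy : y ∈ tsupport φ
    · rw [abs_sub_comm, dist_comm]
      rw [dist_comm] at h hle
      exact (hnear y hy x h).trans hle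
    · rw [hφ0 x hx, hφ0 y hy]; simp; positivity
  · calc |φ x * u x - φ y * u y| ≤ |φ x * u x| + |φ y * u y| := abs_sub _ _
      _ ≤ 2 * (B * |N|) := by linarith [hbd x, hbd y]
      _ ≤ 2 * (B * |N|) / δ * dist x y := by
        rw [div_mul_eq_mul_div, le_div_iff₀ hδ]
        exact mul_le_mul_of_nonneg_left h (by positivity)
      _ ≤ C * dist x y := by
        refine mul_le_mul_of_nonneg_right ?_ dist_nonneg
        rw [hC]; exact le_add_of_nonneg_left (by positivity)

/-- A function that is uniformly Lipschitz on the balls in `Ω` has its almost everywhere classical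
gradient as weak gradient. -/
theorem hasPlanarGradient_of_lipschitz {Ω : Set Plane} (hΩ : IsOpen Ω) {u : Plane → ℝ}
    {G : Plane → Plane} {K : NNReal} (hu : MemLp u 2 (volume.restrict Ω))
    (hG : MemLp G 2 (volume.restrict Ω))
    (hL : ∀ x r, Metric.ball x r ⊆ Ω → LipschitzOnWith K u (Metric.ball x r))
    (hgrad : ∀ᵐ x ∂(volume.restrict Ω), HasGradientAt u (G x) x) :
    HasPlanarGradient Ω u G := by
  refine ⟨hu, hG, fun φ hφ hc hs => (weak_gradient_iff hu hG hφ hc).2 fun v => ?_⟩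
  obtain ⟨C, hC⟩ := exists_lipschitzWith_mul hΩ hL hφ hc hs
  have hgc : HasCompactSupport (fun x => φ x * u x) := hc.mul_right
  -- Integration by parts against the constant function `1`: the directional derivative of the
  -- compactly supported Lipschitz function `φ u` has integral zero. Expanding it by the product
  -- rule gives the weak identity.
  have key := (LipschitzWith.const' (1 : ℝ) (K := 0) (α := Plane)).integral_lineDeriv_mul_eq
    (μ := volume) hC hgc (-v)
  have h0 : ∀ x, lineDeriv ℝ (fun _ : Plane => (1:ℝ)) x (-v) = 0 := fun x => by
    rw [lineDeriv]; simp
  simp only [h0, zero_mul, integral_zero, neg_neg, mul_one] at key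
  have hout : ∀ x ∉ Ω, lineDeriv ℝ (fun x => φ x * u x) x v = 0 := by
    intro x hx
    have hx' : x ∉ tsupport φ := fun h => hx (hs h)
    have : (fun x => φ x * u x) =ᶠ[𝓝 x] fun _ => 0 := by
      filter_upwards [(isClosed_tsupport φ).isOpen_compl.mem_nhds hx'] with y hy
      rw [image_eq_zero_of_notMem_tsupport hy, zero_mul]
    rw [this.lineDeriv_eq]
    rw [lineDeriv]; simp
  rw [← setIntegral_eq_integral_of_forall_compl_eq_zero hout] at key
  have hcongr : ∫ x in Ω, lineDeriv ℝ (fun x => φ x * u x) x v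
      = ∫ x in Ω, (u x * fderiv ℝ φ x v + φ x * inner ℝ v (G x)) := by
    refine integral_congr_ae ?_
    filter_upwards [hgrad] with x hx
    have h1 : HasFDerivAt φ (fderiv ℝ φ x) x :=
      (hφ.differentiable (by simp)).differentiableAt.hasFDerivAt
    have h2 := (h1.mul hx.hasFDerivAt).hasLineDerivAt v
    refine h2.lineDeriv.trans ?_
    simp [real_inner_comm]
    ring
  rw [hcongr, integral_add] at key
  · linarith
  · have := hu.integrable_smul_of_two (((hφ.continuous_fderiv (by simp)).clm_apply
      continuous_const).memLp_of_hasCompactSupport (p := 2) (μ := volume.restrict Ω)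
      ((hc.fderiv ℝ).comp_left (g := fun L : Plane →L[ℝ] ℝ => L v) rfl))
    simpa using this
  · have h2 := (hφ.continuous.memLp_of_hasCompactSupport (p := 2)
      (μ := volume.restrict Ω) hc).integrable_smul_of_two hG
    simpa only [inner_smul_right] using h2.const_inner (𝕜 := ℝ) v

theorem tendsto_integral_smul_of_tendsto_eLpNorm_sub {α E F : Type*} {m : MeasurableSpace α}
    {μ : Measure α} [NormedAddCommGroup E] [NormedSpace ℝ E] [NormedAddCommGroup F]
    [NormedSpace ℝ F] {w : ℕ → α → ℝ} {u : α → ℝ} {g : α → E} (hw : ∀ k, MemLp (w k) 2 μ)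
    (hu : MemLp u 2 μ) (hg : MemLp g 2 μ)
    (h : Tendsto (fun k => eLpNorm (fun x => w k x - u x) 2 μ) atTop (𝓝 0)) :
    Tendsto (fun k => ∫ x, w k x • g x ∂μ) atTop (𝓝 (∫ x, u x • g x ∂μ)) := by
  refine tendsto_integral_of_L1' _ (hu.integrable_smul_of_two hg).aestronglyMeasurable
    (Eventually.of_forall fun k => (hw k).integrable_smul_of_two hg) ?_
  have h2 : Tendsto (fun k => eLpNorm (fun x => w k x - u x) 2 μ * eLpNorm g 2 μ) atTop (𝓝 0) := by
    simpa using ENNReal.Tendsto.mul_const h (Or.inr hg.2.ne)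
  refine tendsto_of_tendsto_of_tendsto_of_le_of_le tendsto_const_nhds h2 (fun _ => zero_le)
    fun k => ?_
  have e : ((fun x => w k x • g x) - fun x => u x • g x) = (fun x => w k x - u x) • g := by
    ext x; simp [sub_smul]
  show eLpNorm ((fun x => w k x • g x) - fun x => u x • g x) 1 μ ≤ _
  rw [e]
  exact eLpNorm_smul_le_mul_eLpNorm hg.1 ((hw k).1.sub hu.1)

theorem tendsto_integral_smul_of_tendsto_eLpNorm_sub' {α E : Type*} {m : MeasurableSpace α}
    {μ : Measure α} [NormedAddCommGroup E] [NormedSpace ℝ E] {w : α → ℝ} {g : ℕ → α → E}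
    {G : α → E} (hw : MemLp w 2 μ) (hg : ∀ k, MemLp (g k) 2 μ) (hG : MemLp G 2 μ)
    (h : Tendsto (fun k => eLpNorm (fun x => g k x - G x) 2 μ) atTop (𝓝 0)) :
    Tendsto (fun k => ∫ x, w x • g k x ∂μ) atTop (𝓝 (∫ x, w x • G x ∂μ)) := by
  refine tendsto_integral_of_L1' _ (hw.integrable_smul_of_two hG).aestronglyMeasurable
    (Eventually.of_forall fun k => hw.integrable_smul_of_two (hg k)) ?_
  have h2 : Tendsto (fun k => eLpNorm w 2 μ * eLpNorm (fun x => g k x - G x) 2 μ) atTop (𝓝 0) := by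
    simpa using ENNReal.Tendsto.const_mul h (Or.inr hw.2.ne)
  refine tendsto_of_tendsto_of_tendsto_of_le_of_le tendsto_const_nhds h2 (fun _ => zero_le)
    fun k => ?_
  have e : ((fun x => w x • g k x) - fun x => w x • G x) = w • (fun x => g k x - G x) := by
    ext x; simp [smul_sub]
  show eLpNorm ((fun x => w x • g k x) - fun x => w x • G x) 1 μ ≤ _
  rw [e]
  exact eLpNorm_smul_le_mul_eLpNorm ((hg k).1.sub hG.1) hw.1

/-- Weak gradients are stable under limits in `L₂`. -/
theorem HasPlanarGradient.of_tendsto {Ω : Set Plane} {u : Plane → ℝ} {G : Plane → Plane}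
    {w : ℕ → Plane → ℝ} {g : ℕ → Plane → Plane} (hu : MemLp u 2 (volume.restrict Ω))
    (hG : MemLp G 2 (volume.restrict Ω)) (h : ∀ k, HasPlanarGradient Ω (w k) (g k))
    (hw : Tendsto (fun k => eLpNorm (fun x => w k x - u x) 2 (volume.restrict Ω)) atTop (𝓝 0))
    (hg : Tendsto (fun k => eLpNorm (fun x => g k x - G x) 2 (volume.restrict Ω)) atTop (𝓝 0)) :
    HasPlanarGradient Ω u G := by
  refine ⟨hu, hG, fun φ hφ hc hs => ?_⟩
  have h1 := tendsto_integral_smul_of_tendsto_eLpNorm_sub (F := Plane) (fun k => (h k).memLp) hu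
    (memLp_gradient hφ hc (volume.restrict Ω)) hw
  have h2 := tendsto_integral_smul_of_tendsto_eLpNorm_sub'
    (hφ.continuous.memLp_of_hasCompactSupport (p := 2) (μ := volume.restrict Ω) hc)
    (fun k => (h k).memLp_grad) hG hg
  refine tendsto_nhds_unique (h1.congr fun k => ?_) h2.neg
  exact (h k).weak φ hφ hc hs

theorem HasPlanarGradient.congr_ae {Ω : Set Plane} {u u' : Plane → ℝ} {G G' : Plane → Plane}
    (h : HasPlanarGradient Ω u G) (hu : u =ᵐ[volume.restrict Ω] u')
    (hG : G =ᵐ[volume.restrict Ω] G') : HasPlanarGradient Ω u' G' where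
  memLp := h.memLp.ae_eq hu
  memLp_grad := h.memLp_grad.ae_eq hG
  weak φ hφ hc hs := by
    have e1 : ∫ x in Ω, u' x • gradient φ x = ∫ x in Ω, u x • gradient φ x :=
      integral_congr_ae (hu.mono fun x hx => by simp only [← hx])
    have e2 : ∫ x in Ω, φ x • G' x = ∫ x in Ω, φ x • G x :=
      integral_congr_ae (hG.mono fun x hx => by simp only [← hx])
    rw [e1, e2]
    exact h.weak φ hφ hc hs

/-! ### Translations and Poincaré's inequality on convex sets -/

theorem integrable_shift {G : Plane → Plane} (hGm : StronglyMeasurable G)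
    (hG : Integrable G volume) (v : Plane) :
    Integrable (fun p : ℝ × Plane => inner ℝ v (G (p.2 + p.1 • v)))
      ((volume.restrict (Icc (0:ℝ) 1)).prod volume) := by
  have hm : StronglyMeasurable (fun p : ℝ × Plane => inner ℝ v (G (p.2 + p.1 • v))) :=
    stronglyMeasurable_const.inner (hGm.comp_measurable (by fun_prop))
  refine (integrable_prod_iff hm.aestronglyMeasurable).2 ⟨ae_of_all _ fun t => ?_, ?_⟩
  · exact (hG.comp_add_right (t • v)).const_inner v
  · have : ∀ t : ℝ, ∫ y, ‖inner ℝ v (G (y + t • v))‖ = ∫ y, ‖inner ℝ v (G y)‖ := fun t =>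
      integral_add_right_eq_self (fun y => ‖inner ℝ v (G y)‖) (t • v)
    simp only [this]
    exact integrable_const _

theorem integral_fderiv_shift {g : Plane → ℝ} (hg : ContDiff ℝ ∞ g) (y v : Plane) :
    ∫ t in Icc (0:ℝ) 1, fderiv ℝ g (y - t • v) v = g y - g (y - v) := by
  rw [integral_Icc_eq_integral_Ioc, ← intervalIntegral.integral_of_le zero_le_one]
  have hd : ∀ t ∈ uIcc (0:ℝ) 1, HasDerivAt (fun t : ℝ => -g (y - t • v))
      (fderiv ℝ g (y - t • v) v) t := fun t _ => by
    have h1 : HasDerivAt (fun t : ℝ => y - t • v) (-v) t := by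
      simpa using ((hasDerivAt_id t).smul_const v).const_sub y
    have h2 := ((hg.differentiable (by simp)).differentiableAt (x := y - t • v)).hasFDerivAt
    have h3 := (h2.comp_hasDerivAt t h1).neg
    simp only [map_neg, neg_neg] at h3
    exact h3
  rw [intervalIntegral.integral_eq_sub_of_hasDerivAt hd]
  · simp; ring
  · refine Continuous.intervalIntegrable ?_ _ _
    exact ((hg.continuous_fderiv (by simp)).comp (by fun_prop)).clm_apply continuous_const

/-- The fundamental theorem of calculus along almost every segment in direction `v`. -/
theorem HasPlanarGradient.ae_sub_eq_integral {Ω : Set Plane} (hΩ : IsOpen Ω) (hc : Convex ℝ Ω)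
    {u : Plane → ℝ} {G : Plane → Plane} (h : HasPlanarGradient Ω u G)
    (hGm : StronglyMeasurable G) (hu : Integrable u volume) (hG : Integrable G volume)
    (hu0 : ∀ x ∉ Ω, u x = 0) (hG0 : ∀ x ∉ Ω, G x = 0) (v : Plane) :
    ∀ᵐ x, x ∈ {x | x ∈ Ω ∧ x + v ∈ Ω} →
      u (x + v) - u x - ∫ t in Icc (0:ℝ) 1, inner ℝ v (G (x + t • v)) = 0 := by
  have hF := integrable_shift hGm hG v
  have hFi : Integrable (fun x => ∫ t in Icc (0:ℝ) 1, inner ℝ v (G (x + t • v))) volume :=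
    hF.integral_prod_right
  have huv := hu.comp_add_right v
  have hU : IsOpen {x | x ∈ Ω ∧ x + v ∈ Ω} :=
    hΩ.inter (hΩ.preimage (continuous_id.add continuous_const))
  refine hU.ae_eq_zero_of_integral_contDiff_smul_eq_zero
    (((huv.sub hu).sub hFi).locallyIntegrable.locallyIntegrableOn _) fun g hg hgc hgs => ?_
  obtain ⟨B, hB⟩ := hg.continuous.bounded_above_of_compact_support hgc
  have hgm : AEStronglyMeasurable g volume := hg.continuous.aestronglyMeasurable
  have i1 : Integrable (fun x => g x * u (x + v)) := huv.bdd_mul hgm (ae_of_all _ hB)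
  have i2 : Integrable (fun x => g x * u x) := hu.bdd_mul hgm (ae_of_all _ hB)
  have i3 : Integrable (fun x => g x * ∫ t in Icc (0:ℝ) 1, inner ℝ v (G (x + t • v))) :=
    hFi.bdd_mul hgm (ae_of_all _ hB)
  have hfc : Continuous fun y => fderiv ℝ g y v :=
    (hg.continuous_fderiv (by simp)).clm_apply continuous_const
  obtain ⟨B', hB'⟩ := hfc.bounded_above_of_compact_support
    ((hgc.fderiv ℝ).comp_left (g := fun L : Plane →L[ℝ] ℝ => L v) rfl)
  have main : ∫ x, g x * ∫ t in Icc (0:ℝ) 1, inner ℝ v (G (x + t • v))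
      = (∫ x, g x * u (x + v)) - ∫ x, g x * u x := by
    have s1 : ∫ x, g x * ∫ t in Icc (0:ℝ) 1, inner ℝ v (G (x + t • v))
        = ∫ t in Icc (0:ℝ) 1, ∫ x, g x * inner ℝ v (G (x + t • v)) := by
      simp_rw [← integral_const_mul]
      refine (integral_integral_swap (f := fun (t : ℝ) (x : Plane) =>
        g x * inner ℝ v (G (x + t • v))) ?_).symm
      refine hF.bdd_mul (c := B) (f := fun p : ℝ × Plane => g p.2) ?_ (ae_of_all _ fun p => hB p.2)
      exact (hg.continuous.comp continuous_snd).aestronglyMeasurable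
    -- The translation is moved from `G` to the test function, and the shifted test function is
    -- inserted into the definition of the weak gradient.
    have s2 : ∀ t ∈ Icc (0:ℝ) 1, ∫ x, g x * inner ℝ v (G (x + t • v))
        = -∫ y, u y * fderiv ℝ g (y - t • v) v := fun t ht => by
      have e1 : ∫ x, g x * inner ℝ v (G (x + t • v)) = ∫ y, g (y - t • v) * inner ℝ v (G y) := by
        rw [← integral_sub_right_eq_self _ (t • v)]
        simp
      have hφ : ContDiff ℝ ∞ fun y => g (y - t • v) := hg.comp (contDiff_id.sub contDiff_const)
      have hφc : HasCompactSupport fun y => g (y - t • v) := by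
        simpa [sub_eq_add_neg, Function.comp_def] using
          hgc.comp_homeomorph (Homeomorph.addRight (-(t • v)))
      -- Convexity enters here: `y` lies on the segment between `y - t • v` and `y - t • v + v`, and
      -- both ends are in `Ω` by the support of `g`.
      have hφs : tsupport (fun y => g (y - t • v)) ⊆ Ω := by
        intro y hy
        have : y - t • v ∈ tsupport g :=
          tsupport_comp_subset_preimage g (f := fun y => y - t • v) (by fun_prop) hy
        obtain ⟨h1, h2⟩ := hgs this
        have := hc.add_smul_sub_mem h1 h2 ht
        simpa using this
      have hw := h.weak_inner hφ hφc hφs v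
      have hfd : ∀ y, fderiv ℝ (fun y => g (y - t • v)) y = fderiv ℝ g (y - t • v) := fun y =>
        fderiv_comp_sub (t • v)
      simp only [hfd] at hw
      rw [setIntegral_eq_integral_of_forall_compl_eq_zero (fun x hx => by simp [hu0 x hx]),
        setIntegral_eq_integral_of_forall_compl_eq_zero (fun x hx => by simp [hG0 x hx])] at hw
      rw [e1, hw, neg_neg]
    have s3 : ∫ t in Icc (0:ℝ) 1, ∫ y, u y * fderiv ℝ g (y - t • v) v
        = ∫ y, u y * (g y - g (y - v)) := by
      rw [integral_integral_swap (f := fun (t : ℝ) (y : Plane) =>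
        u y * fderiv ℝ g (y - t • v) v)]
      · simp_rw [integral_const_mul, integral_fderiv_shift hg]
      · have := (hu.comp_snd (volume.restrict (Icc (0:ℝ) 1))).mul_bdd (c := B')
          (g := fun p : ℝ × Plane => fderiv ℝ g (p.2 - p.1 • v) v)
          ((hfc.comp (by fun_prop : Continuous fun p : ℝ × Plane =>
            p.2 - p.1 • v)).aestronglyMeasurable) (ae_of_all _ fun p => hB' _)
        exact this
    rw [s1, setIntegral_congr_fun measurableSet_Icc s2, integral_neg, s3]
    have i4 : Integrable fun y => g (y - v) * u y := by
      have := i1.comp_sub_right v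
      simpa using this
    have e5 : ∫ x, g x * u (x + v) = ∫ y, g (y - v) * u y := by
      rw [← integral_sub_right_eq_self _ v]; simp
    rw [e5, ← integral_sub i4 i2, ← integral_neg]
    congr 1; ext y; ring
  calc ∫ x, g x • (u (x + v) - u x - ∫ t in Icc (0:ℝ) 1, inner ℝ v (G (x + t • v)))
      = ∫ x, (g x * u (x + v) - g x * u x
        - g x * ∫ t in Icc (0:ℝ) 1, inner ℝ v (G (x + t • v))) := by
        congr 1; ext x; simp only [smul_eq_mul]; ring
    _ = 0 := by
        rw [integral_sub (f := fun x => g x * u (x + v) - g x * u x) (i1.sub i2) i3,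
          integral_sub i1 i2, main, sub_self]

theorem sq_lintegral_le {α : Type*} [MeasurableSpace α] (μ : Measure α) [IsProbabilityMeasure μ]
    {f : α → ENNReal} (hf : AEMeasurable f μ) : (∫⁻ x, f x ∂μ) ^ 2 ≤ ∫⁻ x, f x ^ 2 ∂μ := by
  have h := ENNReal.lintegral_mul_le_Lp_mul_Lq μ Real.HolderConjugate.two_two hf
    (aemeasurable_const (b := (1 : ENNReal)))
  simp only [Pi.mul_apply, mul_one, ENNReal.one_rpow, lintegral_const, measure_univ] at h
  calc _ ≤ ((∫⁻ x, f x ^ (2:ℝ) ∂μ) ^ (1 / 2 : ℝ)) ^ 2 := by gcongr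
    _ = _ := by
      rw [← ENNReal.rpow_natCast, ← ENNReal.rpow_mul]
      norm_num

/-- The `L₂`-modulus of continuity of a function with weak gradient. -/
theorem HasPlanarGradient.lintegral_translate_le {Ω : Set Plane} (hΩ : IsOpen Ω)
    (hc : Convex ℝ Ω) {u : Plane → ℝ} {G : Plane → Plane} (h : HasPlanarGradient Ω u G)
    (hGm : StronglyMeasurable G) (hu : Integrable u volume) (hG : Integrable G volume)
    (hu0 : ∀ x ∉ Ω, u x = 0) (hG0 : ∀ x ∉ Ω, G x = 0) (v : Plane) :
    ∫⁻ x in {x | x ∈ Ω ∧ x + v ∈ Ω}, ‖u (x + v) - u x‖ₑ ^ 2 ≤ ‖v‖ₑ ^ 2 * ∫⁻ x, ‖G x‖ₑ ^ 2 := by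
  have hU : IsOpen {x | x ∈ Ω ∧ x + v ∈ Ω} :=
    hΩ.inter (hΩ.preimage (continuous_id.add continuous_const))
  have : IsProbabilityMeasure (volume.restrict (Icc (0:ℝ) 1)) := ⟨by simp⟩
  have hm : Measurable fun p : Plane × ℝ => ‖G (p.1 + p.2 • v)‖ₑ ^ 2 :=
    ((hGm.measurable.comp (by fun_prop)).enorm).pow_const 2
  have hpt : ∀ᵐ x, x ∈ {x | x ∈ Ω ∧ x + v ∈ Ω} → ‖u (x + v) - u x‖ₑ ^ 2
      ≤ ‖v‖ₑ ^ 2 * ∫⁻ t in Icc (0:ℝ) 1, ‖G (x + t • v)‖ₑ ^ 2 := by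
    filter_upwards [h.ae_sub_eq_integral hΩ hc hGm hu hG hu0 hG0 v] with x hx hxU
    rw [sub_eq_zero.1 (hx hxU)]
    have hmx : Measurable fun t : ℝ => ‖G (x + t • v)‖ₑ :=
      (hGm.measurable.comp (by fun_prop)).enorm
    calc ‖∫ t in Icc (0:ℝ) 1, inner ℝ v (G (x + t • v))‖ₑ ^ 2
        ≤ (∫⁻ t in Icc (0:ℝ) 1, ‖inner ℝ v (G (x + t • v))‖ₑ) ^ 2 := by
          gcongr; exact enorm_integral_le_lintegral_enorm _
      _ ≤ (∫⁻ t in Icc (0:ℝ) 1, ‖v‖ₑ * ‖G (x + t • v)‖ₑ) ^ 2 := by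
          gcongr with t
          rw [← ofReal_norm, ← ofReal_norm, ← ofReal_norm, ← ENNReal.ofReal_mul (norm_nonneg _)]
          exact ENNReal.ofReal_le_ofReal (norm_inner_le_norm _ _)
      _ = ‖v‖ₑ ^ 2 * (∫⁻ t in Icc (0:ℝ) 1, ‖G (x + t • v)‖ₑ) ^ 2 := by
          rw [lintegral_const_mul _ hmx, mul_pow]
      _ ≤ _ := by
          gcongr
          exact sq_lintegral_le _ hmx.aemeasurable
  calc ∫⁻ x in {x | x ∈ Ω ∧ x + v ∈ Ω}, ‖u (x + v) - u x‖ₑ ^ 2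
      ≤ ∫⁻ x in {x | x ∈ Ω ∧ x + v ∈ Ω},
          ‖v‖ₑ ^ 2 * ∫⁻ t in Icc (0:ℝ) 1, ‖G (x + t • v)‖ₑ ^ 2 :=
        lintegral_mono_ae ((ae_restrict_iff' hU.measurableSet).2 hpt)
    _ ≤ ∫⁻ x, ‖v‖ₑ ^ 2 * ∫⁻ t in Icc (0:ℝ) 1, ‖G (x + t • v)‖ₑ ^ 2 := setLIntegral_le_lintegral _ _
    _ = ‖v‖ₑ ^ 2 * ∫⁻ x, ∫⁻ t in Icc (0:ℝ) 1, ‖G (x + t • v)‖ₑ ^ 2 :=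
        lintegral_const_mul' _ _ (by simp)
    _ = ‖v‖ₑ ^ 2 * ∫⁻ t in Icc (0:ℝ) 1, ∫⁻ x, ‖G (x + t • v)‖ₑ ^ 2 := by
        rw [lintegral_lintegral_swap hm.aemeasurable]
    _ = _ := by
        congr 1
        have : ∀ t : ℝ, ∫⁻ x, ‖G (x + t • v)‖ₑ ^ 2 = ∫⁻ x, ‖G x‖ₑ ^ 2 := fun t =>
          lintegral_add_right_eq_self (fun x => ‖G x‖ₑ ^ 2) (t • v)
        simp [this]

/-- Substitute `y = x + v` and exchange the order of integration. For fixed `v` the translation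
estimate contributes `‖v‖² ≤ D²`, and only the `v` in the disc of radius `D`, of area `π D²`,
contribute at all. -/
theorem HasPlanarGradient.lintegral_lintegral_le {Ω : Set Plane} (hΩ : IsOpen Ω)
    (hc : Convex ℝ Ω) {D : ℝ} (hD : ∀ x ∈ Ω, ∀ y ∈ Ω, dist x y ≤ D)
    {u : Plane → ℝ} {G : Plane → Plane} (h : HasPlanarGradient Ω u G)
    (hum : StronglyMeasurable u)
    (hGm : StronglyMeasurable G) (hu : Integrable u volume) (hG : Integrable G volume)
    (hu0 : ∀ x ∉ Ω, u x = 0) (hG0 : ∀ x ∉ Ω, G x = 0) :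
    ∫⁻ x in Ω, ∫⁻ y in Ω, ‖u y - u x‖ₑ ^ 2
      ≤ ENNReal.ofReal (Real.pi * D ^ 4) * ∫⁻ x, ‖G x‖ₑ ^ 2 := by
  rcases Ω.eq_empty_or_nonempty with rfl | ⟨x₀, hx₀⟩
  · simp
  have hD0 : 0 ≤ D := dist_nonneg.trans (hD x₀ hx₀ x₀ hx₀)
  have hU : ∀ v : Plane, IsOpen {x | x ∈ Ω ∧ x + v ∈ Ω} := fun v =>
    hΩ.inter (hΩ.preimage (continuous_id.add continuous_const))
  set F : Plane → Plane → ENNReal := fun x v =>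
    {x | x ∈ Ω ∧ x + v ∈ Ω}.indicator (fun x => ‖u (x + v) - u x‖ₑ ^ 2) x with hF
  have hFm : Measurable (Function.uncurry F) := by
    have : Function.uncurry F = {p : Plane × Plane | p.1 ∈ Ω ∧ p.1 + p.2 ∈ Ω}.indicator
        (fun p => ‖u (p.1 + p.2) - u p.1‖ₑ ^ 2) := by
      ext ⟨x, v⟩; simp [F, Function.uncurry, indicator]
    rw [this]
    refine Measurable.indicator ?_ ?_
    · have hm := hum.measurable
      exact (((hm.comp (by fun_prop)).sub (hm.comp (by fun_prop))).enorm).pow_const 2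
    · exact ((hΩ.preimage continuous_fst).inter
        (hΩ.preimage (continuous_fst.add continuous_snd))).measurableSet
  calc ∫⁻ x in Ω, ∫⁻ y in Ω, ‖u y - u x‖ₑ ^ 2 = ∫⁻ x, ∫⁻ v, F x v := by
        rw [← lintegral_indicator hΩ.measurableSet]
        refine lintegral_congr fun x => ?_
        by_cases hx : x ∈ Ω
        · rw [indicator_of_mem hx, ← lintegral_indicator hΩ.measurableSet,
            ← lintegral_add_left_eq_self _ x]
          refine lintegral_congr fun v => ?_
          by_cases hv : x + v ∈ Ω
          · rw [indicator_of_mem hv]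
            have hxv : x ∈ {x | x ∈ Ω ∧ x + v ∈ Ω} := ⟨hx, hv⟩
            simp only [F, indicator_of_mem hxv]
          · rw [indicator_of_notMem hv]
            have hxv : x ∉ {x | x ∈ Ω ∧ x + v ∈ Ω} := fun h => hv h.2
            simp only [F, indicator_of_notMem hxv]
        · rw [indicator_of_notMem hx]
          simp [F, indicator, hx]
    _ = ∫⁻ v, ∫⁻ x, F x v := lintegral_lintegral_swap hFm.aemeasurable
    _ ≤ ∫⁻ v, (Metric.closedBall (0 : Plane) D).indicator
          (fun _ => ENNReal.ofReal D ^ 2 * ∫⁻ x, ‖G x‖ₑ ^ 2) v := by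
        refine lintegral_mono fun v => ?_
        simp only [F]
        rw [lintegral_indicator (hU v).measurableSet]
        by_cases hv : v ∈ Metric.closedBall (0 : Plane) D
        · rw [indicator_of_mem hv]
          refine (h.lintegral_translate_le hΩ hc hGm hu hG hu0 hG0 v).trans ?_
          gcongr
          rw [← ofReal_norm]
          exact ENNReal.ofReal_le_ofReal (by simpa using hv)
        · have : {x | x ∈ Ω ∧ x + v ∈ Ω} = ∅ := by
            refine eq_empty_of_forall_notMem fun x hx => hv ?_
            have := hD _ hx.2 _ hx.1
            simpa [dist_eq_norm] using this
          simp [this]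
    _ = _ := by
        rw [lintegral_indicator Metric.isClosed_closedBall.measurableSet, setLIntegral_const,
          EuclideanSpace.volume_closedBall_fin_two, ENNReal.ofReal_mul Real.pi_pos.le,
          ENNReal.ofReal_pow hD0]
        ring

/-- The Poincaré inequality on a bounded convex open set of the plane. -/
theorem HasPlanarGradient.exists_poincare {Ω : Set Plane} (hΩ : IsOpen Ω) (hc : Convex ℝ Ω)
    (hne : Ω.Nonempty) {D : ℝ} (hD : ∀ x ∈ Ω, ∀ y ∈ Ω, dist x y ≤ D) {u : Plane → ℝ}
    {G : Plane → Plane} (h : HasPlanarGradient Ω u G) :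
    ∃ c : ℝ, volume.real Ω * ∫ x in Ω, (u x - c) ^ 2
      ≤ Real.pi * D ^ 4 * ∫ x in Ω, ‖G x‖ ^ 2 := by
  obtain ⟨x₀, hx₀⟩ := hne
  have hfin : volume Ω ≠ ⊤ := by
    have : Ω ⊆ Metric.closedBall x₀ D := fun x hx => hD x hx x₀ hx₀
    exact ((measure_mono this).trans_lt measure_closedBall_lt_top).ne
  have : IsFiniteMeasure (volume.restrict Ω) := ⟨by simpa using hfin.lt_top⟩
  have hpos : volume Ω ≠ 0 := (hΩ.measure_pos volume ⟨x₀, hx₀⟩).ne'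
  -- Strongly measurable representatives that vanish off `Ω` make all translates globally integrable
  -- and jointly measurable.
  set u' := Ω.indicator (h.memLp.1.mk u) with hu'
  set G' := Ω.indicator (h.memLp_grad.1.mk G) with hG'
  have hum : StronglyMeasurable u' := h.memLp.1.stronglyMeasurable_mk.indicator hΩ.measurableSet
  have hGm : StronglyMeasurable G' :=
    h.memLp_grad.1.stronglyMeasurable_mk.indicator hΩ.measurableSet
  have hue : u =ᵐ[volume.restrict Ω] u' :=
    h.memLp.1.ae_eq_mk.trans (indicator_ae_eq_restrict hΩ.measurableSet).symm
  have hGe : G =ᵐ[volume.restrict Ω] G' :=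
    h.memLp_grad.1.ae_eq_mk.trans (indicator_ae_eq_restrict hΩ.measurableSet).symm
  have h' := h.congr_ae hue hGe
  have hu0 : ∀ x ∉ Ω, u' x = 0 := fun x hx => indicator_of_notMem hx _
  have hG0 : ∀ x ∉ Ω, G' x = 0 := fun x hx => indicator_of_notMem hx _
  have hui : Integrable u' volume :=
    IntegrableOn.integrable_of_forall_notMem_eq_zero (h'.memLp.integrable one_le_two) hu0
  have hGi : Integrable G' volume :=
    IntegrableOn.integrable_of_forall_notMem_eq_zero (h'.memLp_grad.integrable one_le_two) hG0
  have key := h'.lintegral_lintegral_le hΩ hc hD hum hGm hui hGi hu0 hG0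
  have hm : Measurable (fun p : Plane × Plane => ‖u' p.2 - u' p.1‖ₑ ^ 2) :=
    (((hum.measurable.comp measurable_snd).sub
      (hum.measurable.comp measurable_fst)).enorm).pow_const 2
  -- The constant is the value of `u'` at a point where the inner integral does not exceed its
  -- average. The mean value of `u` is not needed.
  obtain ⟨x, hx, hle⟩ := exists_le_setLAverage (μ := volume) hpos hfin
    (f := fun x => ∫⁻ y in Ω, ‖u' y - u' x‖ₑ ^ 2)
    (hm.lintegral_prod_right' (ν := volume.restrict Ω)).aemeasurable
  refine ⟨u' x, ?_⟩
  rw [setLAverage_eq, ENNReal.le_div_iff_mul_le (Or.inl hpos) (Or.inl hfin)] at hle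
  have hle2 := hle.trans key
  have hGsupp : ∫⁻ x, ‖G' x‖ₑ ^ 2 = ∫⁻ x in Ω, ‖G' x‖ₑ ^ 2 := by
    rw [setLIntegral_eq_of_support_subset]
    intro y hy
    by_contra hyn
    simp [hG0 y hyn] at hy
  rw [hGsupp] at hle2
  have e1 : ENNReal.ofReal (∫ y in Ω, (u y - u' x) ^ 2) = ∫⁻ y in Ω, ‖u' y - u' x‖ₑ ^ 2 := by
    have hi : Integrable (fun y => (u y - u' x) ^ 2) (volume.restrict Ω) :=
      (h.memLp.sub (memLp_const (u' x))).integrable_sq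
    rw [ofReal_integral_eq_lintegral_ofReal hi (ae_of_all _ fun y => sq_nonneg _)]
    refine lintegral_congr_ae (hue.mono fun y hy => ?_)
    simp only [hy]
    rw [← ofReal_norm, ← ENNReal.ofReal_pow (norm_nonneg _), Real.norm_eq_abs, sq_abs]
  have e2 : ENNReal.ofReal (∫ y in Ω, ‖G y‖ ^ 2) = ∫⁻ y in Ω, ‖G' y‖ₑ ^ 2 := by
    rw [ofReal_integral_eq_lintegral_ofReal
      (h.memLp_grad.integrable_norm_pow two_ne_zero) (ae_of_all _ fun y => sq_nonneg _)]
    refine lintegral_congr_ae (hGe.mono fun y hy => ?_)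
    simp only [hy]
    rw [← ofReal_norm, ← ENNReal.ofReal_pow (norm_nonneg _)]
  have hD0 : 0 ≤ D := dist_nonneg.trans (hD x₀ hx₀ x₀ hx₀)
  rw [← e1, ← e2, ← ENNReal.ofReal_mul (by positivity), ← ofReal_measureReal hfin,
    ← ENNReal.ofReal_mul (integral_nonneg fun y => sq_nonneg _), ENNReal.ofReal_le_ofReal_iff
      (mul_nonneg (by positivity) (integral_nonneg fun y => sq_nonneg _)), mul_comm] at hle2
  exact hle2

/-! ### Isometric charts and orthonormal frames of triangles -/

/-- The linear part of the chart `(s, t) ↦ s e + t ν`. -/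
noncomputable def chartLin {n : ℕ} (e ν : EuclideanSpace ℝ (Fin n)) :
    Plane →L[ℝ] EuclideanSpace ℝ (Fin n) :=
  (EuclideanSpace.proj (0 : Fin 2)).smulRight e + (EuclideanSpace.proj (1 : Fin 2)).smulRight ν

/-- The chart `(s, t) ↦ a + s e + t ν`. -/
noncomputable def chart {n : ℕ} (a e ν : EuclideanSpace ℝ (Fin n)) (x : Plane) :
    EuclideanSpace ℝ (Fin n) :=
  a + chartLin e ν x

theorem chartLin_apply {n : ℕ} (e ν : EuclideanSpace ℝ (Fin n)) (x : Plane) :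
    chartLin e ν x = x 0 • e + x 1 • ν := by
  simp [chartLin]

theorem norm_chartLin_sq {n : ℕ} {e ν : EuclideanSpace ℝ (Fin n)} (he : ‖e‖ = 1) (hν : ‖ν‖ = 1)
    (heν : inner ℝ e ν = 0) (s t : ℝ) : ‖s • e + t • ν‖ ^ 2 = s ^ 2 + t ^ 2 := by
  rw [norm_add_sq_real, norm_smul, norm_smul, he, hν, inner_smul_left, inner_smul_right, heν]
  simp

theorem isometry_chart {n : ℕ} {e ν : EuclideanSpace ℝ (Fin n)} (he : ‖e‖ = 1) (hν : ‖ν‖ = 1)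
    (heν : inner ℝ e ν = 0) (a : EuclideanSpace ℝ (Fin n)) : Isometry (chart a e ν) := by
  refine Isometry.of_dist_eq fun x y => ?_
  rw [dist_eq_norm, dist_eq_norm]
  have : chart a e ν x - chart a e ν y = (x - y) 0 • e + (x - y) 1 • ν := by
    rw [← chartLin_apply, map_sub, chart, chart]; abel
  rw [this, ← sq_eq_sq₀ (norm_nonneg _) (norm_nonneg _), norm_chartLin_sq he hν heν,
    EuclideanSpace.norm_sq_eq]
  simp

/-- The triangle with nodes `a`, `b`, `p` in an orthonormal frame: `b = a + ℓ e` and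
`p = a + σ e + k ν`. -/
structure TriangleFrame {n : ℕ} (a b p e ν : EuclideanSpace ℝ (Fin n)) (ℓ k σ : ℝ) : Prop where
  norm_e : ‖e‖ = 1
  norm_ν : ‖ν‖ = 1
  orth : inner ℝ e ν = 0
  ℓ_pos : 0 < ℓ
  k_pos : 0 < k
  eq_b : b = a + ℓ • e
  eq_p : p = a + (σ • e + k • ν)

/-- Gram–Schmidt applied to `b - a` and `p - a`; the second vector survives the projection because
`p` is off the line through `a` and `b`. -/
theorem exists_triangleFrame {n : ℕ} {a b p : EuclideanSpace ℝ (Fin n)} (hab : b ≠ a)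
    (hp : ∀ s : ℝ, p ≠ a + s • (b - a)) : ∃ e ν ℓ k σ, TriangleFrame a b p e ν ℓ k σ := by
  have hba : 0 < ‖b - a‖ := norm_pos_iff.2 (sub_ne_zero.2 hab)
  set e := ‖b - a‖⁻¹ • (b - a) with he
  have hne : ‖e‖ = 1 := by
    rw [he, norm_smul, norm_inv, norm_norm, inv_mul_cancel₀ hba.ne']
  set σ := inner ℝ e (p - a) with hσ
  set r := (p - a) - σ • e with hr
  have hr0 : r ≠ 0 := fun h => hp (σ * ‖b - a‖⁻¹) (by
    rw [mul_smul, ← he, ← sub_eq_iff_eq_add']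
    exact sub_eq_zero.1 h)
  have hrn : 0 < ‖r‖ := norm_pos_iff.2 hr0
  have her : inner ℝ e r = 0 := by
    rw [hr, inner_sub_right, inner_smul_right, real_inner_self_eq_norm_sq, hne, hσ]; ring
  refine ⟨e, ‖r‖⁻¹ • r, ‖b - a‖, ‖r‖, σ, hne, ?_, ?_, hba, hrn, ?_, ?_⟩
  · rw [norm_smul, norm_inv, norm_norm, inv_mul_cancel₀ hrn.ne']
  · rw [inner_smul_right, her, mul_zero]
  · rw [he, smul_smul, mul_inv_cancel₀ hba.ne']; simp
  · rw [smul_smul ‖r‖, mul_inv_cancel₀ hrn.ne', one_smul, hr]; abel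

theorem Finset.exists_eq_insert_of_card_three {α : Type*} [DecidableEq α] {T : Finset α} {a b : α}
    (hT : T.card = 3)
    (ha : a ∈ T) (hb : b ∈ T) (hab : b ≠ a) : ∃ p, p ≠ a ∧ p ≠ b ∧ T = {a, b, p} := by
  have h1 : ((T.erase a).erase b).card = 1 := by
    rw [Finset.card_erase_of_mem (Finset.mem_erase.2 ⟨hab, hb⟩), Finset.card_erase_of_mem ha, hT]
  obtain ⟨p, hp⟩ := Finset.card_eq_one.1 h1
  have hpm : p ∈ (T.erase a).erase b := hp ▸ Finset.mem_singleton_self p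
  simp only [Finset.mem_erase] at hpm
  refine ⟨p, hpm.2.1, hpm.1, ?_⟩
  rw [← Finset.insert_erase ha, ← Finset.insert_erase (Finset.mem_erase.2 ⟨hab, hb⟩), hp]

theorem exists_triangleFrame_of_nondegenerate {n : ℕ} {T : Finset (EuclideanSpace ℝ (Fin n))}
    (hT : T.card = 3) (hi : AffineIndependent ℝ (fun z : T => (z : EuclideanSpace ℝ (Fin n))))
    {a b p : EuclideanSpace ℝ (Fin n)} (hab : b ≠ a) (hTe : (T : Set _) = {a, b, p}) :
    ∃ e ν ℓ k σ, TriangleFrame a b p e ν ℓ k σ := by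
  refine exists_triangleFrame hab fun s hs => ?_
  have h2 := hi.finrank_vectorSpan (n := 2) (by simpa using hT)
  rw [Subtype.range_coe_subtype, Finset.setOfPred_mem, hTe] at h2
  have hc : Collinear ℝ {a, b, p} := by
    refine (collinear_iff_of_mem (p₀ := a) (by simp)).2 ⟨b - a, fun q hq => ?_⟩
    rcases hq with rfl | rfl | rfl
    · exact ⟨0, by simp⟩
    · exact ⟨1, by simp⟩
    · exact ⟨s, by rw [hs]; simp [add_comm]⟩
  have := collinear_iff_finrank_le_one.1 hc
  omega

/-- The reference triangle. -/
def refTriangle : Set Plane := {x | 0 ≤ x 0 ∧ 0 ≤ x 1 ∧ x 0 + x 1 ≤ 1}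

/-- The coordinates on the reference triangle are the barycentric weights of `b` and `p`; the weight
of `a` is what is missing to `1`. -/
theorem convexHull_triangle {E : Type*} [AddCommGroup E] [Module ℝ E] (a b p : E) :
    convexHull ℝ {a, b, p} = (fun x : Plane => a + x 0 • (b - a) + x 1 • (p - a)) '' refTriangle := by
  rw [convexHull_insert (by simp), convexHull_pair]
  ext z
  simp only [mem_convexJoin, mem_singleton_iff, exists_eq_left, segment, refTriangle, mem_image,
    mem_ofPred_eq]
  constructor
  · rintro ⟨y, ⟨α, β, hα, hβ, hαβ, rfl⟩, c, d, hc, hd, hcd, rfl⟩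
    refine ⟨!₂[d * α, d * β], ⟨by simp; positivity, by simp; positivity, ?_⟩, ?_⟩
    · simp only [Matrix.cons_val_zero, Matrix.cons_val_one]
      nlinarith
    · simp only [Matrix.cons_val_zero, Matrix.cons_val_one]
      have h1 : c = 1 - d * α - d * β := by rw [← mul_one d, ← hαβ] at hcd; linarith
      rw [h1]; module
  · rintro ⟨x, ⟨h0, h1, h2⟩, rfl⟩
    rcases (add_nonneg h0 h1).eq_or_lt with h | h
    · have e0 : x 0 = 0 := by linarith
      have e1 : x 1 = 0 := by linarith
      exact ⟨b, ⟨1, 0, by simp⟩, 1, 0, by simp [e0, e1]⟩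
    · refine ⟨(x 0 / (x 0 + x 1)) • b + (x 1 / (x 0 + x 1)) • p,
        ⟨_, _, by positivity, by positivity, ?_, rfl⟩, 1 - (x 0 + x 1), x 0 + x 1,
        by linarith, h.le, by ring, ?_⟩
      · rw [← add_div, div_self h.ne']
      · rw [smul_add, smul_smul, smul_smul, mul_div_cancel₀ _ h.ne', mul_div_cancel₀ _ h.ne']
        module

/-- The linear map of the plane that maps the reference triangle to a triangle in its frame. -/
noncomputable def frameLin (ℓ k σ : ℝ) : Plane →L[ℝ] Plane :=
  LinearMap.toContinuousLinearMap
    (Matrix.toLin (EuclideanSpace.basisFun (Fin 2) ℝ).toBasis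
      (EuclideanSpace.basisFun (Fin 2) ℝ).toBasis !![ℓ, σ; 0, k])

theorem frameLin_det (ℓ k σ : ℝ) : (frameLin ℓ k σ).det = ℓ * k := by
  rw [frameLin, LinearMap.det_toContinuousLinearMap, LinearMap.det_toLin, Matrix.det_fin_two_of]
  ring

theorem frameLin_apply (ℓ k σ : ℝ) (x : Plane) :
    frameLin ℓ k σ x = !₂[ℓ * x 0 + σ * x 1, k * x 1] := by
  ext i
  fin_cases i <;>
  simp [frameLin, Matrix.toLin_apply, Matrix.mulVec, dotProduct, Fin.sum_univ_two]

namespace TriangleFrame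

variable {n : ℕ} {a b p e ν : EuclideanSpace ℝ (Fin n)} {ℓ k σ : ℝ}

theorem isometry (h : TriangleFrame a b p e ν ℓ k σ) : Isometry (chart a e ν) :=
  isometry_chart h.norm_e h.norm_ν h.orth a

theorem chart_frameLin (h : TriangleFrame a b p e ν ℓ k σ) (x : Plane) :
    chart a e ν (frameLin ℓ k σ x) = a + x 0 • (b - a) + x 1 • (p - a) := by
  rw [chart, chartLin_apply, frameLin_apply, h.eq_b, h.eq_p]
  simp only [Matrix.cons_val_zero, Matrix.cons_val_one]
  module

theorem convexHull_eq (h : TriangleFrame a b p e ν ℓ k σ) :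
    convexHull ℝ {a, b, p} = chart a e ν '' (frameLin ℓ k σ '' refTriangle) := by
  rw [convexHull_triangle, image_image]
  exact image_congr fun x _ => (h.chart_frameLin x).symm

/-- At height `x 1` the barycentric weight of `p` is `x 1 / k`, and that of `b` is `(x 0 - σ (x 1 /
k)) / ℓ`. The hypotheses say that all three weights are nonnegative. -/
theorem chart_mem (h : TriangleFrame a b p e ν ℓ k σ) {x : Plane} (h1 : 0 ≤ x 1)
    (h2 : 0 ≤ x 0 - σ * (x 1 / k)) (h3 : x 0 - σ * (x 1 / k) + ℓ * (x 1 / k) ≤ ℓ) :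
    chart a e ν x ∈ convexHull ℝ {a, b, p} := by
  rw [h.convexHull_eq]
  have hℓ := h.ℓ_pos
  have hk := h.k_pos
  refine mem_image_of_mem _ ⟨!₂[(x 0 - σ * (x 1 / k)) / ℓ, x 1 / k], ⟨?_, ?_, ?_⟩, ?_⟩
  · simp only [Matrix.cons_val_zero]; positivity
  · simp only [Matrix.cons_val_one, Matrix.cons_val_fin_one]; exact div_nonneg h1 hk.le
  · simp only [Matrix.cons_val_zero, Matrix.cons_val_one]
    rw [div_add' _ _ _ hℓ.ne', div_le_one hℓ]; linarith
  · rw [frameLin_apply]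
    ext i
    fin_cases i
    · simp; field_simp; ring
    · simp; field_simp

theorem range_convexHull (h : TriangleFrame a b p e ν ℓ k σ) :
    convexHull ℝ {a, b, p} ⊆ range (chart a e ν) := by
  rw [h.convexHull_eq]; exact image_subset_range _ _

/-- In the plane, Lebesgue measure is the two-dimensional Hausdorff measure, which isometries
preserve. This reduces all surface integrals over elements to planar ones. -/
theorem map_volume (h : TriangleFrame a b p e ν ℓ k σ) :
    (volume : Measure Plane).map (chart a e ν) = μHE[2].restrict (range (chart a e ν)) := by
  rw [← EuclideanSpace.euclideanHausdorffMeasure_eq_volume]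
  exact h.isometry.map_euclideanHausdorffMeasure

theorem measurableEmbedding (h : TriangleFrame a b p e ν ℓ k σ) :
    MeasurableEmbedding (chart a e ν) :=
  h.isometry.isClosedEmbedding.measurableEmbedding

/-- The chart maps Lebesgue measure on the preimage of `S` to the area measure on `S`. -/
theorem measurePreserving (h : TriangleFrame a b p e ν ℓ k σ) {S : Set (EuclideanSpace ℝ (Fin n))}
    (hS : S ⊆ range (chart a e ν)) :
    MeasurePreserving (chart a e ν) (volume.restrict (chart a e ν ⁻¹' S)) (μHE[2].restrict S) := by
  refine ⟨h.isometry.continuous.measurable, ?_⟩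
  rw [← h.measurableEmbedding.restrict_map, h.map_volume, Measure.restrict_restrict_of_subset hS]

theorem frameLin_injective (h : TriangleFrame a b p e ν ℓ k σ) :
    Function.Injective (frameLin ℓ k σ) := by
  intro x y hxy
  rw [frameLin_apply, frameLin_apply] at hxy
  have h0 := congrArg (fun z : Plane => z 0) hxy
  have h1 := congrArg (fun z : Plane => z 1) hxy
  simp only [Matrix.cons_val_zero, Matrix.cons_val_one] at h0 h1
  have e1 : x 1 = y 1 := mul_left_cancel₀ h.k_pos.ne' h1
  rw [e1] at h0
  have e0 : x 0 = y 0 := mul_left_cancel₀ h.ℓ_pos.ne' (by linarith)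
  ext i; fin_cases i
  · exact e0
  · exact e1

theorem measurableSet_refTriangle : MeasurableSet refTriangle := by
  have h0 : Continuous fun x : Plane => x 0 := by fun_prop
  have h1 : Continuous fun x : Plane => x 1 := by fun_prop
  exact ((isClosed_le continuous_const h0).inter ((isClosed_le continuous_const h1).inter
      (isClosed_le (h0.add h1) continuous_const))).measurableSet

/-- The parametrization by the reference triangle is an isometry after the linear map `frameLin`,
whose determinant is `ℓ k`. -/
theorem setIntegral_eq (h : TriangleFrame a b p e ν ℓ k σ) (f : EuclideanSpace ℝ (Fin n) → ℝ) :
    ∫ x in convexHull ℝ {a, b, p}, f x ∂μHE[2]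
      = ℓ * k * ∫ x in refTriangle, f (a + x 0 • (b - a) + x 1 • (p - a)) := by
  have e1 := (h.measurePreserving h.range_convexHull).integral_comp h.measurableEmbedding f
  rw [← e1, h.convexHull_eq, preimage_image_eq _ h.isometry.injective,
    integral_image_eq_integral_abs_det_fderiv_smul volume measurableSet_refTriangle
      (fun x _ => (frameLin ℓ k σ).hasFDerivWithinAt) h.frameLin_injective.injOn,
    frameLin_det, abs_of_pos (mul_pos h.ℓ_pos h.k_pos)]
  simp only [smul_eq_mul, integral_const_mul, h.chart_frameLin]

end TriangleFrame

/-! ### Integrals of products of affine functions -/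

theorem integral_cubic (A B C D r : ℝ) :
    ∫ t in (0:ℝ)..r, (A + B * t + C * t ^ 2 + D * t ^ 3)
      = A * r + B * r ^ 2 / 2 + C * r ^ 3 / 3 + D * r ^ 4 / 4 := by
  have hd : ∀ t ∈ uIcc (0:ℝ) r, HasDerivAt
      (fun t : ℝ => A * t + B * t ^ 2 / 2 + C * t ^ 3 / 3 + D * t ^ 4 / 4)
      (A + B * t + C * t ^ 2 + D * t ^ 3) t := fun t _ => by
    have h := ((((hasDerivAt_id t).const_mul A).add
      (((hasDerivAt_pow 2 t).const_mul B).div_const 2)).add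
      (((hasDerivAt_pow 3 t).const_mul C).div_const 3)).add
      (((hasDerivAt_pow 4 t).const_mul D).div_const 4)
    exact h.congr_deriv (by push_cast; ring)
  rw [intervalIntegral.integral_eq_sub_of_hasDerivAt hd
    (Continuous.intervalIntegrable (by fun_prop) _ _)]
  ring

theorem setIntegral_refTriangle {f : ℝ × ℝ → ℝ} (hf : Continuous f) :
    ∫ x in refTriangle, f (x 0, x 1) = ∫ s in (0:ℝ)..1, ∫ t in (0:ℝ)..(1 - s), f (s, t) := by
  set R : Set (ℝ × ℝ) := {q | 0 ≤ q.1 ∧ 0 ≤ q.2 ∧ q.1 + q.2 ≤ 1} with hR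
  have hRc : IsClosed R := (isClosed_le continuous_const continuous_fst).inter
    ((isClosed_le continuous_const continuous_snd).inter
      (isClosed_le (continuous_fst.add continuous_snd) continuous_const))
  have hRm := hRc.measurableSet
  have hRk : IsCompact R := by
    refine (isCompact_Icc (a := (0:ℝ)) (b := 1)).prod (isCompact_Icc (a := (0:ℝ)) (b := 1))
      |>.of_isClosed_subset hRc ?_
    rintro ⟨s, t⟩ ⟨h1, h2, h3⟩
    exact ⟨⟨h1, by simp only at *; linarith⟩, ⟨h2, by simp only at *; linarith⟩⟩
  have hmp := (volume_preserving_finTwoArrow ℝ).comp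
    (EuclideanSpace.volume_preserving_symm_measurableEquiv_toLp (Fin 2))
  have e1 := hmp.setIntegral_preimage_emb ((MeasurableEquiv.finTwoArrow.measurableEmbedding).comp
    (MeasurableEquiv.toLp 2 (Fin 2 → ℝ)).symm.measurableEmbedding) f R
  have e2 : ∫ x in refTriangle, f (x 0, x 1) = ∫ q in R, f q := e1
  have hint : Integrable (R.indicator f) (volume.prod volume) :=
    (integrable_indicator_iff hRm).2 (hf.continuousOn.integrableOn_compact hRk)
  rw [e2, ← integral_indicator hRm, Measure.volume_eq_prod, integral_prod _ hint,
    intervalIntegral.integral_of_le zero_le_one, ← integral_Icc_eq_integral_Ioc,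
    ← integral_indicator measurableSet_Icc]
  refine integral_congr_ae (ae_of_all _ fun s => ?_)
  by_cases hs : s ∈ Icc (0:ℝ) 1
  · rw [indicator_of_mem hs, intervalIntegral.integral_of_le (by linarith [hs.2]),
      ← integral_Icc_eq_integral_Ioc, ← integral_indicator measurableSet_Icc]
    refine integral_congr_ae (ae_of_all _ fun t => ?_)
    by_cases ht : t ∈ Icc (0:ℝ) (1 - s)
    · have : (s, t) ∈ R := ⟨hs.1, ht.1, by linarith [ht.2]⟩
      simp only [indicator_of_mem this, indicator_of_mem ht]
    · have : (s, t) ∉ R := fun h => ht ⟨h.2.1, by linarith [h.2.2]⟩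
      simp only [indicator_of_notMem this, indicator_of_notMem ht]
  · rw [indicator_of_notMem hs]
    have : ∀ t, (s, t) ∉ R := fun t h => hs ⟨h.1, by
      have h2 := h.2.1; have h3 := h.2.2; simp only at h2 h3; linarith⟩
    simp only [indicator_of_notMem (this _), integral_zero]

/-- This is the element mass matrix: up to a factor, the identity plus the all-ones matrix. That
structure is what the weighted coercivity estimate exploits. -/
theorem setIntegral_refTriangle_mul (α₀ α₁ α₂ β₀ β₁ β₂ : ℝ) :
    ∫ x in refTriangle, (α₀ + x 0 * (α₁ - α₀) + x 1 * (α₂ - α₀))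
        * (β₀ + x 0 * (β₁ - β₀) + x 1 * (β₂ - β₀))
      = (α₀ * β₀ + α₁ * β₁ + α₂ * β₂ + (α₀ + α₁ + α₂) * (β₀ + β₁ + β₂)) / 24 := by
  rw [setIntegral_refTriangle (f := fun q => (α₀ + q.1 * (α₁ - α₀) + q.2 * (α₂ - α₀))
        * (β₀ + q.1 * (β₁ - β₀) + q.2 * (β₂ - β₀))) (by fun_prop)]
  have e1 : ∀ s : ℝ, ∫ t in (0:ℝ)..(1 - s), (α₀ + s * (α₁ - α₀) + t * (α₂ - α₀))
        * (β₀ + s * (β₁ - β₀) + t * (β₂ - β₀))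
      = (α₀ + s * (α₁ - α₀)) * (β₀ + s * (β₁ - β₀)) * (1 - s)
        + ((α₀ + s * (α₁ - α₀)) * (β₂ - β₀) + (α₂ - α₀) * (β₀ + s * (β₁ - β₀)))
          * (1 - s) ^ 2 / 2
        + (α₂ - α₀) * (β₂ - β₀) * (1 - s) ^ 3 / 3 + 0 * (1 - s) ^ 4 / 4 := fun s => by
    rw [← integral_cubic]
    congr 1; ext t; ring
  simp only [e1]
  set a1 := α₁ - α₀ with ha1
  set a2 := α₂ - α₀ with ha2
  set b1 := β₁ - β₀ with hb1
  set b2 := β₂ - β₀ with hb2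
  have e2 : ∀ s : ℝ, (α₀ + s * a1) * (β₀ + s * b1) * (1 - s)
        + ((α₀ + s * a1) * b2 + a2 * (β₀ + s * b1)) * (1 - s) ^ 2 / 2
        + a2 * b2 * (1 - s) ^ 3 / 3 + 0 * (1 - s) ^ 4 / 4
      = (α₀ * β₀ + (α₀ * b2 + a2 * β₀) / 2 + a2 * b2 / 3)
        + (α₀ * b1 + a1 * β₀ - α₀ * β₀ + (a1 * b2 + a2 * b1) / 2 - (α₀ * b2 + a2 * β₀)
          - a2 * b2) * s
        + (a1 * b1 - (α₀ * b1 + a1 * β₀) + (α₀ * b2 + a2 * β₀) / 2 - (a1 * b2 + a2 * b1)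
          + a2 * b2) * s ^ 2
        + (-a1 * b1 + (a1 * b2 + a2 * b1) / 2 - a2 * b2 / 3) * s ^ 3 := fun s => by ring
  simp only [e2, integral_cubic]
  rw [ha1, ha2, hb1, hb2]
  ring

theorem volume_real_refTriangle : volume.real refTriangle = 1 / 2 := by
  have h := setIntegral_refTriangle_mul 1 1 1 1 1 1
  norm_num at h
  exact h

/-- `V` is affine on the triangle with nodes `a`, `b`, `p`. -/
theorem affine_on_triangle {E : Type*} [AddCommGroup E] [Module ℝ E] {a b p : E} {V : E → ℝ}
    (A : E →ᵃ[ℝ] ℝ) (hA : EqOn V A (convexHull ℝ {a, b, p})) {x : Plane} (hx : x ∈ refTriangle) :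
    V (a + x 0 • (b - a) + x 1 • (p - a)) = V a + x 0 * (V b - V a) + x 1 * (V p - V a) := by
  have hs := subset_convexHull ℝ ({a, b, p} : Set E)
  rw [hA (hs (by simp : a ∈ _)), hA (hs (by simp : b ∈ _)), hA (hs (by simp : p ∈ _)),
    hA (by rw [convexHull_triangle]; exact mem_image_of_mem _ hx)]
  have e : a + x 0 • (b - a) + x 1 • (p - a) = (x 0 • (b - a) + x 1 • (p - a)) +ᵥ a := by
    rw [vadd_eq_add]; abel
  have h1 : A.linear (b - a) = A b - A a := by simpa using A.linearMap_vsub b a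
  have h2 : A.linear (p - a) = A p - A a := by simpa using A.linearMap_vsub p a
  rw [e, A.map_vadd, map_add, map_smul, map_smul, h1, h2]
  simp; ring

namespace TriangleFrame

variable {n : ℕ} {a b p e ν : EuclideanSpace ℝ (Fin n)} {ℓ k σ : ℝ}

theorem area_eq (h : TriangleFrame a b p e ν ℓ k σ) :
    μHE[2].real (convexHull ℝ {a, b, p}) = ℓ * k / 2 := by
  have := h.setIntegral_eq (fun _ => 1)
  simp only [integral_const, smul_eq_mul, mul_one, measureReal_restrict_apply_univ,
    volume_real_refTriangle] at this
  rw [this]; ring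

theorem setIntegral_mul_eq (h : TriangleFrame a b p e ν ℓ k σ)
    {V W : EuclideanSpace ℝ (Fin n) → ℝ} {A B : EuclideanSpace ℝ (Fin n) →ᵃ[ℝ] ℝ}
    (hV : EqOn V A (convexHull ℝ {a, b, p})) (hW : EqOn W B (convexHull ℝ {a, b, p})) :
    ∫ x in convexHull ℝ {a, b, p}, V x * W x ∂μHE[2]
      = μHE[2].real (convexHull ℝ {a, b, p}) / 12 *
        (V a * W a + V b * W b + V p * W p + (V a + V b + V p) * (W a + W b + W p)) := by
  rw [h.setIntegral_eq, h.area_eq, setIntegral_congr_fun measurableSet_refTriangle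
    (fun x hx => by rw [affine_on_triangle A hV hx, affine_on_triangle B hW hx]),
    setIntegral_refTriangle_mul]
  ring

/-- The gradient of the affine function with nodal values `α₀`, `α₁`, `α₂`. -/
theorem exists_gradient (h : TriangleFrame a b p e ν ℓ k σ) (α₀ α₁ α₂ : ℝ) :
    ∃ g ∈ vectorSpan ℝ ({a, b, p} : Set (EuclideanSpace ℝ (Fin n))),
      inner ℝ g (b - a) = α₁ - α₀ ∧ inner ℝ g (p - a) = α₂ - α₀ ∧
      ‖g‖ ^ 2 = ((α₁ - α₀) / ℓ) ^ 2 + ((α₂ - α₀ - σ * ((α₁ - α₀) / ℓ)) / k) ^ 2 := by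
  have hℓ := h.ℓ_pos.ne'
  have hk := h.k_pos.ne'
  have hb : b - a = ℓ • e := by rw [h.eq_b]; simp
  have hp : p - a = σ • e + k • ν := by rw [h.eq_p]; simp
  have hbs : ℓ • e ∈ vectorSpan ℝ ({a, b, p} : Set (EuclideanSpace ℝ (Fin n))) := by
    rw [← hb]; exact vsub_mem_vectorSpan ℝ (by simp) (by simp)
  have hps : σ • e + k • ν ∈ vectorSpan ℝ ({a, b, p} : Set (EuclideanSpace ℝ (Fin n))) := by
    rw [← hp]; exact vsub_mem_vectorSpan ℝ (by simp) (by simp)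
  have he : e ∈ vectorSpan ℝ ({a, b, p} : Set (EuclideanSpace ℝ (Fin n))) := by
    have := Submodule.smul_mem _ ℓ⁻¹ hbs
    rwa [smul_smul, inv_mul_cancel₀ hℓ, one_smul] at this
  have hν : ν ∈ vectorSpan ℝ ({a, b, p} : Set (EuclideanSpace ℝ (Fin n))) := by
    have := Submodule.smul_mem _ k⁻¹ (Submodule.sub_mem _ hps (Submodule.smul_mem _ σ he))
    rwa [add_sub_cancel_left, smul_smul, inv_mul_cancel₀ hk, one_smul] at this
  have i1 : inner ℝ e e = (1:ℝ) := by rw [real_inner_self_eq_norm_sq, h.norm_e, one_pow]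
  have i2 : inner ℝ ν ν = (1:ℝ) := by rw [real_inner_self_eq_norm_sq, h.norm_ν, one_pow]
  have i3 : inner ℝ ν e = (0:ℝ) := by rw [real_inner_comm, h.orth]
  refine ⟨((α₁ - α₀) / ℓ) • e + ((α₂ - α₀ - σ * ((α₁ - α₀) / ℓ)) / k) • ν,
    Submodule.add_mem _ (Submodule.smul_mem _ _ he) (Submodule.smul_mem _ _ hν), ?_, ?_,
    norm_chartLin_sq h.norm_e h.norm_ν h.orth _ _⟩
  · rw [hb]
    simp only [inner_add_left, inner_smul_left, inner_smul_right, i1, i3]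
    simp; field_simp
  · rw [hp]
    simp only [inner_add_left, inner_add_right, inner_smul_left, inner_smul_right, i1, i2, i3,
      h.orth]
    simp; field_simp; ring

theorem ℓ_eq (h : TriangleFrame a b p e ν ℓ k σ) : ℓ = dist a b := by
  rw [h.eq_b]; simp [norm_smul, h.norm_e, abs_of_pos h.ℓ_pos]

theorem dist_a_p_sq (h : TriangleFrame a b p e ν ℓ k σ) : dist a p ^ 2 = σ ^ 2 + k ^ 2 := by
  rw [dist_comm, dist_eq_norm, ← norm_chartLin_sq h.norm_e h.norm_ν h.orth, h.eq_p]; simp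

theorem dist_b_p_sq (h : TriangleFrame a b p e ν ℓ k σ) :
    dist b p ^ 2 = (σ - ℓ) ^ 2 + k ^ 2 := by
  rw [dist_comm, dist_eq_norm, ← norm_chartLin_sq h.norm_e h.norm_ν h.orth, h.eq_p, h.eq_b]
  congr 2; module

/-- Half a ball around the midpoint of an edge lies in the triangle. -/
theorem chart_mem_of_dist_lt (h : TriangleFrame a b p e ν ℓ k σ) {H γ ρ : ℝ}
    (hγ : 0 < γ) (hab : dist a b ≤ H) (hap : dist a p ≤ H) (hbp : dist b p ≤ H)
    (hsh : H ^ 2 ≤ γ * (ℓ * k / 2)) (hρ : ρ * (2 + γ) ≤ ℓ) {x : Plane}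
    (hx : dist x !₂[ℓ / 2, 0] < ρ) (hx1 : 0 ≤ x 1) :
    chart a e ν x ∈ convexHull ℝ {a, b, p} := by
  have hℓ := h.ℓ_pos
  have hk := h.k_pos
  have hH : 0 < H := by linarith [h.ℓ_eq]
  have hℓH : ℓ ≤ H := by rw [h.ℓ_eq]; exact hab
  have hσ : |σ| ≤ H := by
    refine abs_le_of_sq_le_sq ?_ hH.le
    have := h.dist_a_p_sq
    have h2 : dist a p ^ 2 ≤ H ^ 2 := by gcongr
    nlinarith
  have hσ' : |σ - ℓ| ≤ H := by
    refine abs_le_of_sq_le_sq ?_ hH.le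
    have := h.dist_b_p_sq
    have h2 : dist b p ^ 2 ≤ H ^ 2 := by gcongr
    nlinarith
  -- Shape regularity bounds the height from below: `H² ≤ γ ℓ k / 2` with `ℓ ≤ H`.
  have hkH : 2 * H ≤ γ * k := by nlinarith [mul_le_mul_of_nonneg_left hℓH (mul_pos hγ hk).le]
  have hd : (x 0 - ℓ / 2) ^ 2 + x 1 ^ 2 < ρ ^ 2 := by
    have : dist x !₂[ℓ / 2, 0] ^ 2 < ρ ^ 2 := by gcongr
    rw [EuclideanSpace.dist_eq, Real.sq_sqrt (Finset.sum_nonneg fun i _ => sq_nonneg _)] at this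
    simpa [Fin.sum_univ_two, Real.dist_eq, sq_abs] using this
  have hρ0 : 0 < ρ := dist_nonneg.trans_lt hx
  have h0 := abs_lt_of_sq_lt_sq (show (x 0 - ℓ / 2) ^ 2 < ρ ^ 2 by nlinarith) hρ0.le
  have h1 : x 1 ≤ ρ := by nlinarith
  -- At height at most `ρ` the slanted sides have moved inwards by at most `ρ γ / 2`. So the half
  -- disc fits if `ρ + ρ γ / 2 ≤ ℓ / 2`, which is the assumption on `ρ`.
  have hq : x 1 / k * H ≤ ρ * γ / 2 := by
    rw [div_mul_eq_mul_div, div_le_iff₀ hk]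
    nlinarith
  have hq0 : 0 ≤ x 1 / k := by positivity
  have a1 : σ * (x 1 / k) ≤ ρ * γ / 2 := by nlinarith [le_abs_self σ]
  have a2 : -(σ - ℓ) * (x 1 / k) ≤ ρ * γ / 2 := by nlinarith [neg_abs_le (σ - ℓ)]
  refine h.chart_mem hx1 ?_ ?_ <;> nlinarith [abs_lt.1 h0]

end TriangleFrame

/-! ### Single elements: area, mass matrix, inverse estimate -/

/-- `T` is the node set of a nondegenerate triangle. -/
structure IsTriangle {n : ℕ} (T : Finset (EuclideanSpace ℝ (Fin n))) : Prop where
  card_eq : T.card = 3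
  indep : AffineIndependent ℝ (fun z : T => (z : EuclideanSpace ℝ (Fin n)))

section Triangle

variable {n : ℕ} {T : Finset (EuclideanSpace ℝ (Fin n))}

theorem isCompact_triangleHull (T : Finset (EuclideanSpace ℝ (Fin n))) :
    IsCompact (triangleHull T) :=
  T.finite_toSet.isCompact_convexHull ℝ

theorem measurableSet_triangleHull (T : Finset (EuclideanSpace ℝ (Fin n))) :
    MeasurableSet (triangleHull T) :=
  (isCompact_triangleHull T).isClosed.measurableSet

theorem subset_triangleHull {z : EuclideanSpace ℝ (Fin n)} (hz : z ∈ T) : z ∈ triangleHull T :=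
  subset_convexHull ℝ _ hz

theorem dist_le_elementSize {x y : EuclideanSpace ℝ (Fin n)} (hx : x ∈ triangleHull T)
    (hy : y ∈ triangleHull T) : dist x y ≤ elementSize T :=
  Metric.dist_le_diam_of_mem (isCompact_triangleHull T).isBounded hx hy

theorem triangleHull_insert [DecidableEq (EuclideanSpace ℝ (Fin n))]
    (a b p : EuclideanSpace ℝ (Fin n)) :
    triangleHull ({a, b, p} : Finset (EuclideanSpace ℝ (Fin n))) = convexHull ℝ {a, b, p} := by
  simp [triangleHull]

open Classical in
theorem IsTriangle.exists_frame_of_mem (hT : IsTriangle T) {a b : EuclideanSpace ℝ (Fin n)}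
    (ha : a ∈ T) (hb : b ∈ T) (hab : b ≠ a) :
    ∃ p e ν ℓ k σ, p ≠ a ∧ p ≠ b ∧ T = {a, b, p} ∧ TriangleFrame a b p e ν ℓ k σ := by
  obtain ⟨p, hpa, hpb, hTe⟩ := Finset.exists_eq_insert_of_card_three hT.card_eq ha hb hab
  obtain ⟨e, ν, ℓ, k, σ, h⟩ := exists_triangleFrame_of_nondegenerate hT.card_eq hT.indep
    hab (p := p) (by rw [hTe]; simp)
  exact ⟨p, e, ν, ℓ, k, σ, hpa, hpb, hTe, h⟩

open Classical in
theorem IsTriangle.exists_frame (hT : IsTriangle T) : ∃ a b p e ν ℓ k σ,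
    b ≠ a ∧ p ≠ a ∧ p ≠ b ∧ T = {a, b, p} ∧ TriangleFrame a b p e ν ℓ k σ := by
  obtain ⟨a, b, c, hab, -, -, hTe⟩ := Finset.card_eq_three.1 hT.card_eq
  obtain ⟨p, e, ν, ℓ, k, σ, h⟩ := hT.exists_frame_of_mem (a := a) (b := b) (by simp [hTe])
    (by simp [hTe]) hab.symm
  exact ⟨a, b, p, e, ν, ℓ, k, σ, hab.symm, h⟩

theorem IsTriangle.area_pos (hT : IsTriangle T) : 0 < μHE[2].real (triangleHull T) := by
  classical
  obtain ⟨a, b, p, e, ν, ℓ, k, σ, -, -, -, rfl, h⟩ := hT.exists_frame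
  rw [triangleHull_insert, h.area_eq]
  have := h.ℓ_pos; have := h.k_pos; positivity

theorem IsTriangle.area_lt_top (hT : IsTriangle T) : μHE[2] (triangleHull T) < ⊤ := by
  refine lt_top_iff_ne_top.2 fun h => ?_
  have := hT.area_pos
  rw [Measure.real, h] at this
  simp at this

theorem IsTriangle.area_le (hT : IsTriangle T) :
    μHE[2].real (triangleHull T) ≤ elementSize T ^ 2 / 2 := by
  classical
  obtain ⟨a, b, p, e, ν, ℓ, k, σ, -, -, -, rfl, h⟩ := hT.exists_frame
  have hab : dist a b ≤ _ := dist_le_elementSize (T := {a, b, p})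
    (subset_triangleHull (by simp)) (subset_triangleHull (by simp))
  have hap : dist a p ≤ _ := dist_le_elementSize (T := {a, b, p})
    (subset_triangleHull (by simp)) (subset_triangleHull (by simp))
  rw [triangleHull_insert, h.area_eq]
  have h1 := h.dist_a_p_sq
  have hk : k ≤ dist a p := le_of_sq_le_sq (by nlinarith) dist_nonneg
  rw [← h.ℓ_eq] at hab
  have := h.ℓ_pos; have := h.k_pos
  nlinarith [mul_le_mul hab (hk.trans hap) h.k_pos.le (h.ℓ_pos.le.trans hab)]

theorem IsTriangle.elementSize_pos (hT : IsTriangle T) : 0 < elementSize T := by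
  have h1 := hT.area_le
  have h2 := hT.area_pos
  have h3 : 0 ≤ elementSize T := Metric.diam_nonneg
  rcases h3.eq_or_lt with h | h
  · rw [← h] at h1; norm_num at h1; linarith
  · exact h

theorem IsTriangle.isFiniteMeasure (hT : IsTriangle T) :
    IsFiniteMeasure (μHE[2].restrict (triangleHull T)) :=
  ⟨by simpa using hT.area_lt_top⟩

theorem IsTriangle.setIntegral_mul (hT : IsTriangle T) {V W : EuclideanSpace ℝ (Fin n) → ℝ}
    {A B : EuclideanSpace ℝ (Fin n) →ᵃ[ℝ] ℝ} (hV : EqOn V A (triangleHull T))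
    (hW : EqOn W B (triangleHull T)) :
    ∫ x in triangleHull T, V x * W x ∂μHE[2] = μHE[2].real (triangleHull T) / 12 *
      (∑ z ∈ T, V z * W z + (∑ z ∈ T, V z) * ∑ z ∈ T, W z) := by
  classical
  obtain ⟨a, b, p, e, ν, ℓ, k, σ, hab, hpa, hpb, rfl, h⟩ := hT.exists_frame
  rw [triangleHull_insert] at *
  rw [h.setIntegral_mul_eq hV hW]
  have : ∀ f : EuclideanSpace ℝ (Fin n) → ℝ, ∑ z ∈ {a, b, p}, f z = f a + f b + f p := fun f => by
    rw [Finset.sum_insert (by simp [hab.symm, hpa.symm]), Finset.sum_insert (by simp [hpb.symm]),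
      Finset.sum_singleton]
    ring
  simp only [this]

theorem IsTriangle.exists_affineMap (hT : IsTriangle T) (x : EuclideanSpace ℝ (Fin n) → ℝ) :
    ∃ A : EuclideanSpace ℝ (Fin n) →ᵃ[ℝ] ℝ, ∀ z ∈ T, A z = x z := by
  classical
  obtain ⟨a, b, p, e, ν, ℓ, k, σ, -, -, -, rfl, h⟩ := hT.exists_frame
  obtain ⟨g, -, hb, hp, -⟩ := h.exists_gradient (x a) (x b) (x p)
  refine ⟨((innerSL ℝ g).toLinearMap.toAffineMap.comp
    (AffineEquiv.vaddConst ℝ a).symm.toAffineMap) + AffineMap.const ℝ _ (x a), ?_⟩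
  intro z hz
  simp only [Finset.mem_insert, Finset.mem_singleton] at hz
  rcases hz with rfl | rfl | rfl
  · simp
  · simp [hb]
  · simp [hp]

/-- The components of the gradient are difference quotients with denominators `ℓ` and `k`, both
comparable to `H` by shape regularity: `H / ℓ` and `H / k` are at most `γ / 2`. The numerators do
not change when `c` is subtracted from all nodal values. -/
theorem gradient_sq_le {ℓ k σ H γ : ℝ} (hℓ : 0 < ℓ) (hk : 0 < k) (hH : 0 < H) (hℓH : ℓ ≤ H)
    (hkH : k ≤ H) (hσH : σ ^ 2 ≤ H ^ 2) (hγ : H ^ 2 ≤ γ * (ℓ * k / 2)) (α β δ c : ℝ) :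
    H ^ 2 * (((β - α) / ℓ) ^ 2 + ((δ - α - σ * ((β - α) / ℓ)) / k) ^ 2)
      ≤ γ ^ 2 * (6 + γ ^ 2) / 4 * ((α - c) ^ 2 + (β - c) ^ 2 + (δ - c) ^ 2) := by
  have hγ0 : 0 < γ := by
    by_contra hcon
    have : γ * (ℓ * k / 2) ≤ 0 := mul_nonpos_of_nonpos_of_nonneg (not_lt.1 hcon) (by positivity)
    have : 0 < H ^ 2 := by positivity
    linarith
  have h1 : 2 * H ≤ γ * ℓ := by
    refine le_of_mul_le_mul_right ?_ hH
    linarith [mul_le_mul_of_nonneg_left hkH (mul_pos hγ0 hℓ).le]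
  have h2 : 2 * H ≤ γ * k := by
    refine le_of_mul_le_mul_right ?_ hH
    linarith [mul_le_mul_of_nonneg_left hℓH (mul_pos hγ0 hk).le]
  set s := β - α with hs
  set t := δ - α with ht
  set N := (α - c) ^ 2 + (β - c) ^ 2 + (δ - c) ^ 2 with hN
  have q1 : H / ℓ ≤ γ / 2 := by rw [div_le_iff₀ hℓ]; linarith
  have q2 : H / k ≤ γ / 2 := by rw [div_le_iff₀ hk]; linarith
  have q1' : (H / ℓ) ^ 2 ≤ (γ / 2) ^ 2 := by gcongr
  have q2' : (H / k) ^ 2 ≤ (γ / 2) ^ 2 := by gcongr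
  have r1 : (σ * (s / ℓ)) ^ 2 ≤ (γ / 2) ^ 2 * s ^ 2 := by
    calc (σ * (s / ℓ)) ^ 2 = σ ^ 2 * (s / ℓ) ^ 2 := by ring
      _ ≤ H ^ 2 * (s / ℓ) ^ 2 := mul_le_mul_of_nonneg_right hσH (sq_nonneg _)
      _ = (H / ℓ) ^ 2 * s ^ 2 := by ring
      _ ≤ _ := mul_le_mul_of_nonneg_right q1' (sq_nonneg _)
  have r2 : (t - σ * (s / ℓ)) ^ 2 ≤ 2 * t ^ 2 + 2 * ((γ / 2) ^ 2 * s ^ 2) := by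
    linarith [sq_nonneg (t + σ * (s / ℓ)), sub_sq t (σ * (s / ℓ)), add_sq t (σ * (s / ℓ))]
  have s1 : s ^ 2 ≤ 2 * N := by
    have e : s = (β - c) - (α - c) := by rw [hs]; ring
    rw [e, hN]
    linarith [sub_sq (β - c) (α - c), add_sq (β - c) (α - c), sq_nonneg ((β - c) + (α - c)),
      sq_nonneg (δ - c)]
  have t1 : t ^ 2 ≤ 2 * N := by
    have e : t = (δ - c) - (α - c) := by rw [ht]; ring
    rw [e, hN]
    linarith [sub_sq (δ - c) (α - c), add_sq (δ - c) (α - c), sq_nonneg ((δ - c) + (α - c)),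
      sq_nonneg (β - c)]
  calc H ^ 2 * ((s / ℓ) ^ 2 + ((t - σ * (s / ℓ)) / k) ^ 2)
      = (H / ℓ) ^ 2 * s ^ 2 + (H / k) ^ 2 * (t - σ * (s / ℓ)) ^ 2 := by ring
    _ ≤ (γ / 2) ^ 2 * s ^ 2 + (γ / 2) ^ 2 * (2 * t ^ 2 + 2 * ((γ / 2) ^ 2 * s ^ 2)) :=
      add_le_add (mul_le_mul_of_nonneg_right q1' (sq_nonneg _))
        (mul_le_mul q2' r2 (sq_nonneg _) (sq_nonneg _))
    _ = (γ / 2) ^ 2 * ((1 + γ ^ 2 / 2) * s ^ 2 + 2 * t ^ 2) := by ring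
    _ ≤ (γ / 2) ^ 2 * ((1 + γ ^ 2 / 2) * (2 * N) + 2 * (2 * N)) :=
      mul_le_mul_of_nonneg_left (add_le_add (mul_le_mul_of_nonneg_left s1 (by positivity))
        (by linarith)) (sq_nonneg _)
    _ = _ := by ring

/-- An affine function on a triangle has a tangential gradient, which is bounded by the inverse
estimate. -/
theorem IsTriangle.exists_gradient (hT : IsTriangle T) {γ : ℝ}
    (hγ : elementSize T ^ 2 ≤ γ * μHE[2].real (triangleHull T))
    {V : EuclideanSpace ℝ (Fin n) → ℝ}
    {A : EuclideanSpace ℝ (Fin n) →ᵃ[ℝ] ℝ} (hV : EqOn V A (triangleHull T)) :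
    ∃ g ∈ vectorSpan ℝ (T : Set (EuclideanSpace ℝ (Fin n))),
      (∀ x ∈ triangleHull T, ∀ y ∈ triangleHull T, V y - V x = inner ℝ g (y - x)) ∧
      ∀ c : ℝ, elementSize T ^ 2 * ‖g‖ ^ 2
        ≤ γ ^ 2 * (6 + γ ^ 2) / 4 * ∑ z ∈ T, (V z - c) ^ 2 := by
  classical
  obtain ⟨a, b, p, e, ν, ℓ, k, σ, hab, hpa, hpb, rfl, h⟩ := hT.exists_frame
  have dab : dist a b ≤ _ := dist_le_elementSize (T := {a, b, p})
    (subset_triangleHull (by simp)) (subset_triangleHull (by simp))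
  have dap : dist a p ≤ _ := dist_le_elementSize (T := {a, b, p})
    (subset_triangleHull (by simp)) (subset_triangleHull (by simp))
  have hH := hT.elementSize_pos
  set H := elementSize ({a, b, p} : Finset (EuclideanSpace ℝ (Fin n))) with hHdef
  rw [triangleHull_insert] at *
  rw [h.area_eq] at hγ
  obtain ⟨g, hg, hgb, hgp, hgn⟩ := h.exists_gradient (V a) (V b) (V p)
  refine ⟨g, by simpa using hg, ?_, fun c => ?_⟩
  · have key : ∀ x ∈ convexHull ℝ {a, b, p}, V x = V a + inner ℝ g (x - a) := by
      intro x hx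
      rw [convexHull_triangle] at hx
      obtain ⟨q, hq, rfl⟩ := hx
      simp only
      rw [affine_on_triangle A hV hq, add_assoc a, add_sub_cancel_left, inner_add_right,
        inner_smul_right, inner_smul_right, hgb, hgp]
      ring
    intro x hx y hy
    rw [key x hx, key y hy, ← sub_sub_sub_cancel_right y x a, inner_sub_right g (y - a)]
    ring
  · have hℓ := h.ℓ_pos
    have hk := h.k_pos
    have hsum : ∑ z ∈ {a, b, p}, (V z - c) ^ 2 = (V a - c) ^ 2 + (V b - c) ^ 2 + (V p - c) ^ 2 := by
      rw [Finset.sum_insert (by simp [hab.symm, hpa.symm]), Finset.sum_insert (by simp [hpb.symm]),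
        Finset.sum_singleton]
      ring
    have hap2 := h.dist_a_p_sq
    have hap3 : dist a p ^ 2 ≤ H ^ 2 := by gcongr
    have hkH : k ≤ H := le_of_sq_le_sq (by nlinarith) hH.le
    have hσH : σ ^ 2 ≤ H ^ 2 := by nlinarith
    rw [← h.ℓ_eq] at dab
    rw [hsum, hgn]
    exact gradient_sq_le h.ℓ_pos h.k_pos hH dab hkH hσH hγ (V a) (V b) (V p) c

/-- A set of finite one-dimensional measure is null in dimension two. Hence the overlaps of the
elements of a mesh do not matter in integrals. -/
theorem euclideanHausdorffMeasure_segment (x y : EuclideanSpace ℝ (Fin n)) :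
    μHE[2] (segment ℝ x y) = 0 := by
  refine (Measure.euclideanHausdorffMeasure_zero_or_top one_lt_two _).resolve_right ?_
  have h1 : μH[((1 : ℕ) : ℝ)] (segment ℝ x y) = edist x y := by
    simp
  rw [Measure.euclideanHausdorffMeasure_def, Measure.smul_apply, h1]
  exact ENNReal.mul_ne_top ENNReal.coe_ne_top (edist_ne_top _ _)

theorem euclideanHausdorffMeasure_triangleHull_eq_zero {e : Finset (EuclideanSpace ℝ (Fin n))}
    (he : e.card ≤ 2) : μHE[2] (triangleHull e) = 0 := by
  classical
  rcases Nat.lt_or_ge e.card 1 with h | h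
  · have : e = ∅ := by rw [← Finset.card_eq_zero]; omega
    simp [this, triangleHull]
  rcases h.eq_or_lt with h | h
  · obtain ⟨x, rfl⟩ := Finset.card_eq_one.1 h.symm
    have := euclideanHausdorffMeasure_segment x x
    simpa [triangleHull] using this
  · obtain ⟨x, y, -, rfl⟩ := Finset.card_eq_two.1 (le_antisymm he h)
    have := euclideanHausdorffMeasure_segment x y
    simpa [triangleHull, convexHull_pair] using this

end Triangle

/-! ### Meshes: splitting of integrals and prescribed nodal values -/

section Mesh

variable {n : ℕ} {𝒯 : Finset (Finset (EuclideanSpace ℝ (Fin n)))}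
  {S : Set (EuclideanSpace ℝ (Fin n))}

theorem IsMesh.isTriangle (h : IsMesh 𝒯 S) {T : Finset (EuclideanSpace ℝ (Fin n))} (hT : T ∈ 𝒯) :
    IsTriangle T :=
  ⟨h.card_eq T hT, h.nondegenerate T hT⟩

theorem IsMesh.measure_inter (h : IsMesh 𝒯 S) {T T' : Finset (EuclideanSpace ℝ (Fin n))}
    (hT : T ∈ 𝒯) (hT' : T' ∈ 𝒯) (hne : T ≠ T') :
    μHE[2] (triangleHull T ∩ triangleHull T') = 0 := by
  obtain ⟨e, -, -, he, hi⟩ := h.regular T hT T' hT' hne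
  rw [hi, euclideanHausdorffMeasure_triangleHull_eq_zero he]

theorem IsMesh.surfaceMeasure_eq (h : IsMesh 𝒯 S) :
    surfaceMeasure 𝒯 = ∑ T ∈ 𝒯, μHE[2].restrict (triangleHull T) := by
  have e1 : (⋃ T ∈ 𝒯, triangleHull T) = ⋃ T : 𝒯, triangleHull (T : Finset _) := by
    rw [iUnion_subtype]
  rw [surfaceMeasure, e1, Measure.restrict_iUnion_ae, Measure.sum_fintype]
  · exact Finset.sum_coe_sort 𝒯 fun T => μHE[2].restrict (triangleHull T)
  · intro T T' hne
    exact h.measure_inter T.2 T'.2 fun h => hne (Subtype.ext h)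
  · exact fun T => (measurableSet_triangleHull _).nullMeasurableSet

theorem IsMesh.isFiniteMeasure (h : IsMesh 𝒯 S) : IsFiniteMeasure (surfaceMeasure 𝒯) := by
  refine ⟨?_⟩
  rw [h.surfaceMeasure_eq, Measure.finsetSum_apply]
  exact ENNReal.sum_lt_top.2 fun T hT => by simpa using (h.isTriangle hT).area_lt_top

theorem restrict_triangleHull_le {T : Finset (EuclideanSpace ℝ (Fin n))} (hT : T ∈ 𝒯) :
    μHE[2].restrict (triangleHull T) ≤ surfaceMeasure 𝒯 :=
  Measure.restrict_mono (subset_biUnion_of_mem (u := fun T => triangleHull T) hT) le_rfl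

theorem IsMesh.integral_eq_sum (h : IsMesh 𝒯 S) {F : Type*} [NormedAddCommGroup F]
    [NormedSpace ℝ F] {f : EuclideanSpace ℝ (Fin n) → F} (hf : Integrable f (surfaceMeasure 𝒯)) :
    ∫ x, f x ∂(surfaceMeasure 𝒯) = ∑ T ∈ 𝒯, ∫ x in triangleHull T, f x ∂μHE[2] := by
  rw [h.surfaceMeasure_eq, integral_finsetSum_measure]
  exact fun T hT => hf.mono_measure (restrict_triangleHull_le hT)

/-- Courant functions with arbitrary nodal values exist. -/
theorem IsMesh.exists_isCourant (h : IsMesh 𝒯 S) (x : EuclideanSpace ℝ (Fin n) → ℝ) :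
    ∃ V, IsCourant 𝒯 V ∧ ∀ T ∈ 𝒯, ∀ z ∈ T, V z = x z := by
  classical
  have hA : ∀ T : Finset (EuclideanSpace ℝ (Fin n)), ∃ A : EuclideanSpace ℝ (Fin n) →ᵃ[ℝ] ℝ,
      T ∈ 𝒯 → ∀ z ∈ T, A z = x z := fun T => by
    by_cases hT : T ∈ 𝒯
    · obtain ⟨A, hA⟩ := (h.isTriangle hT).exists_affineMap x
      exact ⟨A, fun _ => hA⟩
    · exact ⟨0, fun h => absurd h hT⟩
  choose A hA using hA
  set V : EuclideanSpace ℝ (Fin n) → ℝ := fun y =>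
    if hy : ∃ T ∈ 𝒯, y ∈ triangleHull T then A hy.choose y else 0 with hV
  have hVA : ∀ T ∈ 𝒯, EqOn V (A T) (triangleHull T) := by
    intro T hT y hy
    have hex : ∃ T ∈ 𝒯, y ∈ triangleHull T := ⟨T, hT, hy⟩
    have e : V y = A hex.choose y := dif_pos hex
    rw [e]
    obtain ⟨h1, h2⟩ := hex.choose_spec
    by_cases heq : hex.choose = T
    · rw [heq]
    -- Two elements meet in the hull of common nodes. Their affine interpolants agree there at the
    -- nodes and so on the hull, which makes the arbitrary choice in `V` harmless.
    obtain ⟨s, hs1, hs2, -, hs⟩ := h.regular _ h1 T hT heq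
    have hys : y ∈ triangleHull s := hs ▸ ⟨h2, hy⟩
    have hconv : Convex ℝ {y | A hex.choose y = A T y} := by
      intro y1 hy1 y2 hy2 α β _ _ hαβ
      have hy1' : A hex.choose y1 = A T y1 := hy1
      have hy2' : A hex.choose y2 = A T y2 := hy2
      show A hex.choose (α • y1 + β • y2) = A T (α • y1 + β • y2)
      rw [Convex.combo_affine_apply hαβ, Convex.combo_affine_apply hαβ, hy1', hy2']
    exact convexHull_min (fun z hz => show A hex.choose z = A T z by
      rw [hA _ h1 z (hs1 hz), hA T hT z (hs2 hz)]) hconv hys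
  refine ⟨V, ⟨?_, fun T hT => ⟨A T, hVA T hT⟩⟩, fun T hT z hz => ?_⟩
  · have e1 : (⋃ T ∈ 𝒯, triangleHull T) = ⋃ T : 𝒯, triangleHull (T : Finset _) := by
      rw [iUnion_subtype]
    rw [e1]
    refine (locallyFinite_of_finite _).continuousOn_iUnion
      (fun T => (isCompact_triangleHull _).isClosed) fun T => ?_
    exact ((A T).continuous_of_finiteDimensional.continuousOn).congr (hVA T T.2)
  · rw [hVA T hT (subset_triangleHull hz), hA T hT z hz]

end Mesh

/-! ### Coercivity of the weighted element mass matrix -/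

/-- For fixed extremes the product of sums is convex in the middle value, hence largest when that
value equals an extreme. It is then `5 + 2 (r + 1 / r)` with `r = D₃ / D₁`, and `9.87 + 1 / 9.87 <
9.98` gives `24.96`, still below `25`. -/
theorem sum_mul_sum_inv_le_of_sorted {D₁ D₂ D₃ : ℝ} (h₁ : 0 < D₁) (h₁₂ : D₁ ≤ D₂) (h₂₃ : D₂ ≤ D₃)
    (h : D₃ ≤ 9.87 * D₁) :
    (D₁ + D₂ + D₃) * (D₂ * D₃ + D₁ * D₃ + D₁ * D₂) ≤ 24.96 * (D₁ * D₂ * D₃) := by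
  have h2 : 0 < D₂ := h₁.trans_le h₁₂
  have h3 : 0 < D₃ := h2.trans_le h₂₃
  have e1 : D₃ ^ 2 + D₁ ^ 2 ≤ 9.98 * (D₁ * D₃) := by
    have h4 : D₁ / 9.87 ≤ D₁ := div_le_self h₁.le (by norm_num)
    have := mul_nonneg (sub_nonneg.2 h) (show 0 ≤ D₃ - D₁ / 9.87 by linarith)
    nlinarith [mul_pos h₁ h3]
  have e2 : D₂ * (D₃ ^ 2 + D₁ ^ 2) ≤ D₂ * (9.98 * (D₁ * D₃)) := mul_le_mul_of_nonneg_left e1 h2.le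
  -- Expanded, this is `(D₂² + D₁ D₃) (D₁ + D₃) ≤ D₂ (D₁ + D₃)²`, the replacement of the middle
  -- value by an extreme one.
  have e3 := mul_nonneg (mul_nonneg (sub_nonneg.2 h₁₂) (sub_nonneg.2 h₂₃)) (add_pos h₁ h3).le
  nlinarith [mul_pos (mul_pos h₁ h2) h3]

theorem sum_mul_sum_inv_le {D₁ D₂ D₃ : ℝ} (h₁ : 0 < D₁) (h₂ : 0 < D₂) (h₃ : 0 < D₃)
    (h₁₂ : D₁ ≤ 9.87 * D₂) (h₂₁ : D₂ ≤ 9.87 * D₁) (h₁₃ : D₁ ≤ 9.87 * D₃) (h₃₁ : D₃ ≤ 9.87 * D₁)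
    (h₂₃ : D₂ ≤ 9.87 * D₃) (h₃₂ : D₃ ≤ 9.87 * D₂) :
    (D₁ + D₂ + D₃) * (D₂ * D₃ + D₁ * D₃ + D₁ * D₂) ≤ 24.96 * (D₁ * D₂ * D₃) := by
  rcases le_total D₁ D₂ with a | a <;> rcases le_total D₂ D₃ with b | b <;>
    rcases le_total D₁ D₃ with c | c
  · linarith [sum_mul_sum_inv_le_of_sorted h₁ a b h₃₁]
  · linarith [sum_mul_sum_inv_le_of_sorted h₁ a b h₃₁]
  · linarith [sum_mul_sum_inv_le_of_sorted h₁ c b h₂₁]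
  · linarith [sum_mul_sum_inv_le_of_sorted h₃ c a h₂₃]
  · linarith [sum_mul_sum_inv_le_of_sorted h₂ a c h₃₂]
  · linarith [sum_mul_sum_inv_le_of_sorted h₂ b c h₁₂]
  · linarith [sum_mul_sum_inv_le_of_sorted h₃ b a h₁₃]
  · linarith [sum_mul_sum_inv_le_of_sorted h₃ b a h₁₃]

/-- Positivity of the weighted element mass matrix for weights with ratios at most `π`. -/
theorem weighted_mass_coercive {d₁ d₂ d₃ : ℝ} (h₁ : 0 < d₁) (h₂ : 0 < d₂) (h₃ : 0 < d₃)
    (h₁₂ : d₁ ≤ Real.pi * d₂) (h₂₁ : d₂ ≤ Real.pi * d₁) (h₁₃ : d₁ ≤ Real.pi * d₃)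
    (h₃₁ : d₃ ≤ Real.pi * d₁) (h₂₃ : d₂ ≤ Real.pi * d₃) (h₃₂ : d₃ ≤ Real.pi * d₂)
    (y₁ y₂ y₃ : ℝ) :
    (1 / 1000) * (y₁ ^ 2 + y₂ ^ 2 + y₃ ^ 2) ≤ y₁ ^ 2 + y₂ ^ 2 + y₃ ^ 2
      + (y₁ / d₁ + y₂ / d₂ + y₃ / d₃) * (d₁ * y₁ + d₂ * y₂ + d₃ * y₃) := by
  have hpi : Real.pi ^ 2 ≤ 9.87 := by nlinarith [Real.pi_lt_d4, Real.pi_pos]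
  have hsq : ∀ {s t : ℝ}, 0 < s → 0 < t → s ≤ Real.pi * t → s ^ 2 ≤ 9.87 * t ^ 2 := by
    intro s t hs ht h
    calc s ^ 2 ≤ (Real.pi * t) ^ 2 := by gcongr
      _ = Real.pi ^ 2 * t ^ 2 := by ring
      _ ≤ _ := by gcongr
  set Q := d₁ ^ 2 + d₂ ^ 2 + d₃ ^ 2 with hQ
  set P := (1 / d₁) ^ 2 + (1 / d₂) ^ 2 + (1 / d₃) ^ 2 with hP
  have hQ0 : 0 < Q := by positivity
  have hP0 : 0 < P := by positivity
  have hQP : Q * P ≤ 24.96 := by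
    have h := sum_mul_sum_inv_le (pow_pos h₁ 2) (pow_pos h₂ 2) (pow_pos h₃ 2) (hsq h₁ h₂ h₁₂)
      (hsq h₂ h₁ h₂₁) (hsq h₁ h₃ h₁₃) (hsq h₃ h₁ h₃₁) (hsq h₂ h₃ h₂₃) (hsq h₃ h₂ h₃₂)
    have e : Q * P = (d₁ ^ 2 + d₂ ^ 2 + d₃ ^ 2) * (d₂ ^ 2 * d₃ ^ 2 + d₁ ^ 2 * d₃ ^ 2
        + d₁ ^ 2 * d₂ ^ 2) / (d₁ ^ 2 * d₂ ^ 2 * d₃ ^ 2) := by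
      rw [hQ, hP]; field_simp
    rw [e, div_le_iff₀ (by positivity)]
    exact h
  -- This scaling gives `θ / d` and `d` the same Euclidean norm, for which the bound below on the
  -- product `X Z` of the two linear forms is sharp.
  set θ := Real.sqrt (Q / P) with hθ
  have hθ0 : 0 < θ := Real.sqrt_pos.2 (by positivity)
  have hθ2 : θ ^ 2 * P = Q := by
    rw [hθ, Real.sq_sqrt (by positivity)]; field_simp
  have hQθ : Q ≤ 4.996 * θ := by
    refine le_of_sq_le_sq ?_ (by positivity)
    have : Q * (θ ^ 2 * P) ≤ 24.96 * θ ^ 2 := by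
      calc Q * (θ ^ 2 * P) = (Q * P) * θ ^ 2 := by ring
        _ ≤ _ := by gcongr
    rw [hθ2] at this
    nlinarith [sq_nonneg θ]
  set X := y₁ / d₁ + y₂ / d₂ + y₃ / d₃ with hX
  set Z := d₁ * y₁ + d₂ * y₂ + d₃ * y₃ with hZ
  set Y := y₁ ^ 2 + y₂ ^ 2 + y₃ ^ 2 with hY
  have hY0 : 0 ≤ Y := by positivity
  -- Cauchy–Schwarz for the vector `θ / d - d`; its mixed terms sum to `-6 θ`.
  have hCS : (θ * X - Z) ^ 2 ≤ (θ ^ 2 * P - 6 * θ + Q) * Y := by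
    have e1 : θ * X - Z = (θ / d₁ - d₁) * y₁ + (θ / d₂ - d₂) * y₂ + (θ / d₃ - d₃) * y₃ := by
      rw [hX, hZ]; ring
    have e2 : θ ^ 2 * P - 6 * θ + Q
        = (θ / d₁ - d₁) ^ 2 + (θ / d₂ - d₂) ^ 2 + (θ / d₃ - d₃) ^ 2 := by
      rw [hP, hQ]; field_simp; ring
    rw [e1, e2, hY]
    set c₁ := θ / d₁ - d₁
    set c₂ := θ / d₂ - d₂
    set c₃ := θ / d₃ - d₃
    linarith [sq_nonneg (c₁ * y₂ - c₂ * y₁), sq_nonneg (c₁ * y₃ - c₃ * y₁),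
      sq_nonneg (c₂ * y₃ - c₃ * y₂)]
  rw [hθ2] at hCS
  -- Polarization: `4 θ X Z = (θ X + Z)² - (θ X - Z)²`. With `Q ≤ 4.996 θ` this yields `X Z ≥ -0.998
  -- Y`, so the term `Y` of the mass matrix wins.
  have hbound : -(2 * Q - 6 * θ) * Y ≤ 4 * θ * (X * Z) := by nlinarith [sq_nonneg (θ * X + Z)]
  have h3 : -(3.992 * θ) * Y ≤ 4 * θ * (X * Z) :=
    (mul_le_mul_of_nonneg_right (by linarith) hY0).trans hbound
  have h4 : -(0.998) * Y ≤ X * Z := by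
    refine le_of_mul_le_mul_left ?_ (show 0 < 4 * θ by positivity)
    linarith
  linarith

/-! ### The Courant space and the existence of the projection -/

section Courant

variable {n : ℕ} {𝒯 : Finset (Finset (EuclideanSpace ℝ (Fin n)))}
  {S : Set (EuclideanSpace ℝ (Fin n))}

theorem isCompact_iUnion_triangleHull (𝒯 : Finset (Finset (EuclideanSpace ℝ (Fin n)))) :
    IsCompact (⋃ T ∈ 𝒯, triangleHull T) :=
  𝒯.isCompact_biUnion fun T _ => isCompact_triangleHull T

theorem IsCourant.memLp (h : IsMesh 𝒯 S) {V : EuclideanSpace ℝ (Fin n) → ℝ} (hV : IsCourant 𝒯 V)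
    (p : ENNReal) : MemLp V p (surfaceMeasure 𝒯) := by
  have := h.isFiniteMeasure
  have hK := isCompact_iUnion_triangleHull 𝒯
  obtain ⟨C, hC⟩ := hK.exists_bound_of_continuousOn hV.1
  exact MemLp.of_bound (hV.1.aestronglyMeasurable hK.isClosed.measurableSet) C
    (ae_restrict_of_forall_mem hK.isClosed.measurableSet hC)

theorem IsCourant.sub {V W : EuclideanSpace ℝ (Fin n) → ℝ} (hV : IsCourant 𝒯 V)
    (hW : IsCourant 𝒯 W) : IsCourant 𝒯 (fun x => V x - W x) := by
  refine ⟨hV.1.sub hW.1, fun T hT => ?_⟩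
  obtain ⟨A, hA⟩ := hV.2 T hT
  obtain ⟨B, hB⟩ := hW.2 T hT
  exact ⟨A - B, fun x hx => by simp [hA hx, hB hx]⟩

theorem isCourant_sum {ι : Type*} (s : Finset ι) {φ : ι → EuclideanSpace ℝ (Fin n) → ℝ}
    (hφ : ∀ i ∈ s, IsCourant 𝒯 (φ i)) (c : ι → ℝ) :
    IsCourant 𝒯 (fun x => ∑ i ∈ s, c i * φ i x) := by
  refine ⟨continuousOn_finsetSum s fun i hi => continuousOn_const.mul (hφ i hi).1, fun T hT => ?_⟩
  have : ∀ i, ∃ A : EuclideanSpace ℝ (Fin n) →ᵃ[ℝ] ℝ, i ∈ s → EqOn (φ i) A (triangleHull T) :=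
    fun i => by
      by_cases hi : i ∈ s
      · obtain ⟨A, hA⟩ := (hφ i hi).2 T hT
        exact ⟨A, fun _ => hA⟩
      · exact ⟨0, fun h => absurd h hi⟩
  choose A hA using this
  refine ⟨∑ i ∈ s, c i • A i, fun x hx => ?_⟩
  have e : (∑ i ∈ s, c i • A i : EuclideanSpace ℝ (Fin n) →ᵃ[ℝ] ℝ) x
      = ∑ i ∈ s, (c i • A i : EuclideanSpace ℝ (Fin n) →ᵃ[ℝ] ℝ) x := by
    induction s using Finset.cons_induction with
    | empty => simp
    | cons i s hi ih =>
      rw [Finset.sum_cons, Finset.sum_cons, AffineMap.coe_add, Pi.add_apply,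
        ih (fun j hj => hφ j (Finset.mem_cons_of_mem hj))
          (fun j hj => hA j (Finset.mem_cons_of_mem hj))]
  rw [e]
  exact Finset.sum_congr rfl fun i hi => by simp [hA i hi hx]

/-- Courant functions are determined by their nodal values. -/
theorem IsCourant.eqOn {V W : EuclideanSpace ℝ (Fin n) → ℝ} (hV : IsCourant 𝒯 V)
    (hW : IsCourant 𝒯 W) (hVW : ∀ T ∈ 𝒯, ∀ z ∈ T, V z = W z) :
    EqOn V W (⋃ T ∈ 𝒯, triangleHull T) := by
  intro x hx
  obtain ⟨T, hT, hx⟩ := mem_iUnion₂.1 hx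
  obtain ⟨A, hA⟩ := hV.2 T hT
  obtain ⟨B, hB⟩ := hW.2 T hT
  rw [hA hx, hB hx]
  have hconv : Convex ℝ {y | A y = B y} := by
    intro y1 hy1 y2 hy2 α β _ _ hαβ
    have hy1' : A y1 = B y1 := hy1
    have hy2' : A y2 = B y2 := hy2
    show A (α • y1 + β • y2) = B (α • y1 + β • y2)
    rw [Convex.combo_affine_apply hαβ, Convex.combo_affine_apply hαβ, hy1', hy2']
  exact convexHull_min (fun z hz => show A z = B z by
    rw [← hA (subset_triangleHull hz), ← hB (subset_triangleHull hz), hVW T hT z hz]) hconv hx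

theorem IsMesh.integral_mul_eq_sum (h : IsMesh 𝒯 S) {V W : EuclideanSpace ℝ (Fin n) → ℝ}
    (hV : MemLp V 2 (surfaceMeasure 𝒯)) (hW : MemLp W 2 (surfaceMeasure 𝒯)) :
    ∫ x, V x * W x ∂(surfaceMeasure 𝒯)
      = ∑ T ∈ 𝒯, ∫ x in triangleHull T, V x * W x ∂μHE[2] :=
  h.integral_eq_sum (hV.integrable_mul hW)

theorem IsMesh.setIntegral_mul (h : IsMesh 𝒯 S) {V W : EuclideanSpace ℝ (Fin n) → ℝ}
    (hV : IsCourant 𝒯 V) (hW : IsCourant 𝒯 W) {T : Finset (EuclideanSpace ℝ (Fin n))}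
    (hT : T ∈ 𝒯) :
    ∫ x in triangleHull T, V x * W x ∂μHE[2] = μHE[2].real (triangleHull T) / 12 *
      (∑ z ∈ T, V z * W z + (∑ z ∈ T, V z) * ∑ z ∈ T, W z) := by
  obtain ⟨A, hA⟩ := hV.2 T hT
  obtain ⟨B, hB⟩ := hW.2 T hT
  exact (h.isTriangle hT).setIntegral_mul hA hB

/-- The `L₂`-projection onto the Courant space exists. -/
theorem IsMesh.exists_isL2Projection (h : IsMesh 𝒯 S) {u : EuclideanSpace ℝ (Fin n) → ℝ}
    (hu : MemLp u 2 (surfaceMeasure 𝒯)) : ∃ V, IsL2Projection 𝒯 (surfaceMeasure 𝒯) u V := by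
  classical
  set N := 𝒯.biUnion id with hN
  have hmemN : ∀ T ∈ 𝒯, ∀ z ∈ T, z ∈ N := fun T hT z hz => Finset.mem_biUnion.2 ⟨T, hT, hz⟩
  choose φ hφC hφ using fun z : N => h.exists_isCourant (fun y => if y = z then 1 else 0)
  have hφL : ∀ z, MemLp (φ z) 2 (surfaceMeasure 𝒯) := fun z => (hφC z).memLp h 2
  set comb : (N → ℝ) → EuclideanSpace ℝ (Fin n) → ℝ := fun x y => ∑ z, x z * φ z y with hcomb
  have hcC : ∀ x, IsCourant 𝒯 (comb x) := fun x => isCourant_sum _ (fun z _ => hφC z) x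
  have hcL : ∀ x, MemLp (comb x) 2 (surfaceMeasure 𝒯) := fun x => (hcC x).memLp h 2
  have hcz : ∀ x : N → ℝ, ∀ T ∈ 𝒯, ∀ z ∈ T, ∀ hz : z ∈ N, comb x z = x ⟨z, hz⟩ := by
    intro x T hT z hzT hz
    simp only [comb]
    rw [Finset.sum_eq_single ⟨z, hz⟩]
    · rw [hφ _ T hT z hzT]; simp
    · intro w _ hw
      rw [hφ _ T hT z hzT, if_neg (fun h => hw (Subtype.ext h.symm)), mul_zero]
    · simp
  have hmul : ∀ x : N → ℝ, ∀ v, MemLp v 2 (surfaceMeasure 𝒯) →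
      ∫ y, comb x y * v y ∂(surfaceMeasure 𝒯)
        = ∑ z, x z * ∫ y, φ z y * v y ∂(surfaceMeasure 𝒯) := by
    intro x v hv
    simp only [comb, Finset.sum_mul, mul_assoc]
    have hi : ∀ z ∈ Finset.univ, Integrable (fun y => x z * (φ z y * v y)) (surfaceMeasure 𝒯) :=
      fun z _ => ((hφL z).integrable_mul hv).const_mul (x z)
    rw [integral_finsetSum _ hi]
    simp only [integral_const_mul]
  let L : (N → ℝ) →ₗ[ℝ] (N → ℝ) :=
    Matrix.toLin' (Matrix.of fun z w : N => ∫ y, φ w y * φ z y ∂(surfaceMeasure 𝒯))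
  have hL : ∀ x z, L x z = ∫ y, comb x y * φ z y ∂(surfaceMeasure 𝒯) := by
    intro x z
    rw [hmul x _ (hφL z)]
    simp [L, Matrix.mulVec, dotProduct, mul_comm]
  -- The kernel of the Gram matrix is trivial: a combination orthogonal to all nodal functions has
  -- norm zero, and the mass matrix formula on each element then forces its nodal values to vanish.
  have hinj : Function.Injective L := by
    rw [← LinearMap.ker_eq_bot, LinearMap.ker_eq_bot']
    intro x hx
    have h0 : ∫ y, comb x y * comb x y ∂(surfaceMeasure 𝒯) = 0 := by
      rw [hmul x _ (hcL x)]
      refine Finset.sum_eq_zero fun z _ => ?_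
      have := congrFun hx z
      rw [hL] at this
      simp only [mul_comm (φ z _), this, Pi.zero_apply, mul_zero]
    rw [h.integral_mul_eq_sum (hcL x) (hcL x), Finset.sum_eq_zero_iff_of_nonneg
      (fun T _ => integral_nonneg fun y => mul_self_nonneg _)] at h0
    ext ⟨z, hz⟩
    obtain ⟨T, hT, hzT⟩ := Finset.mem_biUnion.1 hz
    have h1 := h0 T hT
    rw [h.setIntegral_mul (hcC x) (hcC x) hT] at h1
    have h2 : (∑ z ∈ T, comb x z * comb x z) + (∑ z ∈ T, comb x z) * ∑ z ∈ T, comb x z = 0 := by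
      have := (h.isTriangle hT).area_pos
      rcases mul_eq_zero.1 h1 with h3 | h3
      · linarith
      · exact h3
    have h3 : comb x z * comb x z ≤ ∑ z ∈ T, comb x z * comb x z :=
      Finset.single_le_sum (f := fun z => comb x z * comb x z) (fun z _ => mul_self_nonneg _) hzT
    have h4 : comb x z = 0 := by
      nlinarith [mul_self_nonneg (∑ z ∈ T, comb x z), mul_self_nonneg (comb x z)]
    rw [← hcz x T hT z hzT hz, h4]; rfl
  -- In finite dimension injectivity suffices to solve the normal equations.
  obtain ⟨x, hx⟩ := LinearMap.injective_iff_surjective.1 hinj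
    (fun z => ∫ y, φ z y * u y ∂(surfaceMeasure 𝒯))
  refine ⟨comb x, hcC x, fun W hW => ?_⟩
  have hWL := hW.memLp h 2
  have hWe : ∀ᵐ y ∂(surfaceMeasure 𝒯), W y = comb (fun z => W z) y := by
    refine ae_restrict_of_forall_mem
      (isCompact_iUnion_triangleHull 𝒯).isClosed.measurableSet ?_
    exact hW.eqOn (hcC _) fun T hT z hz => (hcz (fun z => W z) T hT z hz (hmemN T hT z hz)).symm
  have e1 : ∫ y, W y * (u y - comb x y) ∂(surfaceMeasure 𝒯)
      = ∫ y, comb (fun z => W z) y * (u y - comb x y) ∂(surfaceMeasure 𝒯) :=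
    integral_congr_ae (hWe.mono fun y hy => by simp only [← hy])
  have hsub : MemLp (fun y => u y - comb x y) 2 (surfaceMeasure 𝒯) := hu.sub (hcL x)
  rw [e1, hmul _ _ hsub]
  refine Finset.sum_eq_zero fun z _ => ?_
  have e2 := congrFun hx z
  rw [hL] at e2
  have e3 : ∫ y, φ z y * (u y - comb x y) ∂(surfaceMeasure 𝒯) = 0 := by
    simp only [mul_sub]
    have i1 : Integrable (fun y => φ z y * u y) (surfaceMeasure 𝒯) := (hφL z).integrable_mul hu
    have i2 : Integrable (fun y => φ z y * comb x y) (surfaceMeasure 𝒯) :=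
      (hφL z).integrable_mul (hcL x)
    rw [integral_sub i1 i2, ← e2]
    simp only [mul_comm (φ z _), sub_self]
  rw [e3, mul_zero]

end Courant

/-! ### Chains of elements and local estimates -/

/-- If a function varies by at most `δ` along each link of a chain in a finite set, then its
variation between the ends of the chain is at most the number of elements times `δ`. -/
theorem abs_sub_le_of_reflTransGen {α : Type*} {s : Finset α} {r : α → α → Prop} {f : α → ℝ}
    {δ : ℝ} (hδ : 0 ≤ δ) (h : ∀ a ∈ s, ∀ b ∈ s, a ≠ b → r a b → |f a - f b| ≤ δ) {a b : α}
    (ha : a ∈ s) (hab : Relation.ReflTransGen (fun x y => y ∈ s ∧ r x y) a b) :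
    |f a - f b| ≤ s.card * δ := by
  classical
  let G : SimpleGraph s := SimpleGraph.fromRel fun x y => r x y
  have hadj : ∀ x y : s, G.Adj x y → |f x - f y| ≤ δ := by
    intro x y hxy
    rw [SimpleGraph.fromRel_adj] at hxy
    have hne : (x : α) ≠ y := fun e => hxy.1 (Subtype.ext e)
    rcases hxy.2 with hr | hr
    · exact h x x.2 y y.2 hne hr
    · rw [abs_sub_comm]; exact h y y.2 x x.2 hne.symm hr
  have hreach : ∃ hb : b ∈ s, G.Reachable ⟨a, ha⟩ ⟨b, hb⟩ := by
    induction hab with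
    | refl => exact ⟨ha, SimpleGraph.Reachable.refl _⟩
    | @tail x y _ hxy ih =>
      obtain ⟨hx, hr⟩ := ih
      refine ⟨hxy.1, ?_⟩
      -- A chain may repeat an element, whereas the simple graph has no loops; such links are
      -- dropped.
      by_cases hxe : x = y
      · subst hxe; exact hr
      · refine hr.trans (SimpleGraph.Adj.reachable ?_)
        rw [SimpleGraph.fromRel_adj]
        exact ⟨fun e => hxe (Subtype.ext_iff.1 e), Or.inl hxy.2⟩
  obtain ⟨hb, hr⟩ := hreach
  -- A path visits no vertex twice, so its length is below the number of elements, however long the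
  -- given chain is.
  obtain ⟨p, hp⟩ := hr.exists_isPath
  have hwalk : ∀ {x y : s} (p : G.Walk x y), |f x - f y| ≤ p.length * δ := by
    intro x y p
    induction p with
    | nil => simp
    | @cons x z y hxz q ih =>
      rw [SimpleGraph.Walk.length_cons]
      calc |f x - f y| ≤ |f x - f z| + |f z - f y| := abs_sub_le _ _ _
        _ ≤ δ + q.length * δ := add_le_add (hadj _ _ hxz) ih
        _ = _ := by push_cast; ring
  have hlen := hp.length_lt
  rw [Fintype.card_coe] at hlen
  refine (hwalk p).trans (mul_le_mul_of_nonneg_right ?_ hδ)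
  exact_mod_cast hlen.le

/-- Local estimates for a function `u` with gradient `G`: a Poincaré inequality on each element, and
a bound of the jumps between elements that share an edge. -/
structure HasLocalEstimates {n : ℕ} (𝒯 : Finset (Finset (EuclideanSpace ℝ (Fin n))))
    (u : EuclideanSpace ℝ (Fin n) → ℝ) (G : EuclideanSpace ℝ (Fin n) → EuclideanSpace ℝ (Fin n))
    (K : ℝ) (c : Finset (EuclideanSpace ℝ (Fin n)) → ℝ) : Prop where
  poincare : ∀ T ∈ 𝒯, ∫ x in triangleHull T, (u x - c T) ^ 2 ∂μHE[2]
    ≤ K * elementSize T ^ 2 * ∫ x in triangleHull T, ‖G x‖ ^ 2 ∂μHE[2]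
  jump : ∀ T ∈ 𝒯, ∀ T' ∈ 𝒯, T ≠ T' → ∀ z a, a ≠ z → z ∈ T → a ∈ T → z ∈ T' → a ∈ T' →
    (c T - c T') ^ 2 ≤ K * (∫ x in triangleHull T, ‖G x‖ ^ 2 ∂μHE[2]
      + ∫ x in triangleHull T', ‖G x‖ ^ 2 ∂μHE[2])

/-! ### Weighted stability of the projection -/

section Stability

variable {n : ℕ} {𝒯 : Finset (Finset (EuclideanSpace ℝ (Fin n)))}
  {S : Set (EuclideanSpace ℝ (Fin n))}

theorem isCourant_const (c : ℝ) : IsCourant 𝒯 (fun _ => c) :=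
  ⟨continuousOn_const, fun _ _ => ⟨AffineMap.const ℝ _ c, fun _ _ => rfl⟩⟩

/-- With `y = V / d` one has `W = y / d` and `V = d y`, so this is `weighted_mass_coercive` at the
three nodes. -/
theorem sum_weighted_mass_coercive {T : Finset (EuclideanSpace ℝ (Fin n))} (hT : T.card = 3)
    {d : EuclideanSpace ℝ (Fin n) → ℝ} (hd : ∀ z ∈ T, 0 < d z)
    (hr : ∀ z ∈ T, ∀ z' ∈ T, d z ≤ Real.pi * d z') {V W : EuclideanSpace ℝ (Fin n) → ℝ}
    (hW : ∀ z ∈ T, W z = V z / d z ^ 2) :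
    (1 / 1000) * ∑ z ∈ T, (V z / d z) ^ 2
      ≤ ∑ z ∈ T, W z * V z + (∑ z ∈ T, W z) * ∑ z ∈ T, V z := by
  classical
  obtain ⟨a, b, p, hab, hap, hbp, rfl⟩ := Finset.card_eq_three.1 hT
  have hsum : ∀ f : EuclideanSpace ℝ (Fin n) → ℝ, ∑ z ∈ {a, b, p}, f z = f a + f b + f p :=
    fun f => by
      rw [Finset.sum_insert (by simp [hab, hap]), Finset.sum_insert (by simp [hbp]),
        Finset.sum_singleton]
      ring
  have ma : a ∈ ({a, b, p} : Finset (EuclideanSpace ℝ (Fin n))) := by simp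
  have mb : b ∈ ({a, b, p} : Finset (EuclideanSpace ℝ (Fin n))) := by simp
  have mp : p ∈ ({a, b, p} : Finset (EuclideanSpace ℝ (Fin n))) := by simp
  have da := hd a ma
  have db := hd b mb
  have dp := hd p mp
  have key := weighted_mass_coercive da db dp (hr a ma b mb) (hr b mb a ma) (hr a ma p mp)
    (hr p mp a ma) (hr b mb p mp) (hr p mp b mb) (V a / d a) (V b / d b) (V p / d p)
  simp only [hsum, hW a ma, hW b mb, hW p mp]
  refine key.trans (le_of_eq ?_)
  field_simp

theorem sum_mul_add_le {T : Finset (EuclideanSpace ℝ (Fin n))} (hT : T.card = 3)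
    (f : EuclideanSpace ℝ (Fin n) → ℝ) :
    ∑ z ∈ T, f z * f z + (∑ z ∈ T, f z) * ∑ z ∈ T, f z ≤ 4 * ∑ z ∈ T, f z ^ 2 := by
  have h := sq_sum_le_card_mul_sum_sq (s := T) (f := f)
  rw [hT] at h
  simp only [← sq]
  push_cast at h
  linarith

theorem setIntegral_sq_le (h : IsMesh 𝒯 S) {V : EuclideanSpace ℝ (Fin n) → ℝ}
    (hV : IsCourant 𝒯 V) {T : Finset (EuclideanSpace ℝ (Fin n))} (hT : T ∈ 𝒯) :
    ∫ x in triangleHull T, V x ^ 2 ∂μHE[2]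
      ≤ μHE[2].real (triangleHull T) / 3 * ∑ z ∈ T, V z ^ 2 := by
  simp only [sq (V _)]
  rw [h.setIntegral_mul hV hV hT]
  have h1 := sum_mul_add_le (h.card_eq T hT) V
  have h2 := (h.isTriangle hT).area_pos
  calc _ ≤ μHE[2].real (triangleHull T) / 12 * (4 * ∑ z ∈ T, V z ^ 2) := by gcongr
    _ = _ := by simp only [sq]; ring

/-- Stability of the `L₂`-projection in the norm weighted with the inverse of the element size. -/
theorem IsMesh.weighted_stability (h : IsMesh 𝒯 S) {d : EuclideanSpace ℝ (Fin n) → ℝ}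
    {C₅ C₆ : ℝ} (hC₅ : C₅ ≤ Real.pi) (hC₆ : 0 < C₆) (hd : IsNodalWeight 𝒯 d C₅ C₆)
    {v V : EuclideanSpace ℝ (Fin n) → ℝ} (hv : MemLp v 2 (surfaceMeasure 𝒯))
    (hV : IsL2Projection 𝒯 (surfaceMeasure 𝒯) v V) :
    ∑ T ∈ 𝒯, μHE[2].real (triangleHull T) / elementSize T ^ 2 * ∑ z ∈ T, V z ^ 2
      ≤ 48000000 * C₆ ^ 4 *
        ∑ T ∈ 𝒯, (∫ x in triangleHull T, v x ^ 2 ∂μHE[2]) / elementSize T ^ 2 := by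
  -- The function `V` divided by a squared weight function need not be in the Courant space;
  -- dividing only the nodal values gives an admissible test function.
  obtain ⟨W, hW, hWz⟩ := h.exists_isCourant fun z => V z / d z ^ 2
  have hVL := hV.1.memLp h 2
  have hWL := hW.memLp h 2
  have horth : ∑ T ∈ 𝒯, ∫ x in triangleHull T, W x * V x ∂μHE[2]
      = ∑ T ∈ 𝒯, ∫ x in triangleHull T, W x * v x ∂μHE[2] := by
    have h0 := hV.2 W hW
    rw [← h.integral_mul_eq_sum hWL hVL, ← h.integral_mul_eq_sum hWL hv]
    have i1 : Integrable (fun y => W y * v y) (surfaceMeasure 𝒯) := hWL.integrable_mul hv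
    have i2 : Integrable (fun y => W y * V y) (surfaceMeasure 𝒯) := hWL.integrable_mul hVL
    simp only [mul_sub] at h0
    rw [integral_sub i1 i2] at h0
    linarith
  have hsize : ∀ T ∈ 𝒯, 0 < elementSize T := fun T hT => (h.isTriangle hT).elementSize_pos
  have harea : ∀ T ∈ 𝒯, 0 < μHE[2].real (triangleHull T) := fun T hT => (h.isTriangle hT).area_pos
  have hdlo : ∀ T ∈ 𝒯, ∀ z ∈ T, elementSize T ≤ C₆ * d z := fun T hT z hz => by
    have := hd.le_div_size T hT z hz
    rw [le_div_iff₀ (hsize T hT), inv_mul_le_iff₀ hC₆] at this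
    exact this
  have hdhi : ∀ T ∈ 𝒯, ∀ z ∈ T, d z ≤ C₆ * elementSize T := fun T hT z hz => by
    have := hd.div_size_le T hT z hz
    rwa [div_le_iff₀ (hsize T hT)] at this
  have hlow : ∀ T ∈ 𝒯, μHE[2].real (triangleHull T) / 12 * ((1 / 1000) * ∑ z ∈ T, (V z / d z) ^ 2)
      ≤ ∫ x in triangleHull T, W x * V x ∂μHE[2] := fun T hT => by
    rw [h.setIntegral_mul hW hV.1 hT]
    refine mul_le_mul_of_nonneg_left ?_ (by have := harea T hT; positivity)
    refine sum_weighted_mass_coercive (h.card_eq T hT) (hd.pos T hT) (fun z hz z' hz' => ?_)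
      (hWz T hT)
    have := hd.ratio_le T hT z hz z' hz'
    rw [div_le_iff₀ (hd.pos T hT z' hz')] at this
    exact this.trans (mul_le_mul_of_nonneg_right hC₅ (hd.pos T hT z' hz').le)
  have hup : ∀ T ∈ 𝒯, ∫ x in triangleHull T, W x * v x ∂μHE[2]
      ≤ μHE[2].real (triangleHull T) / 12 * ((1 / 2000) * ∑ z ∈ T, (V z / d z) ^ 2)
        + 2000 * C₆ ^ 2 * ((∫ x in triangleHull T, v x ^ 2 ∂μHE[2]) / elementSize T ^ 2) :=
    fun T hT => by
      have hh := hsize T hT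
      set H := elementSize T with hH
      have hle := restrict_triangleHull_le hT
      have hWT := hWL.mono_measure hle
      have hvT := hv.mono_measure hle
      -- The Young parameter is chosen so that the `W` term consumes exactly half of the coercivity
      -- constant `1 / 1000`.
      set κ := H ^ 2 / (8000 * C₆ ^ 2) with hκ
      have hκ0 : 0 < κ := by positivity
      have hyoung : ∀ x, W x * v x ≤ κ * W x ^ 2 + (4 * κ)⁻¹ * v x ^ 2 := fun x => by
        have h1 := mul_nonneg (inv_pos.2 hκ0).le (sq_nonneg (κ * W x - v x / 2))
        have h2 : κ⁻¹ * (κ * W x - v x / 2) ^ 2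
            = κ * W x ^ 2 - W x * v x + (4 * κ)⁻¹ * v x ^ 2 := by field_simp; ring
        linarith
      have i1 : Integrable (fun x => W x * v x) (μHE[2].restrict (triangleHull T)) :=
        hWT.integrable_mul hvT
      have i2 := hWT.integrable_sq.const_mul κ
      have i3 := hvT.integrable_sq.const_mul (4 * κ)⁻¹
      have hW2 : ∫ x in triangleHull T, W x ^ 2 ∂μHE[2]
          ≤ μHE[2].real (triangleHull T) / 3 * (C₆ ^ 2 / H ^ 2 * ∑ z ∈ T, (V z / d z) ^ 2) := by
        refine (setIntegral_sq_le h hW hT).trans (mul_le_mul_of_nonneg_left ?_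
          (by have := harea T hT; positivity))
        rw [Finset.mul_sum]
        refine Finset.sum_le_sum fun z hz => ?_
        have hdz := hd.pos T hT z hz
        rw [hWz T hT z hz]
        have e : (V z / d z ^ 2) ^ 2 = (1 / d z) ^ 2 * (V z / d z) ^ 2 := by field_simp
        rw [e]
        refine mul_le_mul_of_nonneg_right ?_ (sq_nonneg _)
        rw [← div_pow]
        refine pow_le_pow_left₀ (by positivity) ?_ 2
        rw [div_le_div_iff₀ hdz hh, one_mul]
        exact hdlo T hT z hz
      calc ∫ x in triangleHull T, W x * v x ∂μHE[2]
          ≤ ∫ x in triangleHull T, (κ * W x ^ 2 + (4 * κ)⁻¹ * v x ^ 2) ∂μHE[2] :=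
            integral_mono i1 (i2.add i3) hyoung
        _ = κ * ∫ x in triangleHull T, W x ^ 2 ∂μHE[2]
            + (4 * κ)⁻¹ * ∫ x in triangleHull T, v x ^ 2 ∂μHE[2] := by
            rw [integral_add i2 i3, integral_const_mul, integral_const_mul]
        _ ≤ κ * (μHE[2].real (triangleHull T) / 3 * (C₆ ^ 2 / H ^ 2 * ∑ z ∈ T, (V z / d z) ^ 2))
            + (4 * κ)⁻¹ * ∫ x in triangleHull T, v x ^ 2 ∂μHE[2] := by gcongr
        _ = _ := by rw [hκ]; field_simp; ring
  have hmain : ∑ T ∈ 𝒯, μHE[2].real (triangleHull T) / 12 *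
        ((1 / 2000) * ∑ z ∈ T, (V z / d z) ^ 2)
      ≤ ∑ T ∈ 𝒯, 2000 * C₆ ^ 2 *
        ((∫ x in triangleHull T, v x ^ 2 ∂μHE[2]) / elementSize T ^ 2) := by
    have h1 := Finset.sum_le_sum hlow
    have h2 := Finset.sum_le_sum hup
    rw [Finset.sum_add_distrib] at h2
    have h3 : ∑ T ∈ 𝒯, μHE[2].real (triangleHull T) / 12 *
        ((1 / 1000) * ∑ z ∈ T, (V z / d z) ^ 2)
      = 2 * ∑ T ∈ 𝒯, μHE[2].real (triangleHull T) / 12 *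
        ((1 / 2000) * ∑ z ∈ T, (V z / d z) ^ 2) := by
      rw [Finset.mul_sum]
      exact Finset.sum_congr rfl fun T _ => by ring
    linarith
  -- The return from `V / d` to `V` costs `C₆²` through `d z ≤ C₆ h(T)`; the number `24000` undoes
  -- the factors `12` and `2000`.
  have hfin : ∀ T ∈ 𝒯, μHE[2].real (triangleHull T) / elementSize T ^ 2 * ∑ z ∈ T, V z ^ 2
      ≤ 24000 * C₆ ^ 2 * (μHE[2].real (triangleHull T) / 12 *
        ((1 / 2000) * ∑ z ∈ T, (V z / d z) ^ 2)) := fun T hT => by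
    have hh := hsize T hT
    have hA := harea T hT
    have : ∑ z ∈ T, V z ^ 2 ≤ C₆ ^ 2 * elementSize T ^ 2 * ∑ z ∈ T, (V z / d z) ^ 2 := by
      rw [Finset.mul_sum]
      refine Finset.sum_le_sum fun z hz => ?_
      have hdz := hd.pos T hT z hz
      have e : V z ^ 2 = d z ^ 2 * (V z / d z) ^ 2 := by field_simp
      rw [e, ← mul_pow C₆]
      refine mul_le_mul_of_nonneg_right ?_ (sq_nonneg _)
      exact pow_le_pow_left₀ hdz.le (hdhi T hT z hz) 2
    calc _ ≤ μHE[2].real (triangleHull T) / elementSize T ^ 2 *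
          (C₆ ^ 2 * elementSize T ^ 2 * ∑ z ∈ T, (V z / d z) ^ 2) := by gcongr
      _ = _ := by field_simp; ring
  calc _ ≤ ∑ T ∈ 𝒯, 24000 * C₆ ^ 2 * (μHE[2].real (triangleHull T) / 12 *
        ((1 / 2000) * ∑ z ∈ T, (V z / d z) ^ 2)) := Finset.sum_le_sum hfin
    _ = 24000 * C₆ ^ 2 * ∑ T ∈ 𝒯, (μHE[2].real (triangleHull T) / 12 *
        ((1 / 2000) * ∑ z ∈ T, (V z / d z) ^ 2)) := by rw [Finset.mul_sum]
    _ ≤ 24000 * C₆ ^ 2 * ∑ T ∈ 𝒯, 2000 * C₆ ^ 2 *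
        ((∫ x in triangleHull T, v x ^ 2 ∂μHE[2]) / elementSize T ^ 2) := by gcongr
    _ = _ := by rw [← Finset.mul_sum]; ring

end Stability

/-! ### Quasi-interpolation by local constants -/

section Core

variable {n : ℕ} {𝒯 : Finset (Finset (EuclideanSpace ℝ (Fin n)))}
  {S : Set (EuclideanSpace ℝ (Fin n))}

open Classical in
/-- The elements with node `z`. -/
noncomputable def nodePatch (𝒯 : Finset (Finset (EuclideanSpace ℝ (Fin n))))
    (z : EuclideanSpace ℝ (Fin n)) : Finset (Finset (EuclideanSpace ℝ (Fin n))) :=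
  𝒯.filter fun T => z ∈ T

theorem mem_nodePatch {z : EuclideanSpace ℝ (Fin n)} {T : Finset (EuclideanSpace ℝ (Fin n))} :
    T ∈ nodePatch 𝒯 z ↔ T ∈ 𝒯 ∧ z ∈ T := by
  simp [nodePatch]

theorem NodeValenceLE.card_nodePatch_le {M : ℕ} (hM : NodeValenceLE 𝒯 M)
    (z : EuclideanSpace ℝ (Fin n)) : (nodePatch 𝒯 z).card ≤ M := by
  have h := hM z
  have e : {T | T ∈ 𝒯 ∧ z ∈ T} = (nodePatch 𝒯 z : Set (Finset (EuclideanSpace ℝ (Fin n)))) := by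
    ext T
    exact mem_nodePatch.symm
  rwa [e, ncard_coe_finset] at h

/-- Double counting: `a T'` occurs once for each pair of a node of `T'` and an element at that node,
and there are at most `3 M` such pairs. -/
theorem sum_sum_nodePatch_le (h : IsMesh 𝒯 S) {M : ℕ} (hM : NodeValenceLE 𝒯 M)
    {a : Finset (EuclideanSpace ℝ (Fin n)) → ℝ} (ha : ∀ T, 0 ≤ a T) :
    ∑ T ∈ 𝒯, ∑ z ∈ T, ∑ T' ∈ nodePatch 𝒯 z, a T' ≤ 3 * M * ∑ T ∈ 𝒯, a T := by
  classical
  have e1 : ∀ T ∈ 𝒯, ∑ z ∈ T, ∑ T' ∈ nodePatch 𝒯 z, a T'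
      = ∑ T' ∈ 𝒯, ((T.filter fun z => z ∈ T').card : ℝ) * a T' := fun T _ => by
    simp only [nodePatch, Finset.sum_filter]
    rw [Finset.sum_comm]
    refine Finset.sum_congr rfl fun T' _ => ?_
    rw [← Finset.sum_filter, Finset.sum_const, nsmul_eq_mul]
  rw [Finset.sum_congr rfl e1, Finset.sum_comm, Finset.mul_sum]
  refine Finset.sum_le_sum fun T' hT' => ?_
  rw [← Finset.sum_mul]
  refine mul_le_mul_of_nonneg_right ?_ (ha T')
  have e2 : ∑ T ∈ 𝒯, (T.filter fun z => z ∈ T').card = ∑ z ∈ T', (nodePatch 𝒯 z).card := by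
    have e : ∀ T ∈ 𝒯, (T.filter fun z => z ∈ T').card = (T'.filter fun z => z ∈ T).card :=
      fun T _ => by
        congr 1
        ext z
        simp only [Finset.mem_filter, and_comm]
    rw [Finset.sum_congr rfl e]
    simp only [nodePatch, Finset.card_filter]
    exact Finset.sum_comm
  have e3 : ∑ z ∈ T', (nodePatch 𝒯 z).card ≤ 3 * M := by
    rw [← h.card_eq T' hT', ← smul_eq_mul]
    exact Finset.sum_le_card_nsmul _ _ _ fun z _ => hM.card_nodePatch_le z
  rw [← e2] at e3
  exact_mod_cast e3

/-- In the patch of a node the local means differ by at most the energy on the patch. -/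
theorem HasLocalEstimates.sub_sq_le {u : EuclideanSpace ℝ (Fin n) → ℝ}
    {G : EuclideanSpace ℝ (Fin n) → EuclideanSpace ℝ (Fin n)} {K : ℝ} (hK : 0 ≤ K)
    {c : Finset (EuclideanSpace ℝ (Fin n)) → ℝ} (hloc : HasLocalEstimates 𝒯 u G K c)
    (hE : HasEdgeConnectedPatches 𝒯) {M : ℕ} (hM : NodeValenceLE 𝒯 M)
    {z : EuclideanSpace ℝ (Fin n)} {T T' : Finset (EuclideanSpace ℝ (Fin n))} (hT : T ∈ 𝒯)
    (hT' : T' ∈ 𝒯) (hz : z ∈ T) (hz' : z ∈ T') :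
    (c T - c T') ^ 2 ≤ M ^ 2 * K *
      ∑ A ∈ nodePatch 𝒯 z, ∫ x in triangleHull A, ‖G x‖ ^ 2 ∂μHE[2] := by
  classical
  set a : Finset (EuclideanSpace ℝ (Fin n)) → ℝ := fun A =>
    ∫ x in triangleHull A, ‖G x‖ ^ 2 ∂μHE[2] with ha
  have ha0 : ∀ A, 0 ≤ a A := fun A => integral_nonneg fun x => sq_nonneg _
  have hs0 : 0 ≤ ∑ A ∈ nodePatch 𝒯 z, a A := Finset.sum_nonneg fun A _ => ha0 A
  -- Every single jump is bounded by the energy of the whole patch, and a chain in the patch has at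
  -- most `M` links.
  set δ := Real.sqrt (K * ∑ A ∈ nodePatch 𝒯 z, a A) with hδ
  have hδ0 : 0 ≤ δ := Real.sqrt_nonneg _
  have key := abs_sub_le_of_reflTransGen (s := nodePatch 𝒯 z)
    (r := fun A B => ∃ y, y ≠ z ∧ y ∈ A ∧ y ∈ B) (f := c) hδ0 ?_ (mem_nodePatch.2 ⟨hT, hz⟩)
    (b := T') ?_
  · have h1 : |c T - c T'| ≤ M * δ :=
      key.trans (mul_le_mul_of_nonneg_right (by exact_mod_cast hM.card_nodePatch_le z) hδ0)
    calc (c T - c T') ^ 2 = |c T - c T'| ^ 2 := (sq_abs _).symm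
      _ ≤ (M * δ) ^ 2 := pow_le_pow_left₀ (abs_nonneg _) h1 2
      _ = _ := by rw [mul_pow, hδ, Real.sq_sqrt (mul_nonneg hK hs0)]; ring
  · rintro A hA B hB hAB ⟨y, hyz, hyA, hyB⟩
    rw [mem_nodePatch] at hA hB
    refine Real.abs_le_sqrt ?_
    refine (hloc.jump A hA.1 B hB.1 hAB z y hyz hA.2 hyA hB.2 hyB).trans
      (mul_le_mul_of_nonneg_left ?_ hK)
    have hsub : ({A, B} : Finset _) ⊆ nodePatch 𝒯 z := by
      intro C hC
      simp only [Finset.mem_insert, Finset.mem_singleton] at hC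
      rcases hC with rfl | rfl
      · exact mem_nodePatch.2 hA
      · exact mem_nodePatch.2 hB
    calc a A + a B = ∑ C ∈ {A, B}, a C := (Finset.sum_pair hAB).symm
      _ ≤ _ := Finset.sum_le_sum_of_subset_of_nonneg hsub fun C _ _ => ha0 C
  · refine Relation.ReflTransGen.mono ?_ _ _ (hE z T hT T' hT' hz hz')
    rintro A B ⟨hB, hzB, hy⟩
    exact ⟨mem_nodePatch.2 ⟨hB, hzB⟩, hy⟩

/-- The `L₂`-projection of a function with local estimates is close to the local means. -/
theorem IsMesh.projection_estimate (h : IsMesh 𝒯 S) (hE : HasEdgeConnectedPatches 𝒯) {M : ℕ}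
    (hM : NodeValenceLE 𝒯 M) {d : EuclideanSpace ℝ (Fin n) → ℝ}
    {C₅ C₆ : ℝ} (hC₅ : C₅ ≤ Real.pi) (hC₆ : 0 < C₆) (hd : IsNodalWeight 𝒯 d C₅ C₆)
    {u : EuclideanSpace ℝ (Fin n) → ℝ} {G : EuclideanSpace ℝ (Fin n) → EuclideanSpace ℝ (Fin n)}
    (hu : MemLp u 2 (surfaceMeasure 𝒯)) {K : ℝ} (hK : 0 ≤ K)
    {c : Finset (EuclideanSpace ℝ (Fin n)) → ℝ} (hloc : HasLocalEstimates 𝒯 u G K c)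
    {V : EuclideanSpace ℝ (Fin n) → ℝ} (hV : IsL2Projection 𝒯 (surfaceMeasure 𝒯) u V) :
    ∑ T ∈ 𝒯, μHE[2].real (triangleHull T) / elementSize T ^ 2 * ∑ z ∈ T, (V z - c T) ^ 2
      ≤ (2 * (48000000 * C₆ ^ 4) * (2 * K + M ^ 3 * K) + 3 * (M ^ 3 * K)) *
        ∑ T ∈ 𝒯, ∫ x in triangleHull T, ‖G x‖ ^ 2 ∂μHE[2] := by
  classical
  set a : Finset (EuclideanSpace ℝ (Fin n)) → ℝ := fun A =>
    ∫ x in triangleHull A, ‖G x‖ ^ 2 ∂μHE[2] with ha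
  have ha0 : ∀ A, 0 ≤ a A := fun A => integral_nonneg fun x => sq_nonneg _
  set Q : ℝ := M ^ 2 * K with hQ
  have hQ0 : 0 ≤ Q := by positivity
  have hsize : ∀ T ∈ 𝒯, 0 < elementSize T := fun T hT => (h.isTriangle hT).elementSize_pos
  -- Each node selects one element whose constant becomes the nodal value of `I`. The default `∅`
  -- concerns points that are not nodes.
  have hchoice : ∀ z, ∃ T₀, ∀ T ∈ 𝒯, z ∈ T → T₀ ∈ 𝒯 ∧ z ∈ T₀ := fun z => by
    by_cases hz : ∃ T ∈ 𝒯, z ∈ T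
    · obtain ⟨T, hT, hzT⟩ := hz
      exact ⟨T, fun _ _ _ => ⟨hT, hzT⟩⟩
    · exact ⟨∅, fun T hT hzT => absurd ⟨T, hT, hzT⟩ hz⟩
  choose τ hτ using hchoice
  obtain ⟨I, hI, hIz⟩ := h.exists_isCourant fun z => c (τ z)
  have hIc : ∀ T ∈ 𝒯, ∀ z ∈ T, (I z - c T) ^ 2 ≤ Q * ∑ A ∈ nodePatch 𝒯 z, a A :=
    fun T hT z hz => by
      rw [hIz T hT z hz]
      obtain ⟨h1, h2⟩ := hτ z T hT hz
      exact hloc.sub_sq_le hK hE hM h1 hT h2 hz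
  have hIL := hI.memLp h 2
  have hvL : MemLp (fun x => u x - I x) 2 (surfaceMeasure 𝒯) := hu.sub hIL
  -- The projection fixes `I`, so weighted stability applies to `u - I`, which is small on each
  -- element.
  have hVI : IsL2Projection 𝒯 (surfaceMeasure 𝒯) (fun x => u x - I x) (fun x => V x - I x) := by
    refine ⟨hV.1.sub hI, fun W hW => ?_⟩
    simpa using hV.2 W hW
  have hstab := h.weighted_stability hC₅ hC₆ hd hvL hVI
  have hv : ∀ T ∈ 𝒯, (∫ x in triangleHull T, (u x - I x) ^ 2 ∂μHE[2]) / elementSize T ^ 2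
      ≤ 2 * K * a T + Q / 3 * ∑ z ∈ T, ∑ A ∈ nodePatch 𝒯 z, a A := fun T hT => by
    have hh := hsize T hT
    have hle := restrict_triangleHull_le hT
    have hfin := (h.isTriangle hT).isFiniteMeasure
    have hcI := (isCourant_const (𝒯 := 𝒯) (c T))
    have i0 : MemLp (fun x => u x - c T) 2 (μHE[2].restrict (triangleHull T)) :=
      (hu.mono_measure hle).sub (memLp_const _)
    have i0' : MemLp (fun x => I x - c T) 2 (μHE[2].restrict (triangleHull T)) :=
      (hIL.mono_measure hle).sub (memLp_const _)
    have i1 := i0.integrable_sq.const_mul 2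
    have i2 := i0'.integrable_sq.const_mul 2
    have i3 : Integrable (fun x => (u x - I x) ^ 2) (μHE[2].restrict (triangleHull T)) :=
      (hvL.mono_measure hle).integrable_sq
    have e1 : ∫ x in triangleHull T, (u x - I x) ^ 2 ∂μHE[2]
        ≤ 2 * ∫ x in triangleHull T, (u x - c T) ^ 2 ∂μHE[2]
          + 2 * ∫ x in triangleHull T, (I x - c T) ^ 2 ∂μHE[2] := by
      rw [← integral_const_mul, ← integral_const_mul, ← integral_add i1 i2]
      refine integral_mono i3 (i1.add i2) fun x => ?_
      show (u x - I x) ^ 2 ≤ 2 * (u x - c T) ^ 2 + 2 * (I x - c T) ^ 2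
      nlinarith [sq_nonneg ((u x - c T) + (I x - c T))]
    have e2 : ∫ x in triangleHull T, (I x - c T) ^ 2 ∂μHE[2]
        ≤ elementSize T ^ 2 / 6 * (Q * ∑ z ∈ T, ∑ A ∈ nodePatch 𝒯 z, a A) := by
      refine (setIntegral_sq_le h (hI.sub hcI) hT).trans ?_
      have e := Finset.sum_le_sum (hIc T hT)
      rw [← Finset.mul_sum] at e
      refine mul_le_mul ?_ e
        (Finset.sum_nonneg fun z _ => sq_nonneg _) (by positivity)
      linarith [(h.isTriangle hT).area_le]
    rw [div_le_iff₀ (by positivity)]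
    have e3 := hloc.poincare T hT
    calc _ ≤ _ := e1
      _ ≤ 2 * (K * elementSize T ^ 2 * a T)
          + 2 * (elementSize T ^ 2 / 6 * (Q * ∑ z ∈ T, ∑ A ∈ nodePatch 𝒯 z, a A)) := by gcongr
      _ = _ := by ring
  have hpatch := sum_sum_nodePatch_le h hM ha0
  have hvsum : ∑ T ∈ 𝒯, (∫ x in triangleHull T, (u x - I x) ^ 2 ∂μHE[2]) / elementSize T ^ 2
      ≤ (2 * K + Q * M) * ∑ T ∈ 𝒯, a T := by
    calc _ ≤ ∑ T ∈ 𝒯, (2 * K * a T + Q / 3 * ∑ z ∈ T, ∑ A ∈ nodePatch 𝒯 z, a A) :=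
          Finset.sum_le_sum hv
      _ = 2 * K * ∑ T ∈ 𝒯, a T + Q / 3 * ∑ T ∈ 𝒯, ∑ z ∈ T, ∑ A ∈ nodePatch 𝒯 z, a A := by
          rw [Finset.sum_add_distrib, Finset.mul_sum, Finset.mul_sum]
      _ ≤ 2 * K * ∑ T ∈ 𝒯, a T + Q / 3 * (3 * M * ∑ T ∈ 𝒯, a T) := by gcongr
      _ = _ := by ring
  have hT2 : ∀ T ∈ 𝒯, μHE[2].real (triangleHull T) / elementSize T ^ 2 *
      ∑ z ∈ T, (V z - c T) ^ 2
      ≤ 2 * (μHE[2].real (triangleHull T) / elementSize T ^ 2 * ∑ z ∈ T, (V z - I z) ^ 2)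
        + Q * ∑ z ∈ T, ∑ A ∈ nodePatch 𝒯 z, a A := fun T hT => by
    have hh := hsize T hT
    have e1 : ∑ z ∈ T, (V z - c T) ^ 2
        ≤ 2 * ∑ z ∈ T, (V z - I z) ^ 2 + 2 * ∑ z ∈ T, (I z - c T) ^ 2 := by
      rw [Finset.mul_sum, Finset.mul_sum, ← Finset.sum_add_distrib]
      refine Finset.sum_le_sum fun z _ => ?_
      nlinarith [sq_nonneg ((V z - I z) - (I z - c T))]
    have e2 : ∑ z ∈ T, (I z - c T) ^ 2 ≤ Q * ∑ z ∈ T, ∑ A ∈ nodePatch 𝒯 z, a A := by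
      rw [Finset.mul_sum]
      exact Finset.sum_le_sum (hIc T hT)
    have e3 : μHE[2].real (triangleHull T) / elementSize T ^ 2 ≤ 1 / 2 := by
      rw [div_le_iff₀ (by positivity)]
      linarith [(h.isTriangle hT).area_le]
    have e4 : 0 ≤ μHE[2].real (triangleHull T) / elementSize T ^ 2 := by positivity
    have e5 : 0 ≤ ∑ z ∈ T, (I z - c T) ^ 2 := Finset.sum_nonneg fun z _ => sq_nonneg _
    calc _ ≤ μHE[2].real (triangleHull T) / elementSize T ^ 2 *
          (2 * ∑ z ∈ T, (V z - I z) ^ 2 + 2 * ∑ z ∈ T, (I z - c T) ^ 2) := by gcongr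
      _ = 2 * (μHE[2].real (triangleHull T) / elementSize T ^ 2 * ∑ z ∈ T, (V z - I z) ^ 2)
          + 2 * (μHE[2].real (triangleHull T) / elementSize T ^ 2) * ∑ z ∈ T, (I z - c T) ^ 2 := by
          ring
      _ ≤ 2 * (μHE[2].real (triangleHull T) / elementSize T ^ 2 * ∑ z ∈ T, (V z - I z) ^ 2)
          + 1 * ∑ z ∈ T, (I z - c T) ^ 2 := by gcongr; linarith
      _ ≤ _ := by linarith
  calc _ ≤ ∑ T ∈ 𝒯, (2 * (μHE[2].real (triangleHull T) / elementSize T ^ 2 *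
        ∑ z ∈ T, (V z - I z) ^ 2) + Q * ∑ z ∈ T, ∑ A ∈ nodePatch 𝒯 z, a A) :=
        Finset.sum_le_sum hT2
    _ = 2 * ∑ T ∈ 𝒯, (μHE[2].real (triangleHull T) / elementSize T ^ 2 *
        ∑ z ∈ T, (V z - I z) ^ 2) + Q * ∑ T ∈ 𝒯, ∑ z ∈ T, ∑ A ∈ nodePatch 𝒯 z, a A := by
        rw [Finset.sum_add_distrib, Finset.mul_sum, Finset.mul_sum]
    _ ≤ 2 * (48000000 * C₆ ^ 4 * ((2 * K + Q * M) * ∑ T ∈ 𝒯, a T))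
        + Q * (3 * M * ∑ T ∈ 𝒯, a T) := by
        gcongr
        exact hstab.trans (by gcongr)
    _ = _ := by rw [hQ]; ring

end Core

/-! ### The piecewise gradient and its norm -/

theorem eLpNorm_two_eq {α F : Type*} [MeasurableSpace α] [NormedAddCommGroup F] {μ : Measure α}
    {f : α → F} (hf : MemLp f 2 μ) :
    eLpNorm f 2 μ = ENNReal.ofReal (Real.sqrt (∫ x, ‖f x‖ ^ 2 ∂μ)) := by
  rw [hf.eLpNorm_eq_integral_rpow_norm two_ne_zero ENNReal.ofNat_ne_top, Real.sqrt_eq_rpow]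
  simp

theorem eLpNorm_two_le_of_integral_le {α F F' : Type*} [MeasurableSpace α] [NormedAddCommGroup F]
    [NormedAddCommGroup F'] {μ : Measure α} {f : α → F} {g : α → F'} (hf : MemLp f 2 μ)
    (hg : MemLp g 2 μ) {C : ℝ} (hC : 0 ≤ C)
    (h : ∫ x, ‖f x‖ ^ 2 ∂μ ≤ C * ∫ x, ‖g x‖ ^ 2 ∂μ) :
    eLpNorm f 2 μ ≤ ENNReal.ofReal (Real.sqrt C) * eLpNorm g 2 μ := by
  rw [eLpNorm_two_eq hf, eLpNorm_two_eq hg, ← ENNReal.ofReal_mul (Real.sqrt_nonneg _),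
    ← Real.sqrt_mul hC]
  exact ENNReal.ofReal_le_ofReal (Real.sqrt_le_sqrt h)

section PiecewiseGradient

variable {n : ℕ} {𝒯 : Finset (Finset (EuclideanSpace ℝ (Fin n)))}
  {S : Set (EuclideanSpace ℝ (Fin n))}

/-- `H` is the piecewise constant tangential gradient of the Courant function `V`. -/
structure IsPiecewiseGradient (𝒯 : Finset (Finset (EuclideanSpace ℝ (Fin n))))
    (V : EuclideanSpace ℝ (Fin n) → ℝ) (H : EuclideanSpace ℝ (Fin n) → EuclideanSpace ℝ (Fin n)) :
    Prop where
  memLp : MemLp H 2 (surfaceMeasure 𝒯)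
  exists_eq : ∀ T ∈ 𝒯, ∃ g ∈ vectorSpan ℝ (T : Set (EuclideanSpace ℝ (Fin n))),
    (∀ x ∈ triangleHull T, ∀ y ∈ triangleHull T, V y - V x = inner ℝ g (y - x)) ∧
      ∀ᵐ x ∂(μHE[2].restrict (triangleHull T)), H x = g

/-- The estimate is the inverse inequality summed over the elements. It holds for every family `c`
at once because a gradient does not see constants. -/
theorem IsMesh.exists_isPiecewiseGradient (h : IsMesh 𝒯 S) {γ : ℝ}
    (hγ : IsShapeRegular μHE[2] 𝒯 γ) {V : EuclideanSpace ℝ (Fin n) → ℝ} (hV : IsCourant 𝒯 V) :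
    ∃ H, IsPiecewiseGradient 𝒯 V H ∧ ∀ c : Finset (EuclideanSpace ℝ (Fin n)) → ℝ,
      ∫ x, ‖H x‖ ^ 2 ∂(surfaceMeasure 𝒯) ≤ γ ^ 2 * (6 + γ ^ 2) / 4 *
        ∑ T ∈ 𝒯, μHE[2].real (triangleHull T) / elementSize T ^ 2 * ∑ z ∈ T, (V z - c T) ^ 2 := by
  classical
  have hex : ∀ T : Finset (EuclideanSpace ℝ (Fin n)), ∃ g : EuclideanSpace ℝ (Fin n), T ∈ 𝒯 →
      g ∈ vectorSpan ℝ (T : Set (EuclideanSpace ℝ (Fin n))) ∧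
      (∀ x ∈ triangleHull T, ∀ y ∈ triangleHull T, V y - V x = inner ℝ g (y - x)) ∧
      ∀ c : ℝ, elementSize T ^ 2 * ‖g‖ ^ 2
        ≤ γ ^ 2 * (6 + γ ^ 2) / 4 * ∑ z ∈ T, (V z - c) ^ 2 := fun T => by
    by_cases hT : T ∈ 𝒯
    · obtain ⟨A, hA⟩ := hV.2 T hT
      obtain ⟨g, h1, h2, h3⟩ := (h.isTriangle hT).exists_gradient (hγ T hT) hA
      exact ⟨g, fun _ => ⟨h1, h2, h3⟩⟩
    · exact ⟨0, fun h => absurd h hT⟩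
  choose g hg using hex
  have hfin := h.isFiniteMeasure
  -- On the overlaps several element gradients are added up, but the overlaps are null.
  let H : EuclideanSpace ℝ (Fin n) → EuclideanSpace ℝ (Fin n) := fun x =>
    ∑ T ∈ 𝒯, (triangleHull T).indicator (fun _ => g T) x
  have hHL : MemLp H 2 (surfaceMeasure 𝒯) :=
    memLp_finsetSum 𝒯 fun T _ => (memLp_const (g T)).indicator (measurableSet_triangleHull T)
  have hHae : ∀ T ∈ 𝒯, ∀ᵐ x ∂(μHE[2].restrict (triangleHull T)), H x = g T := fun T hT => by
    have h1 : ∀ T' ∈ 𝒯, ∀ᵐ x ∂(μHE[2].restrict (triangleHull T)),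
        T' ≠ T → x ∉ triangleHull T' := fun T' hT' => by
      by_cases hne : T' = T
      · exact Eventually.of_forall fun x h => absurd hne h
      · rw [ae_restrict_iff' (measurableSet_triangleHull T)]
        have h0 : ∀ᵐ x ∂(μHE[2] : Measure (EuclideanSpace ℝ (Fin n))),
            x ∉ triangleHull T ∩ triangleHull T' :=
          measure_eq_zero_iff_ae_notMem.1 (h.measure_inter hT hT' (Ne.symm hne))
        filter_upwards [h0] with x hx hxT _ hxT'
        exact hx ⟨hxT, hxT'⟩
    have h2 := (Finset.eventually_all 𝒯).2 h1
    filter_upwards [h2, ae_restrict_mem (measurableSet_triangleHull T)] with x hx hxT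
    show ∑ T ∈ 𝒯, (triangleHull T).indicator (fun _ => g T) x = g T
    rw [Finset.sum_eq_single T]
    · exact indicator_of_mem hxT _
    · exact fun T' hT' hne => indicator_of_notMem (hx T' hT' hne) _
    · exact fun hn => absurd hT hn
  refine ⟨H, ⟨hHL, fun T hT => ⟨g T, (hg T hT).1, (hg T hT).2.1, hHae T hT⟩⟩, fun c => ?_⟩
  rw [h.integral_eq_sum hHL.integrable_norm_pow', Finset.mul_sum]
  refine Finset.sum_le_sum fun T hT => ?_
  have e1 : ∫ x in triangleHull T, ‖H x‖ ^ 2 ∂μHE[2]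
      = μHE[2].real (triangleHull T) * ‖g T‖ ^ 2 := by
    have : ∀ᵐ x ∂(μHE[2].restrict (triangleHull T)), ‖H x‖ ^ 2 = ‖g T‖ ^ 2 := by
      filter_upwards [hHae T hT] with x hx
      rw [hx]
    rw [integral_congr_ae this]
    simp
  have h0 := (h.isTriangle hT).elementSize_pos
  have ha := (h.isTriangle hT).area_pos
  rw [e1]
  calc μHE[2].real (triangleHull T) * ‖g T‖ ^ 2
      = μHE[2].real (triangleHull T) / elementSize T ^ 2 * (elementSize T ^ 2 * ‖g T‖ ^ 2) := by
        field_simp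
    _ ≤ μHE[2].real (triangleHull T) / elementSize T ^ 2 *
        (γ ^ 2 * (6 + γ ^ 2) / 4 * ∑ z ∈ T, (V z - c T) ^ 2) := by
        exact mul_le_mul_of_nonneg_left ((hg T hT).2.2 (c T)) (by positivity)
    _ = _ := by ring

/-- The stability constant for meshes with at most `M` elements at a node whose local estimates
hold with constant `K`. -/
noncomputable def stabilityConst (γ C₆ K : ℝ) (M : ℕ) : ℝ :=
  Real.sqrt (γ ^ 2 * (6 + γ ^ 2) / 4 *
    (2 * (48000000 * C₆ ^ 4) * (2 * K + M ^ 3 * K) + 3 * (M ^ 3 * K))) + 1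

theorem stabilityConst_pos (γ C₆ K : ℝ) (M : ℕ) : 0 < stabilityConst γ C₆ K M := by
  have := Real.sqrt_nonneg (γ ^ 2 * (6 + γ ^ 2) / 4 *
    (2 * (48000000 * C₆ ^ 4) * (2 * K + M ^ 3 * K) + 3 * (M ^ 3 * K)))
  rw [stabilityConst]
  linarith

/-- The piecewise gradient of the `L₂`-projection of a function with local estimates. -/
theorem IsMesh.exists_gradient_projection (h : IsMesh 𝒯 S) (hE : HasEdgeConnectedPatches 𝒯)
    {M : ℕ} (hM : NodeValenceLE 𝒯 M) {d : EuclideanSpace ℝ (Fin n) → ℝ} {γ C₅ C₆ : ℝ}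
    (hγ : IsShapeRegular μHE[2] 𝒯 γ) (hC₅ : C₅ ≤ Real.pi) (hC₆ : 0 < C₆)
    (hd : IsNodalWeight 𝒯 d C₅ C₆) {u : EuclideanSpace ℝ (Fin n) → ℝ}
    {G : EuclideanSpace ℝ (Fin n) → EuclideanSpace ℝ (Fin n)}
    (hu : MemLp u 2 (surfaceMeasure 𝒯)) (hG : MemLp G 2 (surfaceMeasure 𝒯)) {K : ℝ} (hK : 0 ≤ K)
    {c : Finset (EuclideanSpace ℝ (Fin n)) → ℝ} (hloc : HasLocalEstimates 𝒯 u G K c)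
    {V : EuclideanSpace ℝ (Fin n) → ℝ} (hV : IsL2Projection 𝒯 (surfaceMeasure 𝒯) u V) :
    ∃ H, IsPiecewiseGradient 𝒯 V H ∧ eLpNorm H 2 (surfaceMeasure 𝒯)
      ≤ ENNReal.ofReal (stabilityConst γ C₆ K M) * eLpNorm G 2 (surfaceMeasure 𝒯) := by
  have hfin := h.isFiniteMeasure
  obtain ⟨H, hH, hbound⟩ := h.exists_isPiecewiseGradient hγ hV.1
  refine ⟨H, hH, ?_⟩
  have key := h.projection_estimate hE hM hC₅ hC₆ hd hu hK hloc hV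
  rw [← h.integral_eq_sum hG.integrable_norm_pow'] at key
  refine (eLpNorm_two_le_of_integral_le (C := γ ^ 2 * (6 + γ ^ 2) / 4 *
    (2 * (48000000 * C₆ ^ 4) * (2 * K + M ^ 3 * K) + 3 * (M ^ 3 * K))) hH.memLp hG
    (by positivity) ?_).trans ?_
  · refine (hbound c).trans ?_
    rw [mul_assoc]
    exact mul_le_mul_of_nonneg_left key (by positivity)
  · gcongr
    rw [stabilityConst]
    linarith

end PiecewiseGradient

/-! ### Discs at the midpoint of an edge -/

theorem volume_real_ball_plane (x : Plane) {r : ℝ} (hr : 0 ≤ r) :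
    volume.real (Metric.ball x r) = Real.pi * r ^ 2 := by
  rw [Measure.real, EuclideanSpace.volume_ball_fin_two, ENNReal.toReal_mul, ENNReal.toReal_pow,
    ENNReal.toReal_ofReal hr]
  simp [mul_comm, Real.pi_pos.le]

/-- A disc above the midpoint of the edge from `0` to `(ℓ, 0)`. -/
def edgeDisc (ℓ ρ : ℝ) : Set Plane := Metric.ball !₂[ℓ / 2, ρ / 2] (ρ / 2)

theorem dist_sq_plane (x : Plane) (s t : ℝ) :
    dist x !₂[s, t] ^ 2 = (x 0 - s) ^ 2 + (x 1 - t) ^ 2 := by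
  rw [EuclideanSpace.dist_eq, Real.sq_sqrt (Finset.sum_nonneg fun i _ => sq_nonneg _)]
  simp [Fin.sum_univ_two, Real.dist_eq, sq_abs]

theorem pos_of_mem_edgeDisc {ℓ ρ : ℝ} {x : Plane} (hx : x ∈ edgeDisc ℓ ρ) : 0 < x 1 := by
  have h1 : dist x !₂[ℓ / 2, ρ / 2] < ρ / 2 := hx
  have h2 : dist x !₂[ℓ / 2, ρ / 2] ^ 2 < (ρ / 2) ^ 2 := by gcongr
  rw [dist_sq_plane] at h2
  have h0 : 0 < ρ := by linarith [dist_nonneg.trans_lt h1]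
  nlinarith [sq_nonneg (x 0 - ℓ / 2)]

theorem edgeDisc_subset_ball (ℓ ρ : ℝ) : edgeDisc ℓ ρ ⊆ Metric.ball !₂[ℓ / 2, 0] ρ := by
  intro x hx
  have h1 : dist x !₂[ℓ / 2, ρ / 2] < ρ / 2 := hx
  have h0 : 0 < ρ := by linarith [dist_nonneg.trans_lt h1]
  have h2 : dist (!₂[ℓ / 2, ρ / 2] : Plane) !₂[ℓ / 2, 0] ≤ ρ / 2 := by
    refine le_of_sq_le_sq ?_ (by positivity)
    rw [dist_sq_plane]
    simp
  rw [Metric.mem_ball]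
  linarith [dist_triangle x !₂[ℓ / 2, ρ / 2] !₂[ℓ / 2, 0]]

namespace TriangleFrame

variable {n : ℕ} {a b p e ν : EuclideanSpace ℝ (Fin n)} {ℓ k σ : ℝ}
  {T : Finset (EuclideanSpace ℝ (Fin n))}

theorem triangleHull_eq (hT : (T : Set (EuclideanSpace ℝ (Fin n))) = {a, b, p}) :
    triangleHull T = convexHull ℝ {a, b, p} := by
  rw [triangleHull, hT]

theorem subset_range (h : TriangleFrame a b p e ν ℓ k σ)
    (hT : (T : Set (EuclideanSpace ℝ (Fin n))) = {a, b, p}) :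
    triangleHull T ⊆ range (chart a e ν) := by
  rw [triangleHull_eq hT]
  exact h.range_convexHull

theorem measurePreserving_triangleHull (h : TriangleFrame a b p e ν ℓ k σ)
    (hT : (T : Set (EuclideanSpace ℝ (Fin n))) = {a, b, p}) :
    MeasurePreserving (chart a e ν) (volume.restrict (chart a e ν ⁻¹' triangleHull T))
      (μHE[2].restrict (triangleHull T)) :=
  h.measurePreserving (h.subset_range hT)

theorem setIntegral_comp_le (h : TriangleFrame a b p e ν ℓ k σ)
    (hT : (T : Set (EuclideanSpace ℝ (Fin n))) = {a, b, p}) {f : EuclideanSpace ℝ (Fin n) → ℝ}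
    (hf : IntegrableOn f (triangleHull T) μHE[2]) (hf0 : ∀ x, 0 ≤ f x) {D : Set Plane}
    (hD : D ⊆ chart a e ν ⁻¹' triangleHull T) :
    IntegrableOn (fun x => f (chart a e ν x)) D ∧
    ∫ x in D, f (chart a e ν x) ≤ ∫ x in triangleHull T, f x ∂μHE[2] := by
  have hmp := h.measurePreserving_triangleHull hT
  have hi : IntegrableOn (fun x => f (chart a e ν x)) (chart a e ν ⁻¹' triangleHull T) :=
    (hmp.integrable_comp_emb h.measurableEmbedding).2 hf
  refine ⟨hi.mono_set hD, ?_⟩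
  rw [← hmp.integral_comp h.measurableEmbedding f]
  exact setIntegral_mono_set hi (Eventually.of_forall fun x => hf0 _) hD.eventuallyLE

theorem chart_mem_triangleHull (h : TriangleFrame a b p e ν ℓ k σ)
    (hT : (T : Set (EuclideanSpace ℝ (Fin n))) = {a, b, p}) {γ ρ : ℝ} (hγ : 0 < γ)
    (hsh : elementSize T ^ 2 ≤ γ * μHE[2].real (triangleHull T)) (hρ : ρ * (2 + γ) ≤ ℓ) {x : Plane}
    (hx : dist x !₂[ℓ / 2, 0] < ρ) (hx1 : 0 ≤ x 1) : chart a e ν x ∈ triangleHull T := by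
  have ha : a ∈ T := by rw [← Finset.mem_coe, hT]; simp
  have hb : b ∈ T := by rw [← Finset.mem_coe, hT]; simp
  have hp : p ∈ T := by rw [← Finset.mem_coe, hT]; simp
  rw [triangleHull_eq hT, h.area_eq] at hsh
  rw [triangleHull_eq hT]
  exact h.chart_mem_of_dist_lt hγ
    (dist_le_elementSize (subset_triangleHull ha) (subset_triangleHull hb))
    (dist_le_elementSize (subset_triangleHull ha) (subset_triangleHull hp))
    (dist_le_elementSize (subset_triangleHull hb) (subset_triangleHull hp)) hsh hρ hx hx1

/-- Conversely to `ℓ ≤ h(T)`, an edge cannot be short: the area is `ℓ k / 2` with `k ≤ h(T)`, and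
shape regularity is divided by `h(T)`. -/
theorem elementSize_le (h : TriangleFrame a b p e ν ℓ k σ)
    (hT : (T : Set (EuclideanSpace ℝ (Fin n))) = {a, b, p}) {γ : ℝ} (hγ : 0 < γ)
    (hsh : elementSize T ^ 2 ≤ γ * μHE[2].real (triangleHull T)) : 2 * elementSize T ≤ γ * ℓ := by
  have ha : a ∈ T := by rw [← Finset.mem_coe, hT]; simp
  have hb : b ∈ T := by rw [← Finset.mem_coe, hT]; simp
  have hp : p ∈ T := by rw [← Finset.mem_coe, hT]; simp
  rw [triangleHull_eq hT, h.area_eq] at hsh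
  have hℓ := h.ℓ_pos
  have hk := h.k_pos
  have hab := dist_le_elementSize (subset_triangleHull ha) (subset_triangleHull hb)
  have hap := dist_le_elementSize (subset_triangleHull ha) (subset_triangleHull hp)
  rw [← h.ℓ_eq] at hab
  have h1 := h.dist_a_p_sq
  have hk1 : k ≤ dist a p := le_of_sq_le_sq (by nlinarith) dist_nonneg
  have hH : 0 < elementSize T := by linarith
  refine le_of_mul_le_mul_right ?_ hH
  have := mul_le_mul_of_nonneg_left (hk1.trans hap) (mul_pos hγ hℓ).le
  linarith

/-- Comparison of two constants on a disc in a triangle. -/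
theorem sub_sq_mul_le (h : TriangleFrame a b p e ν ℓ k σ)
    (hT : (T : Set (EuclideanSpace ℝ (Fin n))) = {a, b, p}) {γ ρ : ℝ} (hγ : 0 < γ)
    (hsh : elementSize T ^ 2 ≤ γ * μHE[2].real (triangleHull T)) (hρ0 : 0 ≤ ρ)
    (hρ : ρ * (2 + γ) ≤ ℓ)
    {u : EuclideanSpace ℝ (Fin n) → ℝ} (hu : MemLp u 2 (μHE[2].restrict (triangleHull T)))
    (hfin : IsFiniteMeasure (μHE[2].restrict (triangleHull T))) (c c' : ℝ) :
    (c - c') ^ 2 * (Real.pi * (ρ / 2) ^ 2) ≤ 2 * ∫ x in triangleHull T, (u x - c) ^ 2 ∂μHE[2]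
      + 2 * ∫ x in edgeDisc ℓ ρ, (u (chart a e ν x) - c') ^ 2 := by
  have hD : edgeDisc ℓ ρ ⊆ chart a e ν ⁻¹' triangleHull T := fun x hx =>
    h.chart_mem_triangleHull hT hγ hsh hρ (edgeDisc_subset_ball ℓ ρ hx) (pos_of_mem_edgeDisc hx).le
  have hsq : ∀ c, IntegrableOn (fun x => (u x - c) ^ 2) (triangleHull T) μHE[2] := fun c => by
    have hi : MemLp (fun x => u x - c) 2 (μHE[2].restrict (triangleHull T)) :=
      hu.sub (memLp_const c)
    exact hi.integrable_sq
  have h1 := h.setIntegral_comp_le hT (hsq c) (fun x => sq_nonneg _) hD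
  have h2 := h.setIntegral_comp_le hT (hsq c') (fun x => sq_nonneg _) hD
  have hvol : volume.real (edgeDisc ℓ ρ) = Real.pi * (ρ / 2) ^ 2 :=
    volume_real_ball_plane _ (by positivity)
  calc (c - c') ^ 2 * (Real.pi * (ρ / 2) ^ 2) = ∫ x in edgeDisc ℓ ρ, (c - c') ^ 2 := by
        rw [setIntegral_const, hvol, smul_eq_mul, mul_comm]
    _ ≤ ∫ x in edgeDisc ℓ ρ, (2 * (u (chart a e ν x) - c) ^ 2
          + 2 * (u (chart a e ν x) - c') ^ 2) := by
        refine integral_mono ?_ ((h1.1.const_mul 2).add (h2.1.const_mul 2)) fun x => ?_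
        · exact integrableOn_const (measure_ball_lt_top.ne)
        · show (c - c') ^ 2 ≤ 2 * (u (chart a e ν x) - c) ^ 2 + 2 * (u (chart a e ν x) - c') ^ 2
          nlinarith [sq_nonneg ((u (chart a e ν x) - c) + (u (chart a e ν x) - c'))]
    _ = 2 * (∫ x in edgeDisc ℓ ρ, (u (chart a e ν x) - c) ^ 2)
          + 2 * ∫ x in edgeDisc ℓ ρ, (u (chart a e ν x) - c') ^ 2 := by
        rw [integral_add (h1.1.const_mul 2) (h2.1.const_mul 2), integral_const_mul,
          integral_const_mul]
    _ ≤ _ := by linarith [h1.2]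

end TriangleFrame

/-! ### From Poincaré inequalities to jump estimates -/

section LocalEstimates

variable {n : ℕ} {𝒯 : Finset (Finset (EuclideanSpace ℝ (Fin n)))}
  {S : Set (EuclideanSpace ℝ (Fin n))}

/-- The constant in the local estimates. -/
noncomputable def localConst (γ : ℝ) : ℝ :=
  4 * (Real.pi * γ * (γ ^ 2 * (2 + γ) ^ 2) + 64) + Real.pi * γ

theorem localConst_nonneg {γ : ℝ} (hγ : 0 < γ) : 0 ≤ localConst γ := by
  have := Real.pi_pos
  rw [localConst]
  positivity

/-- Local estimates follow from Poincaré inequalities on the elements and across the edges. -/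
theorem IsMesh.exists_hasLocalEstimates (h : IsMesh 𝒯 S) {γ : ℝ} (hγ : 0 < γ)
    (hsh : IsShapeRegular μHE[2] 𝒯 γ) {u : EuclideanSpace ℝ (Fin n) → ℝ}
    {G : EuclideanSpace ℝ (Fin n) → EuclideanSpace ℝ (Fin n)}
    (hu : MemLp u 2 (surfaceMeasure 𝒯))
    (hP : ∀ T ∈ 𝒯, ∃ c : ℝ, ∫ x in triangleHull T, (u x - c) ^ 2 ∂μHE[2]
      ≤ Real.pi * γ * elementSize T ^ 2 * ∫ x in triangleHull T, ‖G x‖ ^ 2 ∂μHE[2])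
    (hJ : ∀ T ∈ 𝒯, ∀ T' ∈ 𝒯, T ≠ T' → ∀ a b p q e ν ν' ℓ k σ k' σ',
      (T : Set (EuclideanSpace ℝ (Fin n))) = {a, b, p} →
      (T' : Set (EuclideanSpace ℝ (Fin n))) = {a, b, q} →
      TriangleFrame a b p e ν ℓ k σ → TriangleFrame a b q e ν' ℓ k' σ' →
      ∀ ρ, 0 < ρ → ρ * (2 + γ) = ℓ → ∃ c : ℝ,
      (∫ x in edgeDisc ℓ ρ, (u (chart a e ν x) - c) ^ 2) ≤ 16 * ρ ^ 2 *
        (∫ x in triangleHull T, ‖G x‖ ^ 2 ∂μHE[2] + ∫ x in triangleHull T', ‖G x‖ ^ 2 ∂μHE[2]) ∧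
      (∫ x in edgeDisc ℓ ρ, (u (chart a e ν' x) - c) ^ 2) ≤ 16 * ρ ^ 2 *
        (∫ x in triangleHull T, ‖G x‖ ^ 2 ∂μHE[2] + ∫ x in triangleHull T', ‖G x‖ ^ 2 ∂μHE[2])) :
    ∃ c, HasLocalEstimates 𝒯 u G (localConst γ) c := by
  classical
  have hex : ∀ T : Finset (EuclideanSpace ℝ (Fin n)), ∃ c : ℝ, T ∈ 𝒯 →
      ∫ x in triangleHull T, (u x - c) ^ 2 ∂μHE[2]
        ≤ Real.pi * γ * elementSize T ^ 2 * ∫ x in triangleHull T, ‖G x‖ ^ 2 ∂μHE[2] :=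
    fun T => by
      by_cases hT : T ∈ 𝒯
      · obtain ⟨c, hc⟩ := hP T hT
        exact ⟨c, fun _ => hc⟩
      · exact ⟨0, fun h => absurd h hT⟩
  choose c hc using hex
  have ha0 : ∀ T : Finset (EuclideanSpace ℝ (Fin n)),
      0 ≤ ∫ x in triangleHull T, ‖G x‖ ^ 2 ∂μHE[2] := fun T => integral_nonneg fun x => sq_nonneg _
  have hπ := Real.pi_pos
  refine ⟨c, fun T hT => (hc T hT).trans ?_, fun T hT T' hT' hne z a haz hzT haT hzT' haT' => ?_⟩
  · have : Real.pi * γ ≤ localConst γ := by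
      rw [localConst, le_add_iff_nonneg_left]
      positivity
    gcongr
  · obtain ⟨p, e, ν, ℓ, k, σ, -, -, hTe, hF⟩ := (h.isTriangle hT).exists_frame_of_mem hzT haT haz
    obtain ⟨q, e', ν', ℓ', k', σ', -, -, hTe', hF'⟩ :=
      (h.isTriangle hT').exists_frame_of_mem hzT' haT' haz
    have hℓ := hF.ℓ_pos
    obtain rfl : ℓ = ℓ' := hF.ℓ_eq.trans hF'.ℓ_eq.symm
    obtain rfl : e = e' := by
      have h1 := hF.eq_b.symm.trans hF'.eq_b
      exact smul_right_injective _ hℓ.ne' (add_left_cancel h1)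
    have hTs : (T : Set (EuclideanSpace ℝ (Fin n))) = {z, a, p} := by rw [hTe]; simp
    have hTs' : (T' : Set (EuclideanSpace ℝ (Fin n))) = {z, a, q} := by rw [hTe']; simp
    -- This is the largest radius that the half-disc criterion admits; it makes `ρ`, `ℓ` and the
    -- element sizes comparable.
    set ρ := ℓ / (2 + γ) with hρ
    have hρ0 : 0 < ρ := by positivity
    have hρℓ : ρ * (2 + γ) = ℓ := by rw [hρ]; field_simp
    obtain ⟨c₀, h1, h2⟩ := hJ T hT T' hT' hne z a p q e ν ν' ℓ k σ k' σ' hTs hTs' hF hF' ρ hρ0 hρℓ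
    set s := ∫ x in triangleHull T, ‖G x‖ ^ 2 ∂μHE[2] with hs
    set s' := ∫ x in triangleHull T', ‖G x‖ ^ 2 ∂μHE[2] with hs'
    have hs0 : 0 ≤ s := ha0 T
    have hs0' : 0 ≤ s' := ha0 T'
    set Q := Real.pi * γ * (γ ^ 2 * (2 + γ) ^ 2) + 64 with hQ
    -- The factor `(ρ / 2)²` from the area of the disc cancels against `H²` and `ρ²` on the right,
    -- so the jump bound is free of any length scale.
    have step : ∀ (H x t : ℝ), 0 ≤ H → 2 * H ≤ γ * ℓ → 0 ≤ t → t ≤ s + s' →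
        x * (Real.pi * (ρ / 2) ^ 2)
          ≤ 2 * (Real.pi * γ * H ^ 2 * t) + 2 * (16 * ρ ^ 2 * (s + s')) → x ≤ Q * (s + s') :=
      fun H x t hH0 hH ht0 ht hx => by
        have hH2 : H ^ 2 ≤ (γ * (2 + γ) / 2) ^ 2 * ρ ^ 2 := by
          rw [← mul_pow]
          refine pow_le_pow_left₀ hH0 ?_ 2
          rw [← hρℓ] at hH
          linarith
        have h3 : Real.pi * γ * H ^ 2 * t
            ≤ Real.pi * γ * ((γ * (2 + γ) / 2) ^ 2 * ρ ^ 2) * (s + s') := by gcongr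
        have h4 : 2 ≤ Real.pi := Real.two_le_pi
        have hQ0 : 0 ≤ Q * (s + s') := by positivity
        refine le_of_mul_le_mul_right ?_ (show 0 < Real.pi * (ρ / 2) ^ 2 by positivity)
        calc _ ≤ _ := hx
          _ ≤ 2 * (Real.pi * γ * ((γ * (2 + γ) / 2) ^ 2 * ρ ^ 2) * (s + s'))
              + 2 * (16 * ρ ^ 2 * (s + s')) := by linarith
          _ = Q * (s + s') * (2 * (ρ / 2) ^ 2) := by rw [hQ]; ring
          _ ≤ _ := by gcongr
    have hfin := (h.isTriangle hT).isFiniteMeasure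
    have hfin' := (h.isTriangle hT').isFiniteMeasure
    have e1 := hF.sub_sq_mul_le hTs hγ (hsh T hT) hρ0.le hρℓ.le
      (hu.mono_measure (restrict_triangleHull_le hT)) hfin (c T) c₀
    have e2 := hF'.sub_sq_mul_le hTs' hγ (hsh T' hT') hρ0.le hρℓ.le
      (hu.mono_measure (restrict_triangleHull_le hT')) hfin' (c T') c₀
    have f1 := step (elementSize T) ((c T - c₀) ^ 2) s Metric.diam_nonneg
      (hF.elementSize_le hTs hγ (hsh T hT)) hs0 (by linarith) (by linarith [hc T hT])
    have f2 := step (elementSize T') ((c T' - c₀) ^ 2) s' Metric.diam_nonneg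
      (hF'.elementSize_le hTs' hγ (hsh T' hT')) hs0' (by linarith) (by linarith [hc T' hT'])
    have f3 : (c T - c T') ^ 2 ≤ 4 * (Q * (s + s')) := by
      nlinarith [sq_nonneg ((c T - c₀) + (c T' - c₀))]
    refine f3.trans ?_
    rw [localConst, ← hQ, add_mul, mul_assoc]
    have : 0 ≤ Real.pi * γ * (s + s') := by positivity
    linarith

end LocalEstimates

/-! ### Scaled Poincaré inequalities -/

/-- Poincaré's inequality on a convex shape-regular set. -/
theorem HasPlanarGradient.exists_poincare_of_convex {R : Set Plane}
    (hc : Convex ℝ R) {H γ : ℝ} (hpos : 0 < volume.real R)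
    (hD : ∀ x ∈ R, ∀ y ∈ R, dist x y ≤ H) (hsh : H ^ 2 ≤ γ * volume.real R) {u : Plane → ℝ}
    {G : Plane → Plane} (h : HasPlanarGradient (interior R) u G) :
    ∃ c : ℝ, ∫ x in R, (u x - c) ^ 2 ≤ Real.pi * γ * H ^ 2 * ∫ x in R, ‖G x‖ ^ 2 := by
  -- The frontier of a convex set is null, so the open-set inequality also controls the integrals
  -- over `R`.
  have hae : interior R =ᵐ[volume] R := by
    refine interior_ae_eq_of_null_frontier ?_
    exact hc.addHaar_frontier volume
  have hr : volume.restrict (interior R) = volume.restrict R := Measure.restrict_congr_set hae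
  have hv : volume.real (interior R) = volume.real R := measureReal_congr hae
  have hne : (interior R).Nonempty := by
    by_contra hcon
    rw [not_nonempty_iff_eq_empty] at hcon
    rw [← hv, hcon] at hpos
    simp at hpos
  obtain ⟨c, hc⟩ := h.exists_poincare isOpen_interior hc.interior hne
    (fun x hx y hy => hD x (interior_subset hx) y (interior_subset hy))
  rw [hr, hv] at hc
  refine ⟨c, ?_⟩
  have h0 : 0 ≤ ∫ x in R, ‖G x‖ ^ 2 := integral_nonneg fun x => sq_nonneg _
  refine le_of_mul_le_mul_left ?_ hpos
  calc _ ≤ _ := hc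
    _ = Real.pi * H ^ 2 * (∫ x in R, ‖G x‖ ^ 2) * H ^ 2 := by ring
    _ ≤ Real.pi * H ^ 2 * (∫ x in R, ‖G x‖ ^ 2) * (γ * volume.real R) :=
        mul_le_mul_of_nonneg_left hsh (by have := Real.pi_pos; positivity)
    _ = _ := by ring

/-- Poincaré's inequality on a disc. -/
theorem HasPlanarGradient.exists_poincare_ball {m : Plane} {ρ : ℝ} (hρ : 0 < ρ) {u : Plane → ℝ}
    {G : Plane → Plane} (h : HasPlanarGradient (Metric.ball m ρ) u G) :
    ∃ c : ℝ, ∫ x in Metric.ball m ρ, (u x - c) ^ 2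
      ≤ 16 * ρ ^ 2 * ∫ x in Metric.ball m ρ, ‖G x‖ ^ 2 := by
  obtain ⟨c, hc⟩ := h.exists_poincare Metric.isOpen_ball (convex_ball m ρ)
    (Metric.nonempty_ball.2 hρ) (D := 2 * ρ) fun x hx y hy => by
      have h1 : dist x m < ρ := hx
      have h2 : dist y m < ρ := hy
      linarith [dist_triangle_right x y m]
  rw [volume_real_ball_plane _ hρ.le] at hc
  refine ⟨c, le_of_mul_le_mul_left ?_ (show 0 < Real.pi * ρ ^ 2 by
    have := Real.pi_pos; positivity)⟩
  refine hc.trans (le_of_eq ?_)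
  ring

/-! ### Transport of functions and gradients through charts -/

section Chart

variable {n : ℕ} {e ν : EuclideanSpace ℝ (Fin n)}

/-- Orthonormal pairs of vectors. -/
structure IsOrthonormalPair (e ν : EuclideanSpace ℝ (Fin n)) : Prop where
  norm_left : ‖e‖ = 1
  norm_right : ‖ν‖ = 1
  orth : inner ℝ e ν = 0

theorem TriangleFrame.isOrthonormalPair {a b p : EuclideanSpace ℝ (Fin n)} {ℓ k σ : ℝ}
    (h : TriangleFrame a b p e ν ℓ k σ) : IsOrthonormalPair e ν :=
  ⟨h.norm_e, h.norm_ν, h.orth⟩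

namespace IsOrthonormalPair

theorem neg_right (h : IsOrthonormalPair e ν) : IsOrthonormalPair e (-ν) :=
  ⟨h.norm_left, by rw [norm_neg, h.norm_right], by rw [inner_neg_right, h.orth, neg_zero]⟩

theorem isometry (h : IsOrthonormalPair e ν) (a : EuclideanSpace ℝ (Fin n)) :
    Isometry (chart a e ν) :=
  isometry_chart h.norm_left h.norm_right h.orth a

theorem measurableEmbedding (h : IsOrthonormalPair e ν) (a : EuclideanSpace ℝ (Fin n)) :
    MeasurableEmbedding (chart a e ν) :=
  (h.isometry a).isClosedEmbedding.measurableEmbedding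

theorem measurePreserving (h : IsOrthonormalPair e ν) {a : EuclideanSpace ℝ (Fin n)}
    {S : Set (EuclideanSpace ℝ (Fin n))} (hS : S ⊆ range (chart a e ν)) :
    MeasurePreserving (chart a e ν) (volume.restrict (chart a e ν ⁻¹' S)) (μHE[2].restrict S) := by
  refine ⟨(h.isometry a).continuous.measurable, ?_⟩
  rw [← (h.measurableEmbedding a).restrict_map, ← EuclideanSpace.euclideanHausdorffMeasure_eq_volume,
    (h.isometry a).map_euclideanHausdorffMeasure, Measure.restrict_restrict_of_subset hS]

/-- The adjoint of a linear isometry has norm at most one. Only this inequality is needed, so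
surface gradients need not be shown to remain tangential in the `L₂` limit. -/
theorem norm_adjoint_le (h : IsOrthonormalPair e ν) (v : EuclideanSpace ℝ (Fin n)) :
    ‖(chartLin e ν).adjoint v‖ ≤ ‖v‖ := by
  have h1 : ‖chartLin e ν‖ ≤ 1 := by
    refine ContinuousLinearMap.opNorm_le_bound _ zero_le_one fun x => ?_
    have := (h.isometry 0).dist_eq x 0
    simpa [chart, chartLin_apply, dist_eq_norm] using this.le
  calc _ ≤ ‖(chartLin e ν).adjoint‖ * ‖v‖ := ContinuousLinearMap.le_opNorm _ _
    _ = ‖chartLin e ν‖ * ‖v‖ := by rw [LinearIsometryEquiv.norm_map]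
    _ ≤ 1 * ‖v‖ := by gcongr
    _ = _ := one_mul _

theorem memLp_comp (h : IsOrthonormalPair e ν) {a : EuclideanSpace ℝ (Fin n)}
    {S : Set (EuclideanSpace ℝ (Fin n))} (hS : S ⊆ range (chart a e ν)) {F : Type*}
    [NormedAddCommGroup F] {f : EuclideanSpace ℝ (Fin n) → F} (hf : MemLp f 2 (μHE[2].restrict S)) :
    MemLp (fun x => f (chart a e ν x)) 2 (volume.restrict (chart a e ν ⁻¹' S)) :=
  hf.comp_measurePreserving (h.measurePreserving hS)

theorem eLpNorm_comp (h : IsOrthonormalPair e ν) {a : EuclideanSpace ℝ (Fin n)}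
    {S : Set (EuclideanSpace ℝ (Fin n))} (hS : S ⊆ range (chart a e ν)) {F : Type*}
    [NormedAddCommGroup F] {f : EuclideanSpace ℝ (Fin n) → F} (hf : MemLp f 2 (μHE[2].restrict S)) :
    eLpNorm (fun x => f (chart a e ν x)) 2 (volume.restrict (chart a e ν ⁻¹' S))
      = eLpNorm f 2 (μHE[2].restrict S) :=
  eLpNorm_comp_measurePreserving hf.aestronglyMeasurable (h.measurePreserving hS)

/-- The gradient of `w ∘ chart` is obtained by projecting the gradient of `w`. -/
theorem ae_hasGradientWithinAt (h : IsOrthonormalPair e ν) {a : EuclideanSpace ℝ (Fin n)}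
    {S : Set (EuclideanSpace ℝ (Fin n))} (hS : S ⊆ range (chart a e ν))
    {w : EuclideanSpace ℝ (Fin n) → ℝ} {g : EuclideanSpace ℝ (Fin n) → EuclideanSpace ℝ (Fin n)}
    (hw : ∀ᵐ x ∂(μHE[2].restrict S), HasGradientWithinAt w (g x) S x) :
    ∀ᵐ x ∂(volume.restrict (chart a e ν ⁻¹' S)), HasGradientWithinAt
      (fun x => w (chart a e ν x)) ((chartLin e ν).adjoint (g (chart a e ν x)))
      (chart a e ν ⁻¹' S) x := by
  have h1 := (h.measurePreserving hS).quasiMeasurePreserving.ae hw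
  filter_upwards [h1] with x hx
  have h2 : HasFDerivWithinAt (chart a e ν) (chartLin e ν) (chart a e ν ⁻¹' S) x :=
    ((chartLin e ν).hasFDerivAt.const_add a).hasFDerivWithinAt
  have h3 := hx.hasFDerivWithinAt.comp x h2 (mapsTo_preimage _ _)
  have e1 : InnerProductSpace.toDual ℝ Plane ((chartLin e ν).adjoint (g (chart a e ν x)))
      = (InnerProductSpace.toDual ℝ _ (g (chart a e ν x))).comp (chartLin e ν) := by
    ext y
    simp [ContinuousLinearMap.adjoint_inner_left]
  rw [hasGradientWithinAt_iff_hasFDerivWithinAt, e1]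
  exact h3

theorem lipschitzOnWith_comp (h : IsOrthonormalPair e ν) {a : EuclideanSpace ℝ (Fin n)}
    {S : Set (EuclideanSpace ℝ (Fin n))} {w : EuclideanSpace ℝ (Fin n) → ℝ} {K : NNReal}
    (hw : LipschitzOnWith K w S) :
    LipschitzOnWith K (fun x => w (chart a e ν x)) (chart a e ν ⁻¹' S) := by
  have := hw.comp ((h.isometry a).lipschitz.lipschitzOnWith (s := chart a e ν ⁻¹' S))
    (mapsTo_preimage _ _)
  rw [mul_one] at this
  exact this

theorem convex_preimage (a : EuclideanSpace ℝ (Fin n)) {S : Set (EuclideanSpace ℝ (Fin n))}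
    (hS : Convex ℝ S) : Convex ℝ (chart a e ν ⁻¹' S) :=
  (hS.translate_preimage_right a).linear_preimage (chartLin e ν).toLinearMap

end IsOrthonormalPair

end Chart

theorem convex_triangleHull {n : ℕ} (T : Finset (EuclideanSpace ℝ (Fin n))) :
    Convex ℝ (triangleHull T) :=
  convex_convexHull ℝ _

/-! ### Poincaré's inequality on surface elements -/

section Surface

variable {n : ℕ} {𝒯 : Finset (Finset (EuclideanSpace ℝ (Fin n)))}
  {S : Set (EuclideanSpace ℝ (Fin n))} {a b p e ν : EuclideanSpace ℝ (Fin n)} {ℓ k σ : ℝ}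
  {T : Finset (EuclideanSpace ℝ (Fin n))}

theorem IsLipschitzWithSurfaceGradient.memLp {w : EuclideanSpace ℝ (Fin n) → ℝ}
    {g : EuclideanSpace ℝ (Fin n) → EuclideanSpace ℝ (Fin n)} (h : IsMesh 𝒯 S)
    (hw : IsLipschitzWithSurfaceGradient 𝒯 w g) : MemLp w 2 (surfaceMeasure 𝒯) := by
  have := h.isFiniteMeasure
  have hc := isCompact_iUnion_triangleHull 𝒯
  obtain ⟨C, hC⟩ := hc.exists_bound_of_continuousOn hw.continuousOn
  refine MemLp.of_bound (hw.continuousOn.aestronglyMeasurable hc.isClosed.measurableSet) C ?_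
  rw [surfaceMeasure]
  filter_upwards [ae_restrict_mem hc.isClosed.measurableSet] with x hx using hC x hx

/-- In a chart of an element, a Lipschitz function has the projected surface gradient as weak
gradient. -/
theorem IsLipschitzWithSurfaceGradient.hasPlanarGradient {w : EuclideanSpace ℝ (Fin n) → ℝ}
    {g : EuclideanSpace ℝ (Fin n) → EuclideanSpace ℝ (Fin n)} (h : IsMesh 𝒯 S)
    (hw : IsLipschitzWithSurfaceGradient 𝒯 w g) (hT : T ∈ 𝒯) (ho : IsOrthonormalPair e ν)
    (hr : triangleHull T ⊆ range (chart a e ν)) :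
    HasPlanarGradient (interior (chart a e ν ⁻¹' triangleHull T)) (fun x => w (chart a e ν x))
      (fun x => (chartLin e ν).adjoint (g (chart a e ν x))) := by
  have hle : volume.restrict (interior (chart a e ν ⁻¹' triangleHull T))
      ≤ volume.restrict (chart a e ν ⁻¹' triangleHull T) :=
    Measure.restrict_mono interior_subset le_rfl
  obtain ⟨K, hK⟩ := hw.lipschitz T hT
  have hle' := restrict_triangleHull_le hT
  refine hasPlanarGradient_of_lipschitz (K := K) isOpen_interior
    ((ho.memLp_comp hr ((hw.memLp h).mono_measure hle')).mono_measure hle)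
    (((chartLin e ν).adjoint.comp_memLp'
      (ho.memLp_comp hr (hw.memLp_grad.mono_measure hle'))).mono_measure hle)
    (fun x r hxr => (ho.lipschitzOnWith_comp hK).mono (hxr.trans interior_subset)) ?_
  have h1 := ho.ae_hasGradientWithinAt hr ((hw.grad T hT).mono fun x hx => hx.2)
  filter_upwards [ae_mono hle h1, ae_restrict_mem isOpen_interior.measurableSet] with x hx hxm
  have := hx.hasFDerivWithinAt.hasFDerivAt (mem_interior_iff_mem_nhds.1 hxm)
  rwa [hasGradientAt_iff_hasFDerivAt]

theorem tendsto_eLpNorm_comp_chart {F : Type*} [NormedAddCommGroup F]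
    {f : ℕ → EuclideanSpace ℝ (Fin n) → F} {f₀ : EuclideanSpace ℝ (Fin n) → F}
    (hf : ∀ k, MemLp (f k) 2 (surfaceMeasure 𝒯)) (hf₀ : MemLp f₀ 2 (surfaceMeasure 𝒯))
    (hlim : Tendsto (fun k => eLpNorm (fun x => f k x - f₀ x) 2 (surfaceMeasure 𝒯)) atTop (𝓝 0))
    (hT : T ∈ 𝒯) (ho : IsOrthonormalPair e ν) (hr : triangleHull T ⊆ range (chart a e ν))
    {D : Set Plane} (hD : D ⊆ chart a e ν ⁻¹' triangleHull T) :
    Tendsto (fun k => eLpNorm (fun x => f k (chart a e ν x) - f₀ (chart a e ν x)) 2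
      (volume.restrict D)) atTop (𝓝 0) := by
  refine tendsto_of_tendsto_of_tendsto_of_le_of_le tendsto_const_nhds hlim (fun _ => zero_le)
    fun k => ?_
  have hle' := restrict_triangleHull_le hT
  have hi : MemLp (fun x => f k x - f₀ x) 2 (surfaceMeasure 𝒯) := (hf k).sub hf₀
  calc _ ≤ eLpNorm (fun x => f k (chart a e ν x) - f₀ (chart a e ν x)) 2
        (volume.restrict (chart a e ν ⁻¹' triangleHull T)) :=
        eLpNorm_mono_measure _ (Measure.restrict_mono hD le_rfl)
    _ = eLpNorm (fun x => f k x - f₀ x) 2 (μHE[2].restrict (triangleHull T)) :=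
        ho.eLpNorm_comp hr (f := fun x => f k x - f₀ x) (hi.mono_measure hle')
    _ ≤ _ := eLpNorm_mono_measure _ hle'

theorem tendsto_eLpNorm_adjoint {α : Type*} [MeasurableSpace α] {μ : Measure α}
    (ho : IsOrthonormalPair e ν) {g : ℕ → α → EuclideanSpace ℝ (Fin n)}
    {G : α → EuclideanSpace ℝ (Fin n)}
    (h : Tendsto (fun k => eLpNorm (fun x => g k x - G x) 2 μ) atTop (𝓝 0)) :
    Tendsto (fun k => eLpNorm (fun x => (chartLin e ν).adjoint (g k x)
      - (chartLin e ν).adjoint (G x)) 2 μ) atTop (𝓝 0) := by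
  refine tendsto_of_tendsto_of_tendsto_of_le_of_le tendsto_const_nhds h (fun _ => zero_le)
    fun k => eLpNorm_mono fun x => ?_
  rw [← map_sub]
  exact ho.norm_adjoint_le _

/-- It holds for the Lipschitz approximants by Rademacher-free classical differentiation, and passes
to the limit because charts preserve the measure and the adjoint contracts. -/
theorem HasSurfaceGradient.hasPlanarGradient {u : EuclideanSpace ℝ (Fin n) → ℝ}
    {G : EuclideanSpace ℝ (Fin n) → EuclideanSpace ℝ (Fin n)} (h : IsMesh 𝒯 S)
    (hu : HasSurfaceGradient 𝒯 u G) (hT : T ∈ 𝒯) (ho : IsOrthonormalPair e ν)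
    (hr : triangleHull T ⊆ range (chart a e ν)) :
    HasPlanarGradient (interior (chart a e ν ⁻¹' triangleHull T)) (fun x => u (chart a e ν x))
      (fun x => (chartLin e ν).adjoint (G (chart a e ν x))) := by
  obtain ⟨hu, hG, w, g, hw, hwu, hgG⟩ := hu
  have hle : volume.restrict (interior (chart a e ν ⁻¹' triangleHull T))
      ≤ volume.restrict (chart a e ν ⁻¹' triangleHull T) :=
    Measure.restrict_mono interior_subset le_rfl
  have hle' := restrict_triangleHull_le hT
  refine HasPlanarGradient.of_tendsto ((ho.memLp_comp hr (hu.mono_measure hle')).mono_measure hle)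
    (((chartLin e ν).adjoint.comp_memLp'
      (ho.memLp_comp hr (hG.mono_measure hle'))).mono_measure hle)
    (fun k => (hw k).hasPlanarGradient h hT ho hr) ?_ ?_
  · exact tendsto_eLpNorm_comp_chart (fun k => (hw k).memLp h) hu hwu hT ho hr interior_subset
  · exact tendsto_eLpNorm_adjoint ho
      (tendsto_eLpNorm_comp_chart (fun k => (hw k).memLp_grad) hG hgG hT ho hr interior_subset)

theorem IsOrthonormalPair.setIntegral_adjoint_le (ho : IsOrthonormalPair e ν)
    {G : EuclideanSpace ℝ (Fin n) → EuclideanSpace ℝ (Fin n)} (hG : MemLp G 2 (surfaceMeasure 𝒯))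
    (hT : T ∈ 𝒯) (hr : triangleHull T ⊆ range (chart a e ν)) {D : Set Plane}
    (hD : D ⊆ chart a e ν ⁻¹' triangleHull T) :
    ∫ x in D, ‖(chartLin e ν).adjoint (G (chart a e ν x))‖ ^ 2
      ≤ ∫ x in triangleHull T, ‖G x‖ ^ 2 ∂μHE[2] := by
  have h1 := ho.memLp_comp hr (hG.mono_measure (restrict_triangleHull_le hT))
  have h2 := (chartLin e ν).adjoint.comp_memLp' h1
  have i1 := h1.integrable_norm_pow (p := 2) (by norm_num)
  have i2 := h2.integrable_norm_pow (p := 2) (by norm_num)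
  calc _ ≤ ∫ x in chart a e ν ⁻¹' triangleHull T,
        ‖(chartLin e ν).adjoint (G (chart a e ν x))‖ ^ 2 :=
        setIntegral_mono_set i2 (Eventually.of_forall fun x => sq_nonneg _) hD.eventuallyLE
    _ ≤ ∫ x in chart a e ν ⁻¹' triangleHull T, ‖G (chart a e ν x)‖ ^ 2 := by
        refine integral_mono i2 i1 fun x => ?_
        exact pow_le_pow_left₀ (norm_nonneg _) (ho.norm_adjoint_le _) 2
    _ = _ := (ho.measurePreserving hr).integral_comp (ho.measurableEmbedding a)
        fun x => ‖G x‖ ^ 2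

/-- Poincaré's inequality on the elements of a surface mesh. -/
theorem HasSurfaceGradient.exists_poincare {u : EuclideanSpace ℝ (Fin n) → ℝ}
    {G : EuclideanSpace ℝ (Fin n) → EuclideanSpace ℝ (Fin n)} (h : IsMesh 𝒯 S) {γ : ℝ}
    (hγ : IsShapeRegular μHE[2] 𝒯 γ) (hγ0 : 0 < γ)
    (hu : HasSurfaceGradient 𝒯 u G) (hT : T ∈ 𝒯) :
    ∃ c : ℝ, ∫ x in triangleHull T, (u x - c) ^ 2 ∂μHE[2]
      ≤ Real.pi * γ * elementSize T ^ 2 * ∫ x in triangleHull T, ‖G x‖ ^ 2 ∂μHE[2] := by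
  classical
  obtain ⟨a, b, p, e, ν, ℓ, k, σ, -, -, -, hTe, hF⟩ := (h.isTriangle hT).exists_frame
  have hTs : (T : Set (EuclideanSpace ℝ (Fin n))) = {a, b, p} := by rw [hTe]; simp
  have ho := hF.isOrthonormalPair
  have hr := hF.subset_range hTs
  have hmp := ho.measurePreserving hr
  have hvol : volume.real (chart a e ν ⁻¹' triangleHull T) = μHE[2].real (triangleHull T) := by
    have := hmp.measureReal_preimage (s := univ) MeasurableSet.univ.nullMeasurableSet
    simpa using this
  obtain ⟨c, hc⟩ := (hu.hasPlanarGradient h hT ho hr).exists_poincare_of_convex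
    (H := elementSize T) (γ := γ)
    (IsOrthonormalPair.convex_preimage a (convex_triangleHull T))
    (by rw [hvol]; exact (h.isTriangle hT).area_pos)
    (fun x hx y hy => by
      rw [← (ho.isometry a).dist_eq]
      exact dist_le_elementSize hx hy)
    (by rw [hvol]; exact hγ T hT)
  refine ⟨c, ?_⟩
  rw [← hmp.integral_comp (ho.measurableEmbedding a) fun x => (u x - c) ^ 2]
  refine hc.trans ?_
  have := Real.pi_pos
  gcongr
  exact ho.setIntegral_adjoint_le hu.2.1 hT hr Subset.rfl

end Surface

/-! ### Gluing along the axis and unfolding -/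

/-- The closed upper half plane. -/
def upperHalf : Set Plane := {x | 0 ≤ x 1}

theorem isClosed_upperHalf : IsClosed upperHalf :=
  isClosed_le continuous_const (by fun_prop : Continuous fun x : Plane => x 1)

theorem volume_axis : volume {x : Plane | x 1 = 0} = 0 := by
  have h := Measure.addHaar_submodule (volume : Measure Plane)
    (LinearMap.ker (EuclideanSpace.proj (1 : Fin 2) : Plane →L[ℝ] ℝ).toLinearMap) fun htop => by
      have h1 : (!₂[0, 1] : Plane) ∈
          LinearMap.ker (EuclideanSpace.proj (1 : Fin 2) : Plane →L[ℝ] ℝ).toLinearMap := by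
        rw [htop]; trivial
      simp at h1
  have e : {x : Plane | x 1 = 0}
      = LinearMap.ker (EuclideanSpace.proj (1 : Fin 2) : Plane →L[ℝ] ℝ).toLinearMap := by
    ext x
    simp
  rw [e]
  exact h

open Classical in
theorem memLp_piecewise_upperHalf {F : Type*} [NormedAddCommGroup F] {B : Set Plane}
    {f f' : Plane → F}
    (hf : MemLp f 2 (volume.restrict (B ∩ upperHalf)))
    (hf' : MemLp f' 2 (volume.restrict (B ∩ upperHalfᶜ))) :
    MemLp (upperHalf.piecewise f f') 2 (volume.restrict B) := by
  refine MemLp.piecewise isClosed_upperHalf.measurableSet ?_ ?_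
  · rwa [Measure.restrict_restrict isClosed_upperHalf.measurableSet, inter_comm]
  · rwa [Measure.restrict_restrict isClosed_upperHalf.measurableSet.compl, inter_comm]

open Classical in
theorem tendsto_eLpNorm_piecewise_upperHalf {F : Type*} [NormedAddCommGroup F] {B : Set Plane}
    {f f' : ℕ → Plane → F} {f₀ f₀' : Plane → F}
    (hm : ∀ k, AEStronglyMeasurable (fun x => f k x - f₀ x) (volume.restrict (B ∩ upperHalf)))
    (hm' : ∀ k, AEStronglyMeasurable (fun x => f' k x - f₀' x) (volume.restrict (B ∩ upperHalfᶜ)))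
    (hf : Tendsto (fun k => eLpNorm (fun x => f k x - f₀ x) 2 (volume.restrict (B ∩ upperHalf)))
      atTop (𝓝 0))
    (hf' : Tendsto (fun k => eLpNorm (fun x => f' k x - f₀' x) 2
      (volume.restrict (B ∩ upperHalfᶜ))) atTop (𝓝 0)) :
    Tendsto (fun k => eLpNorm (fun x => upperHalf.piecewise (f k) (f' k) x
      - upperHalf.piecewise f₀ f₀' x) 2 (volume.restrict B)) atTop (𝓝 0) := by
  have hms := isClosed_upperHalf.measurableSet
  have h := hf.add hf'
  rw [add_zero] at h
  refine tendsto_of_tendsto_of_tendsto_of_le_of_le tendsto_const_nhds h (fun _ => zero_le)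
    fun k => ?_
  have e : (fun x => upperHalf.piecewise (f k) (f' k) x - upperHalf.piecewise f₀ f₀' x)
      = upperHalf.indicator (fun x => f k x - f₀ x)
        + upperHalfᶜ.indicator (fun x => f' k x - f₀' x) := by
    ext1 x
    by_cases hx : x ∈ upperHalf <;> simp [hx]
  have r1 : (volume.restrict B).restrict upperHalf = volume.restrict (B ∩ upperHalf) := by
    rw [Measure.restrict_restrict hms, inter_comm]
  have r2 : (volume.restrict B).restrict upperHalfᶜ = volume.restrict (B ∩ upperHalfᶜ) := by
    rw [Measure.restrict_restrict hms.compl, inter_comm]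
  rw [e, ← r1, ← r2, ← eLpNorm_indicator_eq_eLpNorm_restrict hms,
    ← eLpNorm_indicator_eq_eLpNorm_restrict hms.compl]
  refine eLpNorm_add_le ?_ ?_ (by norm_num)
  · rw [aestronglyMeasurable_indicator_iff hms, r1]
    exact hm k
  · rw [aestronglyMeasurable_indicator_iff hms.compl, r2]
    exact hm' k

open Classical in
/-- Gluing of two Lipschitz functions along the axis. -/
theorem hasPlanarGradient_piecewise {B R R' : Set Plane} (hB : IsOpen B) (hc : Convex ℝ B)
    (hR : IsClosed R) (hR' : IsClosed R') (hBR : ∀ x ∈ B, 0 ≤ x 1 → x ∈ R)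
    (hBR' : ∀ x ∈ B, x 1 ≤ 0 → x ∈ R') {f f' : Plane → ℝ} {G G' : Plane → Plane}
    (hf : MemLp f 2 (volume.restrict R)) (hf' : MemLp f' 2 (volume.restrict R'))
    (hG : MemLp G 2 (volume.restrict R)) (hG' : MemLp G' 2 (volume.restrict R')) {K K' : NNReal}
    (hK : LipschitzOnWith K f R) (hK' : LipschitzOnWith K' f' R')
    (hff' : ∀ x, x 1 = 0 → f x = f' x)
    (hg : ∀ᵐ x ∂(volume.restrict R), HasGradientWithinAt f (G x) R x)
    (hg' : ∀ᵐ x ∂(volume.restrict R'), HasGradientWithinAt f' (G' x) R' x) :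
    HasPlanarGradient B (upperHalf.piecewise f f') (upperHalf.piecewise G G') := by
  have s1 : B ∩ upperHalf ⊆ R := fun x hx => hBR x hx.1 hx.2
  have s2 : B ∩ upperHalfᶜ ⊆ R' := fun x hx => hBR' x hx.1 (not_le.1 (show ¬ (0 ≤ x 1) from hx.2)).le
  have m1 := Measure.restrict_mono (μ := (volume : Measure Plane)) s1 le_rfl
  have m2 := Measure.restrict_mono (μ := (volume : Measure Plane)) s2 le_rfl
  have hcoord : Continuous fun x : Plane => x 1 := by fun_prop
  have c2 : IsClosed {x : Plane | x 1 ≤ 0} := isClosed_le hcoord continuous_const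
  have eq1 : EqOn (upperHalf.piecewise f f') f upperHalf := fun x hx => piecewise_eq_of_mem _ _ _ hx
  -- The two functions agree on the axis, so the lower one describes the glued function on the
  -- closed half plane. Closedness of both pieces is what the covering lemma asks for.
  have eq2 : EqOn (upperHalf.piecewise f f') f' {x : Plane | x 1 ≤ 0} := fun x hx => by
    by_cases hxu : x ∈ upperHalf
    · rw [piecewise_eq_of_mem _ _ _ hxu, hff' x (le_antisymm hx hxu)]
    · rw [piecewise_eq_of_notMem _ _ _ hxu]
  have l1 : LipschitzOnWith (max K K') (upperHalf.piecewise f f') (upperHalf ∩ R) :=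
    fun x hx y hy => by
      rw [eq1 hx.1, eq1 hy.1]
      exact hK.weaken (le_max_left K K') hx.2 hy.2
  have l2 : LipschitzOnWith (max K K') (upperHalf.piecewise f f') ({x : Plane | x 1 ≤ 0} ∩ R') :=
    fun x hx y hy => by
      rw [eq2 hx.1, eq2 hy.1]
      exact hK'.weaken (le_max_right K K') hx.2 hy.2
  have hcont : ContinuousOn (upperHalf.piecewise f f')
      ((upperHalf ∩ R) ∪ ({x : Plane | x 1 ≤ 0} ∩ R')) :=
    l1.continuousOn.union_of_isClosed l2.continuousOn (isClosed_upperHalf.inter hR) (c2.inter hR')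
  have hcov : B ⊆ (upperHalf ∩ R) ∪ ({x : Plane | x 1 ≤ 0} ∩ R') := fun x hx => by
    rcases le_total 0 (x 1) with h | h
    · exact Or.inl ⟨h, hBR x hx h⟩
    · exact Or.inr ⟨h, hBR' x hx h⟩
  have hLip : LipschitzOnWith (max K K') (upperHalf.piecewise f f') B := by
    refine lipschitzOnWith_of_finite_closed_cover (s := Finset.univ)
      (S := fun i : Bool => cond i (upperHalf ∩ R) ({x : Plane | x 1 ≤ 0} ∩ R')) hc ?_ ?_
      (hcont.mono hcov) ?_
    · rintro (_ | _) -
      · exact c2.inter hR'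
      · exact isClosed_upperHalf.inter hR
    · intro x hx
      simp only [mem_iUnion]
      rcases hcov hx with h | h
      · exact ⟨true, Finset.mem_univ _, h⟩
      · exact ⟨false, Finset.mem_univ _, h⟩
    · rintro (_ | _) -
      · exact l2.mono inter_subset_left
      · exact l1.mono inter_subset_left
  refine hasPlanarGradient_of_lipschitz (K := max K K') hB
    (memLp_piecewise_upperHalf (hf.mono_measure m1) (hf'.mono_measure m2))
    (memLp_piecewise_upperHalf (hG.mono_measure m1) (hG'.mono_measure m2))
    (fun x r hx => hLip.mono hx) ?_
  rw [ae_restrict_iff' hR.measurableSet] at hg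
  rw [ae_restrict_iff' hR'.measurableSet] at hg'
  rw [ae_restrict_iff' hB.measurableSet]
  have h0 : ∀ᵐ x : Plane, x ∉ {x : Plane | x 1 = 0} :=
    measure_eq_zero_iff_ae_notMem.1 volume_axis
  filter_upwards [hg, hg', h0] with x hx hx' hx0 hxB
  rcases lt_or_gt_of_ne (fun h : x 1 = 0 => hx0 h) with hlt | hgt
  · have hnh : B ∩ {x : Plane | x 1 < 0} ∈ 𝓝 x :=
      (hB.inter (isOpen_lt hcoord continuous_const)).mem_nhds ⟨hxB, hlt⟩
    have hd := (hx' (hBR' x hxB hlt.le)).hasFDerivWithinAt.hasFDerivAt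
      (mem_of_superset hnh fun y hy => hBR' y hy.1 (le_of_lt hy.2))
    have hxu : x ∉ upperHalf := fun h => absurd hlt (not_lt.2 h)
    rw [hasGradientAt_iff_hasFDerivAt, piecewise_eq_of_notMem _ _ _ hxu]
    refine hd.congr_of_eventuallyEq (mem_of_superset hnh fun y hy => ?_)
    exact eq2 (show y 1 ≤ 0 from le_of_lt (show y 1 < 0 from hy.2))
  · have hnh : B ∩ {x : Plane | 0 < x 1} ∈ 𝓝 x :=
      (hB.inter (isOpen_lt continuous_const hcoord)).mem_nhds ⟨hxB, hgt⟩
    have hd := (hx (hBR x hxB hgt.le)).hasFDerivWithinAt.hasFDerivAt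
      (mem_of_superset hnh fun y hy => hBR y hy.1 (le_of_lt hy.2))
    have hxu : x ∈ upperHalf := le_of_lt hgt
    rw [hasGradientAt_iff_hasFDerivAt, piecewise_eq_of_mem _ _ _ hxu]
    refine hd.congr_of_eventuallyEq (mem_of_superset hnh fun y hy => ?_)
    exact eq1 (show 0 ≤ y 1 from le_of_lt (show 0 < y 1 from hy.2))

/-- Reversing the normal reflects the coordinates in the axis. Thus the second element of an edge
can be placed below the axis while the first lies above it. -/
theorem chart_neg_apply {n : ℕ} (a e ν : EuclideanSpace ℝ (Fin n)) (s t : ℝ) :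
    chart a e (-ν) !₂[s, -t] = chart a e ν !₂[s, t] := by
  simp [chart, chartLin_apply]

theorem range_chart_neg {n : ℕ} (a e ν : EuclideanSpace ℝ (Fin n)) :
    range (chart a e ν) ⊆ range (chart a e (-ν)) := by
  rintro _ ⟨x, rfl⟩
  refine ⟨!₂[x 0, -x 1], ?_⟩
  rw [chart_neg_apply]
  congr 1
  ext i
  fin_cases i <;> simp

/-- The axis is mapped to the line of the common edge in either chart; this is the compatibility
needed for gluing. -/
theorem chart_eq_of_axis {n : ℕ} (a e ν ν' : EuclideanSpace ℝ (Fin n)) {x : Plane}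
    (hx : x 1 = 0) : chart a e ν x = chart a e ν' x := by
  simp [chart, chartLin_apply, hx]

/-! ### The jump estimate and stability on surfaces -/

section SurfaceJump

variable {n : ℕ} {𝒯 : Finset (Finset (EuclideanSpace ℝ (Fin n)))}
  {S : Set (EuclideanSpace ℝ (Fin n))} {a b p q e ν ν' : EuclideanSpace ℝ (Fin n)}
  {ℓ k σ k' σ' : ℝ} {T T' : Finset (EuclideanSpace ℝ (Fin n))}

open Classical in
/-- Unfolding of two elements with a common edge. -/
theorem HasSurfaceGradient.hasPlanarGradient_piecewise {u : EuclideanSpace ℝ (Fin n) → ℝ}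
    {G : EuclideanSpace ℝ (Fin n) → EuclideanSpace ℝ (Fin n)} (h : IsMesh 𝒯 S)
    (hu : HasSurfaceGradient 𝒯 u G) (hT : T ∈ 𝒯) (hT' : T' ∈ 𝒯) (ho : IsOrthonormalPair e ν)
    (ho' : IsOrthonormalPair e ν') (hr : triangleHull T ⊆ range (chart a e ν))
    (hr' : triangleHull T' ⊆ range (chart a e ν')) {B : Set Plane} (hB : IsOpen B)
    (hc : Convex ℝ B) (hBT : ∀ x ∈ B, 0 ≤ x 1 → chart a e ν x ∈ triangleHull T)
    (hBT' : ∀ x ∈ B, x 1 ≤ 0 → chart a e ν' x ∈ triangleHull T') :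
    HasPlanarGradient B
      (upperHalf.piecewise (fun x => u (chart a e ν x)) fun x => u (chart a e ν' x))
      (upperHalf.piecewise (fun x => (chartLin e ν).adjoint (G (chart a e ν x)))
        fun x => (chartLin e ν').adjoint (G (chart a e ν' x))) := by
  obtain ⟨hu, hG, w, g, hw, hwu, hgG⟩ := hu
  have s1 : B ∩ upperHalf ⊆ chart a e ν ⁻¹' triangleHull T := fun x hx => hBT x hx.1 hx.2
  have s2 : B ∩ upperHalfᶜ ⊆ chart a e ν' ⁻¹' triangleHull T' := fun x hx =>
    hBT' x hx.1 (not_le.1 (show ¬ (0 ≤ x 1) from hx.2)).le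
  have m1 := Measure.restrict_mono (μ := (volume : Measure Plane)) s1 le_rfl
  have m2 := Measure.restrict_mono (μ := (volume : Measure Plane)) s2 le_rfl
  have hle := restrict_triangleHull_le hT
  have hle' := restrict_triangleHull_le hT'
  have fu := ho.memLp_comp hr (hu.mono_measure hle)
  have fu' := ho'.memLp_comp hr' (hu.mono_measure hle')
  have fG := (chartLin e ν).adjoint.comp_memLp' (ho.memLp_comp hr (hG.mono_measure hle))
  have fG' := (chartLin e ν').adjoint.comp_memLp' (ho'.memLp_comp hr' (hG.mono_measure hle'))
  have fw := fun k => ho.memLp_comp hr (((hw k).memLp h).mono_measure hle)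
  have fw' := fun k => ho'.memLp_comp hr' (((hw k).memLp h).mono_measure hle')
  have fg := fun k => (chartLin e ν).adjoint.comp_memLp'
    (ho.memLp_comp hr ((hw k).memLp_grad.mono_measure hle))
  have fg' := fun k => (chartLin e ν').adjoint.comp_memLp'
    (ho'.memLp_comp hr' ((hw k).memLp_grad.mono_measure hle'))
  -- An `L₂` function has no values on the edge, so the continuous approximants are glued and the
  -- limit is taken afterwards.
  refine HasPlanarGradient.of_tendsto
    (w := fun k => upperHalf.piecewise (fun x => w k (chart a e ν x)) fun x => w k (chart a e ν' x))
    (g := fun k => upperHalf.piecewise (fun x => (chartLin e ν).adjoint (g k (chart a e ν x)))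
        fun x => (chartLin e ν').adjoint (g k (chart a e ν' x)))
    (memLp_piecewise_upperHalf (fu.mono_measure m1) (fu'.mono_measure m2))
    (memLp_piecewise_upperHalf (fG.mono_measure m1) (fG'.mono_measure m2))
    (fun k => ?_) ?_ ?_
  · obtain ⟨K, hK⟩ := (hw k).lipschitz T hT
    obtain ⟨K', hK'⟩ := (hw k).lipschitz T' hT'
    exact _root_.hasPlanarGradient_piecewise hB hc
      ((isCompact_triangleHull T).isClosed.preimage (ho.isometry a).continuous)
      ((isCompact_triangleHull T').isClosed.preimage (ho'.isometry a).continuous)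
      hBT hBT' (fw k) (fw' k) (fg k) (fg' k) (ho.lipschitzOnWith_comp hK)
      (ho'.lipschitzOnWith_comp hK') (fun x hx => by rw [chart_eq_of_axis a e ν ν' hx])
      (ho.ae_hasGradientWithinAt hr (((hw k).grad T hT).mono fun x hx => hx.2))
      (ho'.ae_hasGradientWithinAt hr' (((hw k).grad T' hT').mono fun x hx => hx.2))
  · exact tendsto_eLpNorm_piecewise_upperHalf
      (fun k => (((fw k).sub fu).mono_measure m1).aestronglyMeasurable)
      (fun k => (((fw' k).sub fu').mono_measure m2).aestronglyMeasurable)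
      (tendsto_eLpNorm_comp_chart (fun k => (hw k).memLp h) hu hwu hT ho hr s1)
      (tendsto_eLpNorm_comp_chart (fun k => (hw k).memLp h) hu hwu hT' ho' hr' s2)
  · exact tendsto_eLpNorm_piecewise_upperHalf
      (fun k => (((fg k).sub fG).mono_measure m1).aestronglyMeasurable)
      (fun k => (((fg' k).sub fG').mono_measure m2).aestronglyMeasurable)
      (tendsto_eLpNorm_adjoint ho
        (tendsto_eLpNorm_comp_chart (fun k => (hw k).memLp_grad) hG hgG hT ho hr s1))
      (tendsto_eLpNorm_adjoint ho'
        (tendsto_eLpNorm_comp_chart (fun k => (hw k).memLp_grad) hG hgG hT' ho' hr' s2))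

/-- Poincaré's inequality across an edge of a surface mesh. -/
theorem HasSurfaceGradient.exists_poincare_edge {u : EuclideanSpace ℝ (Fin n) → ℝ}
    {G : EuclideanSpace ℝ (Fin n) → EuclideanSpace ℝ (Fin n)} (h : IsMesh 𝒯 S) {γ : ℝ}
    (hsh : IsShapeRegular μHE[2] 𝒯 γ) (hγ : 0 < γ) (hu : HasSurfaceGradient 𝒯 u G) (hT : T ∈ 𝒯)
    (hT' : T' ∈ 𝒯) (hTs : (T : Set (EuclideanSpace ℝ (Fin n))) = {a, b, p})
    (hTs' : (T' : Set (EuclideanSpace ℝ (Fin n))) = {a, b, q})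
    (hF : TriangleFrame a b p e ν ℓ k σ) (hF' : TriangleFrame a b q e ν' ℓ k' σ') {ρ : ℝ}
    (hρ : 0 < ρ) (hρℓ : ρ * (2 + γ) = ℓ) : ∃ c : ℝ,
      (∫ x in edgeDisc ℓ ρ, (u (chart a e ν x) - c) ^ 2) ≤ 16 * ρ ^ 2 *
        (∫ x in triangleHull T, ‖G x‖ ^ 2 ∂μHE[2] + ∫ x in triangleHull T', ‖G x‖ ^ 2 ∂μHE[2]) ∧
      (∫ x in edgeDisc ℓ ρ, (u (chart a e ν' x) - c) ^ 2) ≤ 16 * ρ ^ 2 *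
        (∫ x in triangleHull T, ‖G x‖ ^ 2 ∂μHE[2] +
          ∫ x in triangleHull T', ‖G x‖ ^ 2 ∂μHE[2]) := by
  classical
  have ho := hF.isOrthonormalPair
  have ho₁ := hF'.isOrthonormalPair
  have ho' := ho₁.neg_right
  have hr := hF.subset_range hTs
  have hr₁ := hF'.subset_range hTs'
  have hr' := hr₁.trans (range_chart_neg a e ν')
  set B := Metric.ball (!₂[ℓ / 2, 0] : Plane) ρ with hB
  have hBT : ∀ x ∈ B, 0 ≤ x 1 → chart a e ν x ∈ triangleHull T := fun x hx hx1 =>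
    hF.chart_mem_triangleHull hTs hγ (hsh T hT) hρℓ.le hx hx1
  have hneg : ∀ x : Plane, chart a e (-ν') x = chart a e ν' !₂[x 0, -x 1] := fun x => by
    rw [← chart_neg_apply a e ν' (x 0) (-x 1), neg_neg]
    congr 1
    ext i
    fin_cases i <;> simp
  have hBT' : ∀ x ∈ B, x 1 ≤ 0 → chart a e (-ν') x ∈ triangleHull T' := fun x hx hx1 => by
    rw [hneg]
    refine hF'.chart_mem_triangleHull hTs' hγ (hsh T' hT') hρℓ.le ?_ (by simpa using hx1)
    have hx' : dist x !₂[ℓ / 2, 0] < ρ := hx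
    refine lt_of_le_of_lt (le_of_sq_le_sq ?_ dist_nonneg) hx'
    rw [dist_sq_plane, dist_sq_plane]
    simp
  have hPG := hu.hasPlanarGradient_piecewise h hT hT' ho ho' hr hr' Metric.isOpen_ball
    (convex_ball _ _) hBT hBT'
  obtain ⟨c, hc⟩ := hPG.exists_poincare_ball hρ
  set f := upperHalf.piecewise (fun x => u (chart a e ν x)) fun x => u (chart a e (-ν') x) with hf
  set g := upperHalf.piecewise (fun x => (chartLin e ν).adjoint (G (chart a e ν x)))
        fun x => (chartLin e (-ν')).adjoint (G (chart a e (-ν') x)) with hg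
  have hms := isClosed_upperHalf.measurableSet
  have s1 : B ∩ upperHalf ⊆ chart a e ν ⁻¹' triangleHull T := fun x hx => hBT x hx.1 hx.2
  have s2 : B ∩ upperHalfᶜ ⊆ chart a e (-ν') ⁻¹' triangleHull T' := fun x hx =>
    hBT' x hx.1 (not_le.1 (show ¬ (0 ≤ x 1) from hx.2)).le
  have hgle : ∫ x in B, ‖g x‖ ^ 2 ≤ ∫ x in triangleHull T, ‖G x‖ ^ 2 ∂μHE[2]
      + ∫ x in triangleHull T', ‖G x‖ ^ 2 ∂μHE[2] := by
    have hgi : IntegrableOn (fun x => ‖g x‖ ^ 2) B :=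
      hPG.memLp_grad.integrable_norm_pow (p := 2) (by norm_num)
    rw [← integral_inter_add_sdiff hms hgi, sdiff_eq]
    refine add_le_add ?_ ?_
    · rw [setIntegral_congr_fun (g := fun x => ‖(chartLin e ν).adjoint (G (chart a e ν x))‖ ^ 2)
        (Metric.isOpen_ball.measurableSet.inter hms) fun x hx => by
          simp only [hg, piecewise_eq_of_mem _ _ _ hx.2]]
      exact ho.setIntegral_adjoint_le hu.2.1 hT hr s1
    · rw [setIntegral_congr_fun
        (g := fun x => ‖(chartLin e (-ν')).adjoint (G (chart a e (-ν') x))‖ ^ 2)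
        (Metric.isOpen_ball.measurableSet.inter hms.compl) fun x hx => by
          simp only [hg, piecewise_eq_of_notMem _ _ _ hx.2]]
      exact ho'.setIntegral_adjoint_le hu.2.1 hT' hr' s2
  have hfi : IntegrableOn (fun x => (f x - c) ^ 2) B := by
    have : IsFiniteMeasure (volume.restrict B) :=
      ⟨by rw [Measure.restrict_apply_univ]; exact measure_ball_lt_top⟩
    have hi : MemLp (fun x => f x - c) 2 (volume.restrict B) := hPG.memLp.sub (memLp_const c)
    exact hi.integrable_sq
  have hbound : ∀ D ⊆ B, ∫ x in D, (f x - c) ^ 2 ≤ 16 * ρ ^ 2 *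
      (∫ x in triangleHull T, ‖G x‖ ^ 2 ∂μHE[2] + ∫ x in triangleHull T', ‖G x‖ ^ 2 ∂μHE[2]) :=
    fun D hD => (setIntegral_mono_set hfi (Eventually.of_forall fun x => sq_nonneg _)
      hD.eventuallyLE).trans (hc.trans (mul_le_mul_of_nonneg_left hgle (by positivity)))
  have hDB : edgeDisc ℓ ρ ⊆ B := edgeDisc_subset_ball ℓ ρ
  refine ⟨c, ?_, ?_⟩
  · refine le_of_eq_of_le (setIntegral_congr_fun Metric.isOpen_ball.measurableSet fun x hx => ?_)
      (hbound _ hDB)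
    simp only [hf, piecewise_eq_of_mem _ _ _
      (show x ∈ upperHalf from (pos_of_mem_edgeDisc hx).le)]
  · have hmeas : MeasurableSet (chart a e ν' '' edgeDisc ℓ ρ) :=
      (ho₁.measurableEmbedding a).measurableSet_image.2 Metric.isOpen_ball.measurableSet
    -- Both charts of the second element carry Lebesgue measure to the same surface measure, so the
    -- disc above the axis may be exchanged for its mirror image, where `f` is given by the second
    -- element.
    have e1 := (ho₁.measurePreserving (a := a) (image_subset_range _ (edgeDisc ℓ ρ))).integral_comp
      (ho₁.measurableEmbedding a) fun x => (u x - c) ^ 2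
    have e2 := (ho'.measurePreserving (a := a) ((image_subset_range _ (edgeDisc ℓ ρ)).trans
      (range_chart_neg a e ν'))).integral_comp (ho'.measurableEmbedding a) fun x => (u x - c) ^ 2
    rw [preimage_image_eq _ (ho₁.isometry a).injective] at e1
    rw [e1, ← e2]
    have hmem : ∀ x ∈ chart a e (-ν') ⁻¹' (chart a e ν' '' edgeDisc ℓ ρ),
        !₂[x 0, -x 1] ∈ edgeDisc ℓ ρ := fun x hx => by
      obtain ⟨y, hy, hyx⟩ := hx
      rw [hneg] at hyx
      rwa [← (ho₁.isometry a).injective hyx]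
    refine le_of_eq_of_le (setIntegral_congr_fun
      ((ho'.isometry a).continuous.measurable hmeas) fun x hx => ?_) (hbound _ ?_)
    · have hx1 := pos_of_mem_edgeDisc (hmem x hx)
      have hxu : x ∉ upperHalf := fun hxu => by
        have : 0 ≤ x 1 := hxu
        simp at hx1
        linarith
      simp only [hf, piecewise_eq_of_notMem _ _ _ hxu]
    · intro x hx
      have hx' : dist !₂[x 0, -x 1] !₂[ℓ / 2, 0] < ρ := hDB (hmem x hx)
      refine lt_of_le_of_lt (le_of_sq_le_sq ?_ dist_nonneg) hx'
      rw [dist_sq_plane, dist_sq_plane]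
      simp

/-- A Courant function is itself Lipschitz on each element, so a constant approximating sequence
does. -/
theorem IsPiecewiseGradient.hasSurfaceGradient {V : EuclideanSpace ℝ (Fin n) → ℝ}
    {H : EuclideanSpace ℝ (Fin n) → EuclideanSpace ℝ (Fin n)} (h : IsMesh 𝒯 S)
    (hV : IsCourant 𝒯 V) (hH : IsPiecewiseGradient 𝒯 V H) : HasSurfaceGradient 𝒯 V H := by
  refine ⟨hV.memLp h 2, hH.memLp, fun _ => V, fun _ => H, fun _ => ⟨hV.1, fun T hT => ?_,
    hH.memLp, fun T hT => ?_⟩, by simp, by simp⟩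
  · obtain ⟨g, -, hg, -⟩ := hH.exists_eq T hT
    refine ⟨‖g‖₊, LipschitzOnWith.of_dist_le_mul fun x hx y hy => ?_⟩
    rw [Real.dist_eq, hg y hy x hx, dist_eq_norm]
    exact abs_real_inner_le_norm _ _
  · obtain ⟨g, hgs, hg, hae⟩ := hH.exists_eq T hT
    filter_upwards [hae, ae_restrict_mem (measurableSet_triangleHull T)] with x hx hxT
    rw [hx]
    refine ⟨hgs, ?_⟩
    have h1 : HasFDerivWithinAt (fun y => inner ℝ g (y - x) + V x) (innerSL ℝ g)
        (triangleHull T) x := by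
      have := ((innerSL ℝ g).hasFDerivAt (x := x)).sub_const (innerSL ℝ g x)
      simpa [inner_sub_right] using (this.add_const (V x)).hasFDerivWithinAt
    rw [hasGradientWithinAt_iff_hasFDerivWithinAt]
    refine HasFDerivWithinAt.congr (f := fun y => inner ℝ g (y - x) + V x) h1 (fun y hy => ?_) ?_
    · show V y = inner ℝ g (y - x) + V x
      rw [← hg x hxT y hy]; ring
    · simp

/-- `H¹`-stability of the `L₂`-projection on surface meshes. -/
theorem IsMesh.isH1StableProjection_surface (h : IsMesh 𝒯 S) (hE : HasEdgeConnectedPatches 𝒯)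
    {M : ℕ} (hM : NodeValenceLE 𝒯 M) {d : EuclideanSpace ℝ (Fin n) → ℝ} {γ C₅ C₆ : ℝ}
    (hγ : 0 < γ) (hsh : IsShapeRegular μHE[2] 𝒯 γ) (hC₅ : C₅ ≤ Real.pi) (hC₆ : 0 < C₆)
    (hd : IsNodalWeight 𝒯 d C₅ C₆) :
    IsH1StableProjection 𝒯 (surfaceMeasure 𝒯) (HasSurfaceGradient 𝒯)
      (stabilityConst γ C₆ (localConst γ) M) := by
  intro u G hu
  refine ⟨h.exists_isL2Projection hu.1, fun V hV => ?_⟩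
  obtain ⟨c, hc⟩ := h.exists_hasLocalEstimates hγ hsh hu.1
    (fun T hT => hu.exists_poincare h hsh hγ hT)
    fun T hT T' hT' _ a b p q e ν ν' ℓ k σ k' σ' hTs hTs' hF hF' ρ hρ hρℓ =>
      hu.exists_poincare_edge h hsh hγ hT hT' hTs hTs' hF hF' hρ hρℓ
  obtain ⟨H, hH, hle⟩ := h.exists_gradient_projection hE hM hsh hC₅ hC₆ hd hu.1 hu.2.1
    (localConst_nonneg hγ) hc hV
  exact ⟨H, hH.hasSurfaceGradient h hV.1, hle⟩

end SurfaceJump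

/-! ### Planar meshes -/

theorem IsOrthonormalPair.eq_or_eq_neg {e ν ν' : Plane} (h : IsOrthonormalPair e ν)
    (h' : IsOrthonormalPair e ν') : ν' = ν ∨ ν' = -ν := by
  have key : ∀ {ν : Plane}, IsOrthonormalPair e ν → ∃ s : ℝ, (s = 1 ∨ s = -1) ∧
      ν 0 = -(s * e 1) ∧ ν 1 = s * e 0 := by
    intro ν h
    have h1 : e 0 ^ 2 + e 1 ^ 2 = 1 := by
      have := EuclideanSpace.norm_sq_eq e
      rw [h.norm_left] at this
      simpa [Fin.sum_univ_two] using this.symm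
    have h2 : ν 0 ^ 2 + ν 1 ^ 2 = 1 := by
      have := EuclideanSpace.norm_sq_eq ν
      rw [h.norm_right] at this
      simpa [Fin.sum_univ_two] using this.symm
    have h3 : e 0 * ν 0 + e 1 * ν 1 = 0 := by
      have := h.orth
      simp [PiLp.inner_apply, Fin.sum_univ_two] at this
      linarith
    -- The sign is the determinant of the pair; its square is `1` by Lagrange's identity.
    refine ⟨e 0 * ν 1 - e 1 * ν 0, mul_self_eq_one_iff.1 ?_, ?_, ?_⟩
    · linear_combination (ν 0 ^ 2 + ν 1 ^ 2) * h1 + h2 - (e 0 * ν 0 + e 1 * ν 1) * h3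
    · linear_combination -ν 0 * h1 + e 0 * h3
    · linear_combination -ν 1 * h1 + e 1 * h3
  obtain ⟨s, hs, h0, h1⟩ := key h
  obtain ⟨s', hs', h0', h1'⟩ := key h'
  have hss : s' = s ∨ s' = -s := by
    rcases hs with rfl | rfl <;> rcases hs' with rfl | rfl <;> simp
  refine hss.imp (fun hs => ?_) fun hs => ?_
  · ext i
    fin_cases i
    · show ν' 0 = ν 0
      rw [h0, h0', hs]
    · show ν' 1 = ν 1
      rw [h1, h1', hs]
  · ext i
    fin_cases i
    · show ν' 0 = -ν 0
      rw [h0, h0', hs]; ring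
    · show ν' 1 = -ν 1
      rw [h1, h1', hs]; ring

theorem IsOrthonormalPair.surjective_chart {e ν : Plane} (h : IsOrthonormalPair e ν) (a : Plane) :
    Function.Surjective (chart a e ν) := by
  intro y
  have hinj : Function.Injective (chartLin e ν).toLinearMap := by
    intro x x' hx
    refine (h.isometry 0).injective ?_
    simpa [chart] using hx
  obtain ⟨x, hx⟩ := LinearMap.injective_iff_surjective.1 hinj (y - a)
  refine ⟨x, ?_⟩
  have : chartLin e ν x = y - a := hx
  rw [chart, this, add_sub_cancel]

section Mesh

variable {n : ℕ} {𝒯 : Finset (Finset (EuclideanSpace ℝ (Fin n)))}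
  {S : Set (EuclideanSpace ℝ (Fin n))}

theorem IsMesh.subset (h : IsMesh 𝒯 S) {𝒯' : Finset (Finset (EuclideanSpace ℝ (Fin n)))}
    (hs : 𝒯' ⊆ 𝒯) : IsMesh 𝒯' (⋃ T ∈ 𝒯', triangleHull T) where
  card_eq T hT := h.card_eq T (hs hT)
  nondegenerate T hT := h.nondegenerate T (hs hT)
  covers := rfl
  regular T hT T' hT' := h.regular T (hs hT) T' (hs hT')

end Mesh

section Planar

variable {𝒯 : Finset (Finset Plane)} {S Ω : Set Plane} {T T' : Finset Plane}

/-- In the plane the number of elements at a node is bounded. -/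
theorem IsMesh.nodeValenceLE_planar (h : IsMesh 𝒯 S) {d : Plane → ℝ} {γ C₅ C₆ : ℝ} (hγ : 0 < γ)
    (hsh : IsShapeRegular μHE[2] 𝒯 γ) (hC₆ : 0 < C₆) (hd : IsNodalWeight 𝒯 d C₅ C₆) :
    NodeValenceLE 𝒯 ⌊Real.pi * C₆ ^ 4 * γ⌋₊ := by
  intro z
  have e : {T | T ∈ 𝒯 ∧ z ∈ T} = (nodePatch 𝒯 z : Set (Finset Plane)) := by
    ext T
    exact mem_nodePatch.symm
  rw [e, ncard_coe_finset]
  refine Nat.le_floor ?_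
  have hm := h.subset (𝒯' := nodePatch 𝒯 z) fun T hT => (mem_nodePatch.1 hT).1
  rcases (nodePatch 𝒯 z).eq_empty_or_nonempty with h0 | ⟨T₀, hT₀⟩
  · rw [h0]
    have := Real.pi_pos
    simp only [Finset.card_empty, Nat.cast_zero]
    positivity
  have hz0 : 0 < d z := hd.pos T₀ (mem_nodePatch.1 hT₀).1 z (mem_nodePatch.1 hT₀).2
  -- All elements at `z` lie in a disc of radius `C₆ d z`, overlap in null sets, and have area at
  -- least `d z² / (C₆² γ)`. Dividing the areas bounds their number by `π C₆⁴ γ`.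
  have hsub : (⋃ T ∈ nodePatch 𝒯 z, triangleHull T) ⊆ Metric.closedBall z (C₆ * d z) := by
    refine iUnion₂_subset fun T hT y hy => ?_
    obtain ⟨hT, hzT⟩ := mem_nodePatch.1 hT
    have h1 := hd.le_div_size T hT z hzT
    rw [le_div_iff₀ (h.isTriangle hT).elementSize_pos, inv_mul_le_iff₀ hC₆] at h1
    exact (dist_le_elementSize hy (subset_triangleHull hzT)).trans h1
  have hsum : ∑ T ∈ nodePatch 𝒯 z, μHE[2].real (triangleHull T) ≤ Real.pi * (C₆ * d z) ^ 2 := by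
    have h1 : (surfaceMeasure (nodePatch 𝒯 z)).real univ
        = ∑ T ∈ nodePatch 𝒯 z, μHE[2].real (triangleHull T) := by
      rw [hm.surfaceMeasure_eq, Measure.real, Measure.finsetSum_apply, ENNReal.toReal_sum]
      · simp [Measure.real]
      · exact fun T hT => by simpa using (hm.isTriangle hT).area_lt_top.ne
    rw [← h1, surfaceMeasure, measureReal_restrict_apply_univ,
      EuclideanSpace.euclideanHausdorffMeasure_eq_volume]
    refine (measureReal_mono hsub measure_closedBall_lt_top.ne).trans (le_of_eq ?_)
    rw [Measure.real, EuclideanSpace.volume_closedBall_fin_two, ENNReal.toReal_mul,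
      ENNReal.toReal_pow, ENNReal.toReal_ofReal (by positivity)]
    simp [mul_comm, Real.pi_pos.le]
  have hlow : ∀ T ∈ nodePatch 𝒯 z, d z ^ 2 / (C₆ ^ 2 * γ) ≤ μHE[2].real (triangleHull T) :=
    fun T hT => by
      obtain ⟨hT, hzT⟩ := mem_nodePatch.1 hT
      have h1 := hd.div_size_le T hT z hzT
      rw [div_le_iff₀ (h.isTriangle hT).elementSize_pos] at h1
      rw [div_le_iff₀ (by positivity)]
      calc d z ^ 2 ≤ (C₆ * elementSize T) ^ 2 := by gcongr
        _ = C₆ ^ 2 * elementSize T ^ 2 := mul_pow _ _ _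
        _ ≤ C₆ ^ 2 * (γ * μHE[2].real (triangleHull T)) := by gcongr; exact hsh T hT
        _ = _ := by ring
  have hcard := Finset.card_nsmul_le_sum _ _ _ hlow
  rw [nsmul_eq_mul] at hcard
  have h2 := hcard.trans hsum
  rw [mul_div_assoc', div_le_iff₀ (by positivity)] at h2
  refine le_of_mul_le_mul_right (h2.trans (le_of_eq ?_)) (show 0 < d z ^ 2 by positivity)
  ring

theorem IsMesh.interior_subset (h : IsMesh 𝒯 (closure Ω)) (hΩ : interior (closure Ω) = Ω)
    (hT : T ∈ 𝒯) : interior (triangleHull T) ⊆ Ω := by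
  rw [← hΩ]
  refine interior_mono ?_
  rw [h.covers]
  exact subset_biUnion_of_mem (u := fun T => triangleHull T) hT

theorem volume_frontier_triangleHull (T : Finset Plane) :
    volume (frontier (triangleHull T)) = 0 :=
  (convex_triangleHull T).addHaar_frontier volume

/-- A point of the closure outside `Ω` cannot be interior to an element, so it lies on the frontier
of one; these frontiers are null by convexity. -/
theorem IsMesh.restrict_eq_surfaceMeasure (h : IsMesh 𝒯 (closure Ω))
    (hΩ : interior (closure Ω) = Ω) : volume.restrict Ω = surfaceMeasure 𝒯 := by
  rw [surfaceMeasure, EuclideanSpace.euclideanHausdorffMeasure_eq_volume, ← h.covers]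
  refine Measure.restrict_congr_set (subset_closure.eventuallyLE.antisymm ?_)
  rw [ae_le_set]
  refine measure_mono_null (t := ⋃ T ∈ 𝒯, frontier (triangleHull T)) ?_
    ((measure_biUnion_null_iff 𝒯.countable_toSet).2 fun T _ => volume_frontier_triangleHull T)
  rintro x ⟨hx, hxΩ⟩
  rw [h.covers] at hx
  simp only [mem_iUnion] at hx ⊢
  obtain ⟨T, hT, hxT⟩ := hx
  exact ⟨T, hT, subset_closure hxT, fun hxi => hxΩ (h.interior_subset hΩ hT hxi)⟩

/-- Poincaré's inequality on the elements of a planar mesh. -/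
theorem HasPlanarGradient.exists_poincare_element (h : IsMesh 𝒯 (closure Ω))
    (hΩ : interior (closure Ω) = Ω) {γ : ℝ} (hsh : IsShapeRegular μHE[2] 𝒯 γ) {u : Plane → ℝ}
    {G : Plane → Plane} (hu : HasPlanarGradient Ω u G) (hT : T ∈ 𝒯) :
    ∃ c : ℝ, ∫ x in triangleHull T, (u x - c) ^ 2 ∂μHE[2]
      ≤ Real.pi * γ * elementSize T ^ 2 * ∫ x in triangleHull T, ‖G x‖ ^ 2 ∂μHE[2] := by
  have ha := (h.isTriangle hT).area_pos
  have hs := hsh T hT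
  simp only [EuclideanSpace.euclideanHausdorffMeasure_eq_volume] at ha hs ⊢
  exact (hu.mono (h.interior_subset hΩ hT)).exists_poincare_of_convex (convex_triangleHull T) ha
    (fun x hx y hy => dist_le_elementSize hx hy) hs

/-- Poincaré's inequality across an edge of a planar mesh. -/
theorem HasPlanarGradient.exists_poincare_edge (h : IsMesh 𝒯 (closure Ω))
    (hΩ : interior (closure Ω) = Ω) {γ : ℝ} (hsh : IsShapeRegular μHE[2] 𝒯 γ) (hγ : 0 < γ)
    {u : Plane → ℝ} {G : Plane → Plane} (hu : HasPlanarGradient Ω u G) (hT : T ∈ 𝒯)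
    (hT' : T' ∈ 𝒯) (hne : T ≠ T') {a b p q e ν ν' : Plane} {ℓ k σ k' σ' : ℝ}
    (hTs : (T : Set Plane) = {a, b, p}) (hTs' : (T' : Set Plane) = {a, b, q})
    (hF : TriangleFrame a b p e ν ℓ k σ) (hF' : TriangleFrame a b q e ν' ℓ k' σ') {ρ : ℝ}
    (hρ : 0 < ρ) (hρℓ : ρ * (2 + γ) = ℓ) : ∃ c : ℝ,
      (∫ x in edgeDisc ℓ ρ, (u (chart a e ν x) - c) ^ 2) ≤ 16 * ρ ^ 2 *
        (∫ x in triangleHull T, ‖G x‖ ^ 2 ∂μHE[2] + ∫ x in triangleHull T', ‖G x‖ ^ 2 ∂μHE[2]) ∧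
      (∫ x in edgeDisc ℓ ρ, (u (chart a e ν' x) - c) ^ 2) ≤ 16 * ρ ^ 2 *
        (∫ x in triangleHull T, ‖G x‖ ^ 2 ∂μHE[2] +
          ∫ x in triangleHull T', ‖G x‖ ^ 2 ∂μHE[2]) := by
  have ho := hF.isOrthonormalPair
  have ho' := hF'.isOrthonormalPair
  have hmem := fun (x : Plane) (hx : dist x !₂[ℓ / 2, 0] < ρ) (hx1 : 0 ≤ x 1) =>
    hF.chart_mem_triangleHull hTs hγ (hsh T hT) hρℓ.le hx hx1
  have hmem' := fun (x : Plane) (hx : dist x !₂[ℓ / 2, 0] < ρ) (hx1 : 0 ≤ x 1) =>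
    hF'.chart_mem_triangleHull hTs' hγ (hsh T' hT') hρℓ.le hx hx1
  -- The elements lie on opposite sides of the edge: with equal normals both would contain the same
  -- disc, but their intersection is null.
  have hνν : ν' = -ν := by
    refine (ho.eq_or_eq_neg ho').resolve_left fun hν => ?_
    subst hν
    have hsub : edgeDisc ℓ ρ ⊆ chart a e ν' ⁻¹' (triangleHull T ∩ triangleHull T') := fun x hx =>
      ⟨hmem x (edgeDisc_subset_ball ℓ ρ hx) (pos_of_mem_edgeDisc hx).le,
        hmem' x (edgeDisc_subset_ball ℓ ρ hx) (pos_of_mem_edgeDisc hx).le⟩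
    have hmp := ho.measurePreserving (a := a)
      (inter_subset_left.trans (hF.subset_range hTs) :
        triangleHull T ∩ triangleHull T' ⊆ range (chart a e ν'))
    have h0 : volume (chart a e ν' ⁻¹' (triangleHull T ∩ triangleHull T')) = 0 := by
      have := hmp.measure_preimage (s := univ) MeasurableSet.univ.nullMeasurableSet
      simpa [h.measure_inter hT hT' hne] using this
    have hpos : 0 < volume (edgeDisc ℓ ρ) := Metric.measure_ball_pos _ _ (by positivity)
    exact hpos.ne' (measure_mono_null hsub h0)
  have hneg : ∀ x : Plane, chart a e ν x = chart a e ν' !₂[x 0, -x 1] := fun x => by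
    rw [hνν, chart_neg_apply]
    congr 1
    ext i
    fin_cases i <;> simp
  set B := Metric.ball (chart a e ν !₂[ℓ / 2, 0]) ρ with hB
  have hBTT : B ⊆ triangleHull T ∪ triangleHull T' := by
    intro y hy
    obtain ⟨x, rfl⟩ := ho.surjective_chart a y
    have hx : dist x !₂[ℓ / 2, 0] < ρ := by
      rw [← (ho.isometry a).dist_eq]
      exact hy
    rcases le_total 0 (x 1) with h1 | h1
    · exact Or.inl (hmem x hx h1)
    · right
      rw [hneg]
      refine hmem' _ (lt_of_le_of_lt (le_of_sq_le_sq ?_ dist_nonneg) hx) (by simpa using h1)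
      rw [dist_sq_plane, dist_sq_plane]
      simp
  -- An open set covered by the two elements lies in the interior of the closure of `Ω`, which is
  -- `Ω`. Without this regularity `Ω` could have a slit along the edge.
  have hBΩ : B ⊆ Ω := by
    rw [← hΩ, h.covers]
    refine interior_maximal (hBTT.trans (union_subset ?_ ?_)) Metric.isOpen_ball
    · exact subset_biUnion_of_mem (u := fun T => triangleHull T) hT
    · exact subset_biUnion_of_mem (u := fun T => triangleHull T) hT'
  have huB := hu.mono hBΩ
  obtain ⟨c, hc⟩ := huB.exists_poincare_ball hρ
  have hG : MemLp G 2 (surfaceMeasure 𝒯) := by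
    rw [← h.restrict_eq_surfaceMeasure hΩ]
    exact hu.memLp_grad
  have hGi := fun {A : Finset Plane} (hA : A ∈ 𝒯) =>
    (hG.mono_measure (restrict_triangleHull_le hA)).integrable_norm_pow (p := 2) (by norm_num)
  simp only [EuclideanSpace.euclideanHausdorffMeasure_eq_volume] at hGi ⊢
  have hgle : ∫ x in B, ‖G x‖ ^ 2 ≤ (∫ x in triangleHull T, ‖G x‖ ^ 2)
      + ∫ x in triangleHull T', ‖G x‖ ^ 2 := by
    have h0 : volume (triangleHull T ∩ triangleHull T') = 0 := by
      have := h.measure_inter hT hT' hne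
      rwa [EuclideanSpace.euclideanHausdorffMeasure_eq_volume] at this
    rw [← setIntegral_union₀ h0 (measurableSet_triangleHull T').nullMeasurableSet (hGi hT)
      (hGi hT')]
    exact setIntegral_mono_set (IntegrableOn.union (hGi hT) (hGi hT'))
      (Eventually.of_forall fun x => sq_nonneg _) hBTT.eventuallyLE
  have hfi : IntegrableOn (fun x => (u x - c) ^ 2) B := by
    have : IsFiniteMeasure (volume.restrict B) :=
      ⟨by rw [Measure.restrict_apply_univ]; exact measure_ball_lt_top⟩
    have hi : MemLp (fun x => u x - c) 2 (volume.restrict B) := huB.memLp.sub (memLp_const c)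
    exact hi.integrable_sq
  have hbound : ∀ ν₀ : Plane, IsOrthonormalPair e ν₀ → ∫ x in edgeDisc ℓ ρ,
      (u (chart a e ν₀ x) - c) ^ 2 ≤ 16 * ρ ^ 2 *
        ((∫ x in triangleHull T, ‖G x‖ ^ 2) + ∫ x in triangleHull T', ‖G x‖ ^ 2) :=
    fun ν₀ ho₀ => by
      have e1 := (ho₀.measurePreserving (a := a)
        (image_subset_range _ (edgeDisc ℓ ρ))).integral_comp
        (ho₀.measurableEmbedding a) fun x => (u x - c) ^ 2
      rw [preimage_image_eq _ (ho₀.isometry a).injective,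
        EuclideanSpace.euclideanHausdorffMeasure_eq_volume] at e1
      rw [e1]
      refine (setIntegral_mono_set hfi (Eventually.of_forall fun x => sq_nonneg _)
        (LE.le.eventuallyLE ?_)).trans
        (hc.trans (mul_le_mul_of_nonneg_left hgle (by positivity)))
      rintro _ ⟨x, hx, rfl⟩
      have hx' := edgeDisc_subset_ball ℓ ρ hx
      rw [hB, Metric.mem_ball, chart_eq_of_axis a e ν ν₀ (by simp), (ho₀.isometry a).dist_eq]
      exact hx'
  exact ⟨c, hbound ν ho, hbound ν' ho'⟩

/-- Balls in `Ω` are convex, so the largest element Lipschitz constant is valid on each of them. Off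
the null frontiers of the elements the function is locally affine, with the piecewise gradient as
classical gradient. -/
theorem IsPiecewiseGradient.hasPlanarGradient (h : IsMesh 𝒯 (closure Ω))
    (hΩ : interior (closure Ω) = Ω) {V : Plane → ℝ} {H : Plane → Plane} (hV : IsCourant 𝒯 V)
    (hH : IsPiecewiseGradient 𝒯 V H) : HasPlanarGradient Ω V H := by
  classical
  have hμ := h.restrict_eq_surfaceMeasure hΩ
  have hex : ∀ T : Finset Plane, ∃ K : NNReal, T ∈ 𝒯 → LipschitzOnWith K V (triangleHull T) :=
    fun T => by
      by_cases hT : T ∈ 𝒯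
      · obtain ⟨g, -, hg, -⟩ := hH.exists_eq T hT
        refine ⟨‖g‖₊, fun _ => LipschitzOnWith.of_dist_le_mul fun x hx y hy => ?_⟩
        rw [Real.dist_eq, hg y hy x hx, dist_eq_norm]
        exact abs_real_inner_le_norm _ _
      · exact ⟨0, fun h => absurd h hT⟩
  choose K hK using hex
  have hsub : Ω ⊆ ⋃ T ∈ 𝒯, triangleHull T := by
    rw [← h.covers]
    exact subset_closure
  refine hasPlanarGradient_of_lipschitz (K := 𝒯.sup K) (hΩ ▸ isOpen_interior)
    (by rw [hμ]; exact hV.memLp h 2) (by rw [hμ]; exact hH.memLp) (fun x r hxr => ?_) ?_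
  · refine lipschitzOnWith_of_finite_closed_cover (s := 𝒯) (S := fun T => triangleHull T)
      (convex_ball x r) (fun T _ => (isCompact_triangleHull T).isClosed) (hxr.trans hsub)
      (hV.1.mono (hxr.trans hsub)) fun T hT => ?_
    exact ((hK T hT).mono inter_subset_left).weaken (Finset.le_sup hT)
  · rw [hμ, surfaceMeasure, ae_restrict_biUnion_finset_iff]
    intro T hT
    obtain ⟨g, -, hg, hae⟩ := hH.exists_eq T hT
    have h0 : ∀ᵐ x ∂(μHE[2] : Measure Plane), x ∉ frontier (triangleHull T) := by
      rw [EuclideanSpace.euclideanHausdorffMeasure_eq_volume]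
      exact measure_eq_zero_iff_ae_notMem.1 (volume_frontier_triangleHull T)
    filter_upwards [hae, ae_restrict_mem (measurableSet_triangleHull T),
      ae_restrict_of_ae h0] with x hx hxT hxf
    have hxi : triangleHull T ∈ 𝓝 x := by
      rw [← mem_interior_iff_mem_nhds]
      by_contra hcon
      exact hxf ⟨subset_closure hxT, hcon⟩
    rw [hx, hasGradientAt_iff_hasFDerivAt]
    have h1 : HasFDerivAt (fun y => inner ℝ g (y - x) + V x) (innerSL ℝ g) x := by
      have := ((innerSL ℝ g).hasFDerivAt (x := x)).sub_const (innerSL ℝ g x)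
      simpa [inner_sub_right] using this.add_const (V x)
    refine HasFDerivAt.congr_of_eventuallyEq h1 (mem_of_superset hxi fun y hy => ?_)
    show V y = inner ℝ g (y - x) + V x
    rw [← hg x hxT y hy]; ring

/-- `H¹`-stability of the `L₂`-projection on planar meshes. -/
theorem IsMesh.isH1StableProjection_planar (h : IsMesh 𝒯 (closure Ω))
    (hΩ : interior (closure Ω) = Ω) (hE : HasEdgeConnectedPatches 𝒯) {d : Plane → ℝ}
    {γ C₅ C₆ : ℝ} (hγ : 0 < γ) (hsh : IsShapeRegular μHE[2] 𝒯 γ) (hC₅ : C₅ ≤ Real.pi)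
    (hC₆ : 0 < C₆) (hd : IsNodalWeight 𝒯 d C₅ C₆) :
    IsH1StableProjection 𝒯 (volume.restrict Ω) (HasPlanarGradient Ω)
      (stabilityConst γ C₆ (localConst γ) ⌊Real.pi * C₆ ^ 4 * γ⌋₊) := by
  have hM := h.nodeValenceLE_planar hγ hsh hC₆ hd
  have hμ := h.restrict_eq_surfaceMeasure hΩ
  intro u G hu
  have huL := hu.memLp
  have hGL := hu.memLp_grad
  rw [hμ] at huL hGL ⊢
  refine ⟨h.exists_isL2Projection huL, fun V hV => ?_⟩
  obtain ⟨c, hc⟩ := h.exists_hasLocalEstimates hγ hsh huL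
    (fun T hT => hu.exists_poincare_element h hΩ hsh hT)
    fun T hT T' hT' hne a b p q e ν ν' ℓ k σ k' σ' hTs hTs' hF hF' ρ hρ hρℓ =>
      hu.exists_poincare_edge h hΩ hsh hγ hT hT' hne hTs hTs' hF hF' hρ hρℓ
  obtain ⟨H, hH, hle⟩ := h.exists_gradient_projection hE hM hsh hC₅ hC₆ hd huL hGL
    (localConst_nonneg hγ) hc hV
  exact ⟨H, hH.hasPlanarGradient h hΩ hV.1, hle⟩

end Planar

/-! ### The stability theorem -/

theorem proposition20 (γ C₅ C₆ : ℝ) (hγ : 0 < γ) (hC₅ : 0 < C₅) (hC₅π : C₅ ≤ Real.pi)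
    (hC₆ : 0 < C₆) :
    -- bounded domains in the plane
    (∃ C₂ : ℝ, 0 < C₂ ∧
      ∀ (Ω : Set (EuclideanSpace ℝ (Fin 2)))
        (𝒯 : Finset (Finset (EuclideanSpace ℝ (Fin 2))))
        (d : EuclideanSpace ℝ (Fin 2) → ℝ),
        IsOpen Ω → IsConnected Ω → Bornology.IsBounded Ω → interior (closure Ω) = Ω →
        IsMesh 𝒯 (closure Ω) → HasEdgeConnectedPatches 𝒯 →
        IsShapeRegular volume 𝒯 γ → IsNodalWeight 𝒯 d C₅ C₆ →
        IsH1StableProjection 𝒯 (volume.restrict Ω) (HasPlanarGradient Ω) C₂) ∧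
    -- parts of the boundary of a bounded domain in space
    (∀ M : ℕ, ∃ C₂ : ℝ, 0 < C₂ ∧
      ∀ (D Γ : Set (EuclideanSpace ℝ (Fin 3)))
        (𝒯 : Finset (Finset (EuclideanSpace ℝ (Fin 3))))
        (d : EuclideanSpace ℝ (Fin 3) → ℝ),
        IsOpen D → IsConnected D → Bornology.IsBounded D → Γ ⊆ frontier D →
        IsMesh 𝒯 Γ → HasEdgeConnectedPatches 𝒯 → NodeValenceLE 𝒯 M →
        IsShapeRegular μHE[2] 𝒯 γ → IsNodalWeight 𝒯 d C₅ C₆ →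
        IsH1StableProjection 𝒯 (surfaceMeasure 𝒯) (HasSurfaceGradient 𝒯) C₂) := by
  -- In the plane the valence is replaced by its bound from comparing areas, so the constant depends
  -- on `γ` and `C₆` alone; of `C₅` only the bound by `π` is used.
  refine ⟨⟨stabilityConst γ C₆ (localConst γ) ⌊Real.pi * C₆ ^ 4 * γ⌋₊, stabilityConst_pos _ _ _ _,
    fun Ω 𝒯 d _ _ _ hΩ h hE hsh hd => ?_⟩, fun M => ⟨stabilityConst γ C₆ (localConst γ) M,
    stabilityConst_pos _ _ _ _, fun D Γ 𝒯 d _ _ _ _ h hE hM hsh hd => ?_⟩⟩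
  · rw [← EuclideanSpace.euclideanHausdorffMeasure_eq_volume] at hsh
    exact h.isH1StableProjection_planar hΩ hE hγ hsh hC₅π hC₆ hd
  · exact h.isH1StableProjection_surface hE hM hγ hsh hC₅π hC₆ hd
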